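/- **Setting.** Let $\Omega\subset\mathbb{R}^N$ be open, bounded and convex. A *two-phase partitioning* of $\Omega$ is a compact embedded $C^2$ hypersurface $M$ of $\mathbb{R}^N$ with $C^2$ boundary $\partial M$ ($M$ may be disconnected), such that $M\setminus\partial M\subset\Omega$, $\partial M\subset\partial\Omega$, $\partial\Omega$ is of class $C^2$ near $\partial M$, and $\Omega\setminus M$ is the disjoint union of two open sets $\Omega_1,\Omega_2$ (the phases), together with the continuous unit normal field $N$ of $M$ that points from $\Omega_1$ into $\Omega_2$. A *variation* is a family $(\xi^t)_{|t|<\delta}$ of diffeomorphisms of $\mathbb{R}^N$, $C^2$ in $(x,t)$, with $\xi^0=\mathrm{id}$ and $\xi^t=\mathrm{id}$ outside a fixed compact set. $M$ is *minimal* in $\Omega$ if $\frac{d}{dt}A(\xi^t(M))\big|_{t=0}=0$ for every variation with $\xi^t(\partial\Omega)=\partial\Omega$ and $|\xi^t(\Omega_j)|=|\Omega_j|$ ($j=1,2$) for all $t$, where $A$ is the $(N-1)$-dimensional area. A minimal two-phase partitioning $M$ of $\Omega$ is *unstable* if there is a $C^1$ function $f$ on $M$ with $\int_M f=0$, $\int_M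 f^2=1$ and $$J_\Omega(f)=\int_M\left(|\mathrm{grad}_M f|^2-|B_M|^2f^2\right)-\int_{\partial M}II_{\partial\Omega}(N,N)\,f^2<0 ,$$ where $J_\Omega(f)$ is the second variation of area, $B_M$ is the second fundamental form of $M$, and $II_{\partial\Omega}$ is the scalar second fundamental form of $\partial\Omega$ with the sign that makes it nonnegative for convex $\Omega$. **Hypothesis (H).** For all sufficiently large $\sigma$ there is a bounded open convex set $\Omega_\sigma$ with $M\setminus\partial M\subset\Omega_\sigma$, $\partial M\subset\partial\Omega_\sigma$, $\partial\Omega_\sigma$ of class $C^2$ near $\partial M$, such that for all $p\in\partial M$ $$T_p\partial\Omega_\sigma=T_p\partial\Omega\quad\text{and}\quad II_{\partial\Omega_\sigma,p}(N_p,N_p)\ge\sigma .$$ **Proposition.** Let $M$ be a minimal two-phase partitioning, with $\partial M\neq\emptyset$, of a bounded open convex set $\Omega\subset\mathbb{R}^N$, and assume that (H) holds. Then there is a bounded open convex set $\Omega^\star\subset\mathbb{R}^N$ for which $M$ is an unstable (in particular minimal) two-phase partitioning. -/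

import Mathlib

open Set Filter Topology MeasureTheory
open scoped RealInnerProductSpace

noncomputable section

/-- Euclidean space `ℝⁿ`. -/
abbrev RN (n : ℕ) : Type := EuclideanSpace ℝ (Fin n)

/-! ### Hypersurfaces with boundary -/

/-- Near `p`, the set `M` is a `C²` hypersurface without boundary. -/
def IsInteriorPoint {n : ℕ} (M : Set (RN n)) (p : RN n) : Prop :=
  ∃ u : RN n → ℝ, ContDiffAt ℝ 2 u p ∧ u p = 0 ∧ fderiv ℝ u p ≠ 0 ∧
    ∀ᶠ x in 𝓝 p, (x ∈ M ↔ u x = 0)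

/-- Near `p`, the set `M` is a `C²` hypersurface with `C²` boundary, and `p` lies on the boundary:
`M` is the part `v ≥ 0` of the hypersurface `u = 0`, with `du`, `dv` independent at `p`. -/
def IsBoundaryPoint {n : ℕ} (M : Set (RN n)) (p : RN n) : Prop :=
  ∃ u v : RN n → ℝ, ContDiffAt ℝ 2 u p ∧ ContDiffAt ℝ 2 v p ∧ u p = 0 ∧ v p = 0 ∧
    LinearIndependent ℝ ![fderiv ℝ u p, fderiv ℝ v p] ∧
    ∀ᶠ x in 𝓝 p, (x ∈ M ↔ u x = 0 ∧ 0 ≤ v x)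

/-- `M` is a (possibly disconnected) compact embedded `C²` hypersurface of `ℝⁿ` with (possibly
empty) `C²` boundary. -/
def IsHypersurface {n : ℕ} (M : Set (RN n)) : Prop :=
  IsCompact M ∧ ∀ p ∈ M, IsInteriorPoint M p ∨ IsBoundaryPoint M p

/-- The manifold boundary `∂M`. -/
def bdry {n : ℕ} (M : Set (RN n)) : Set (RN n) := {p ∈ M | IsBoundaryPoint M p}

/-- `u` is a local `C²` equation at `p` of a hypersurface containing `M` near `p`. -/
def IsLocalEquation {n : ℕ} (M : Set (RN n)) (p : RN n) (u : RN n → ℝ) : Prop :=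
  ContDiffAt ℝ 2 u p ∧ u p = 0 ∧ fderiv ℝ u p ≠ 0 ∧ ∀ᶠ x in 𝓝 p, x ∈ M → u x = 0

open Classical in
/-- Some local equation of `M` at `p`. All the notions derived from it below are independent of
the choice when `M` is a hypersurface with boundary and `p ∈ M`. -/
def localEquation {n : ℕ} (M : Set (RN n)) (p : RN n) : RN n → ℝ :=
  if h : ∃ u, IsLocalEquation M p u then h.choose else 0

/-- The form `D²u(v, w) / |∇u|` at `p`. On `ker du(p)` it is, up to the choice of the sign of the
unit normal, the scalar second fundamental form of the level set of `u` through `p`. -/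
def levelForm {n : ℕ} (u : RN n → ℝ) (p v w : RN n) : ℝ :=
  fderiv ℝ (fderiv ℝ u) p v w / ‖fderiv ℝ u p‖

/-- The tangent space at `p` of the level set of `u` through `p`. -/
def levelTangent {n : ℕ} (u : RN n → ℝ) (p : RN n) : Submodule ℝ (RN n) :=
  LinearMap.ker (fderiv ℝ u p).toLinearMap

/-- The tangent space `T_p M`. -/
def tangentM {n : ℕ} (M : Set (RN n)) (p : RN n) : Submodule ℝ (RN n) :=
  levelTangent (localEquation M p) p

/-- `|B_M|²` at `p`: the squared norm of the second fundamental form of `M`, i.e. the sum of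
the squares of its components in an orthonormal basis of `T_p M`. -/
def normSqB {n : ℕ} (M : Set (RN n)) (p : RN n) : ℝ :=
  ∑ i, ∑ j, levelForm (localEquation M p) p
    (stdOrthonormalBasis ℝ (tangentM M p) i : RN n)
    (stdOrthonormalBasis ℝ (tangentM M p) j : RN n) ^ 2

/-- `N` is a continuous unit normal field on `M`. -/
def IsUnitNormal {n : ℕ} (M : Set (RN n)) (N : RN n → RN n) : Prop :=
  ContinuousOn N M ∧ ∀ p ∈ M, ‖N p‖ = 1 ∧ ∀ v ∈ tangentM M p, ⟪N p, v⟫ = 0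

/-! ### The boundary of the container -/

/-- `ρ` is a `C²` function that defines `Ω` near the boundary point `p`. -/
def IsDefiningFunction {n : ℕ} (Ω : Set (RN n)) (p : RN n) (ρ : RN n → ℝ) : Prop :=
  ContDiffAt ℝ 2 ρ p ∧ ρ p = 0 ∧ fderiv ℝ ρ p ≠ 0 ∧ ∀ᶠ x in 𝓝 p, (x ∈ Ω ↔ ρ x < 0)

/-- `∂Ω` is of class `C²` near `p`. -/
def HasC2BoundaryAt {n : ℕ} (Ω : Set (RN n)) (p : RN n) : Prop :=
  ∃ ρ, IsDefiningFunction Ω p ρ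

open Classical in
/-- Some local defining function of `Ω` at `p`. The tangent space of `∂Ω` and the second
fundamental form of `∂Ω` on it are independent of the choice. -/
def definingFunction {n : ℕ} (Ω : Set (RN n)) (p : RN n) : RN n → ℝ :=
  if h : HasC2BoundaryAt Ω p then h.choose else 0

/-- The tangent space `T_p ∂Ω`. -/
def tangentBd {n : ℕ} (Ω : Set (RN n)) (p : RN n) : Submodule ℝ (RN n) :=
  levelTangent (definingFunction Ω p) p

/-- The scalar second fundamental form `II_{∂Ω,p}(v, w)` for `v, w ∈ T_p ∂Ω`, with respect to
the inner normal; it is nonnegative for convex `Ω`, and equal to `⟪v, w⟫ / R` for a ball of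
radius `R`. -/
def IIbd {n : ℕ} (Ω : Set (RN n)) (p v w : RN n) : ℝ :=
  levelForm (definingFunction Ω p) p v w

/-- `Ω` is a bounded open set that contains `M` with `∂M` on `∂Ω` and the rest of `M` in the
interior, and `∂Ω` is `C²` near `∂M`. -/
structure IsContainer {n : ℕ} (Ω M : Set (RN n)) : Prop where
  isOpen : IsOpen Ω
  isBounded : Bornology.IsBounded Ω
  interior_subset : M \ bdry M ⊆ Ω
  bdry_subset : bdry M ⊆ frontier Ω
  smooth : ∀ p ∈ bdry M, HasC2BoundaryAt Ω p

/-! ### Two-phase partitionings, variations, minimality -/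

/-- `M` is a partitioning of `Ω` into the two phases `Ω₁`, `Ω₂`, and `N` is the unit normal field
of `M` that points from `Ω₁` into `Ω₂`. -/
structure IsPartitioning {n : ℕ} (Ω M : Set (RN n)) (N : RN n → RN n)
    (Ω₁ Ω₂ : Set (RN n)) : Prop where
  hypersurface : IsHypersurface M
  container : IsContainer Ω M
  normal : IsUnitNormal M N
  isOpen₁ : IsOpen Ω₁
  isOpen₂ : IsOpen Ω₂
  disjoint : Disjoint Ω₁ Ω₂
  union : Ω₁ ∪ Ω₂ = Ω \ M
  sides : ∀ p ∈ M \ bdry M, ∀ᶠ t : ℝ in 𝓝[>] 0, p - t • N p ∈ Ω₁ ∧ p + t • N p ∈ Ω₂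

/-- A variation: a `C²` family `ξ t`, `|t| < δ`, of diffeomorphisms of `ℝⁿ` with `ξ 0 = id`, all
equal to the identity outside a compact set. -/
structure IsVariation {n : ℕ} (δ : ℝ) (ξ : ℝ → RN n → RN n) : Prop where
  pos : 0 < δ
  contDiffOn : ContDiffOn ℝ 2 (fun q : ℝ × RN n => ξ q.1 q.2) (Ioo (-δ) δ ×ˢ univ)
  diffeo : ∀ t ∈ Ioo (-δ) δ, ∃ η : RN n → RN n, ContDiff ℝ 2 η ∧
    Function.LeftInverse η (ξ t) ∧ Function.RightInverse η (ξ t)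
  zero : ξ 0 = id
  compact : ∃ K : Set (RN n), IsCompact K ∧ ∀ t ∈ Ioo (-δ) δ, ∀ x ∉ K, ξ t x = x

/-- The variation preserves `∂Ω` and the volumes of the two phases. -/
def IsAdmissible {n : ℕ} (Ω Ω₁ Ω₂ : Set (RN n)) (δ : ℝ) (ξ : ℝ → RN n → RN n) : Prop :=
  IsVariation δ ξ ∧ ∀ t ∈ Ioo (-δ) δ, ξ t '' frontier Ω = frontier Ω ∧
    volume (ξ t '' Ω₁) = volume Ω₁ ∧ volume (ξ t '' Ω₂) = volume Ω₂

/-- The area, i.e. the `(n-1)`-dimensional measure, of a subset of `ℝⁿ`. The Hausdorff measure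
`μHE[d]` is normalized so as to agree with `d`-dimensional volume. -/
def area {n : ℕ} (S : Set (RN n)) : ℝ := (μHE[n - 1] S).toReal

/-- `M` is a minimal two-phase partitioning of `Ω`: a critical point of the area under all
variations that preserve `∂Ω` and the volumes of the phases. -/
structure IsMinimalPartitioning {n : ℕ} (Ω M : Set (RN n)) (N : RN n → RN n)
    (Ω₁ Ω₂ : Set (RN n)) : Prop extends IsPartitioning Ω M N Ω₁ Ω₂ where
  critical : ∀ (δ : ℝ) (ξ : ℝ → RN n → RN n), IsAdmissible Ω Ω₁ Ω₂ δ ξ →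
    HasDerivAt (fun t => area (ξ t '' M)) 0 0

/-! ### Second variation and instability -/

/-- The tangential gradient `grad_M f` at `p`, for `f` defined near `M`. -/
def tangGrad {n : ℕ} (N : RN n → RN n) (f : RN n → ℝ) (p : RN n) : RN n :=
  gradient f p - ⟪gradient f p, N p⟫ • N p

/-- The second variation of area,
`J(f) = ∫_M (|grad_M f|² - |B_M|² f²) - ∫_{∂M} II_{∂Ω}(N, N) f²`. -/
def secondVar {n : ℕ} (Ω M : Set (RN n)) (N : RN n → RN n) (f : RN n → ℝ) : ℝ :=
  (∫ p in M, (‖tangGrad N f p‖ ^ 2 - normSqB M p * f p ^ 2) ∂μHE[n - 1]) -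
    ∫ p in bdry M, IIbd Ω p (N p) (N p) * f p ^ 2 ∂μHE[n - 2]

/-- `M` is an unstable partitioning of `Ω`: it is a minimal partitioning, and the second variation
of area is negative for some normalized `f` of class `C¹` that satisfies the volume constraint.
(The `C¹` functions on `M` are the restrictions of `C¹` functions on `ℝⁿ`.) -/
def IsUnstablePartitioning {n : ℕ} (Ω M : Set (RN n)) (N : RN n → RN n)
    (Ω₁ Ω₂ : Set (RN n)) : Prop :=
  IsMinimalPartitioning Ω M N Ω₁ Ω₂ ∧
    ∃ f : RN n → ℝ, ContDiff ℝ 1 f ∧ (∫ p in M, f p ∂μHE[n - 1]) = 0 ∧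
      (∫ p in M, f p ^ 2 ∂μHE[n - 1]) = 1 ∧ secondVar Ω M N f < 0

/-- Hypothesis (H): for all sufficiently large `σ` there is a convex container `Ωσ` of `M` that
is tangent to `∂Ω` along `∂M` and satisfies `II_{∂Ωσ}(N, N) ≥ σ` there. -/
def HypothesisH {n : ℕ} (Ω M : Set (RN n)) (N : RN n → RN n) : Prop :=
  ∀ᶠ σ : ℝ in atTop, ∃ Ωσ : Set (RN n), Convex ℝ Ωσ ∧ IsContainer Ωσ M ∧
    ∀ p ∈ bdry M, tangentBd Ωσ p = tangentBd Ω p ∧ σ ≤ IIbd Ωσ p (N p) (N p)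

end

/-!
The second variation of `M` in a container `Ω` depends on `Ω` only through the boundary term
`-∫_{∂M} II_{∂Ω}(N, N) f²`. Take `f` to be a multiple of `a - ‖x - p‖²` with `p ∈ ∂M` and `a` such that
`∫_M f = 0` (`IsPartitioning.exists_test_function`); then `∫_{∂M} f² > 0`. In the containers `Ωσ` of
hypothesis (H), the boundary term is at most `-σ ∫_{∂M} f²` (`IsHypersurface.le_integral_IIbd`), so the
second variation is negative for large `σ` (`IsMinimalPartitioning.exists_unstable`). It remains to see
that `M` is a minimal partitioning of `Ωσ`.

*Phases.* A point of `Ωσ` outside the closure of `Ω` is assigned to the phase of `Ω` that is present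
near its radial projection to `∂Ω`, with centre on `M` (`IsPartitioning.exists_of_isContainer`).

*Minimality.* A variation that preserves `∂Ωσ` need not preserve `∂Ω`, so the criticality of `M` in `Ω`
cannot be applied to it. But the area formula (`IsFlatAlong.area_image`) yields the first variations
of area and volume as linear functions of the velocity field `X` (`IsVariation.hasDerivAt_area`,
`IsVariation.hasDerivAt_volume`): the integrals of the tangential divergence over `M`, and of the
divergence over the phase. Call a field balanced if the first variation of area is `l` times that of
the volume of `Ω₁`. There is a Lagrange multiplier `l` for which the fields tangent to `∂Ω` of a
certain kind are balanced (`IsMinimalPartitioning.exists_multiplier`). In place of general flows, the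
proof uses explicit ones: translations, cut off and conjugated with the shears that flatten `∂Ω`
(`IsShearChart.isFlowField`). They change volumes at constant rate, so a combination with zero flux is
an admissible variation without any correction.

Let `X` be the velocity of an admissible variation in `Ωσ`. Along `∂M` it is tangent to `∂Ωσ`, hence to
`∂Ω`, and so it coincides there with a balanced field `Y` (`IsMultiplier.exists_isTame`). The difference
`X - Y` vanishes on `∂M` and may therefore be cut off near `∂M`: a set of codimension two does not
matter for the fluxes (`IsHypersurface.exists_flux_cutoff_le`) nor, as `X - Y` vanishes on it, for the
area (`IsFlatAlong.exists_firstVar_cutoff_le`). What is left can be cut off away from `M` too, because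
fields vanishing near `M` and tangent to the boundary of the container have no flux out of a phase
(`IsPartitioning.integral_divergence_mul_eq_zero`). This leaves a field with compact support in
`Ω ∩ Ωσ`, where the phases coincide, and it is balanced in `Ω`. Thus the first variation of area in the
direction `X` is `l` times the flux of `X` in `Ωσ`, which is zero
(`IsMinimalPartitioning.of_tangent`).

*Orthogonality.* To estimate the boundary term from the pointwise bound, the function `II(N, N)` has to
be integrable on `∂M`. It is continuous and independent of the choice of local equations for `∂Ωσ` if
`N` is tangent to `∂Ωσ` (`IsContainer.continuousOn_IIbd`), i.e. if `M` meets `∂Ω` orthogonally. This is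
the natural boundary condition for minimality. It is obtained without integrating by parts on `M`, from
test fields concentrated at distance `ε` from a point of `∂M`
(`IsBdryChart.fderiv_tangential_eq_zero`, `IsMinimalPartitioning.normal_mem_tangentBd`).
-/

noncomputable section

open scoped NNReal ENNReal Convolution

/-! ### The tangential Jacobian -/

/-- If `g` is `K`-Lipschitz relative to `f` on `S`, then the `d`-dimensional measure of `g '' S`
is at most `K ^ d` times that of `f '' S`. -/
theorem euclideanHausdorffMeasure_image_le_of_dist_le {α X Y : Type*}
    [MetricSpace X] [MeasurableSpace X] [BorelSpace X]
    [MetricSpace Y] [MeasurableSpace Y] [BorelSpace Y] (d : ℕ) {f : α → X} {g : α → Y}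
    {S : Set α} (K : ℝ≥0) (h : ∀ x ∈ S, ∀ y ∈ S, dist (g x) (g y) ≤ K * dist (f x) (f y)) :
    μHE[d] (g '' S) ≤ (K : ℝ≥0∞) ^ d * μHE[d] (f '' S) := by
  rcases S.eq_empty_or_nonempty with rfl | ⟨x₀, hx₀⟩
  · simp
  -- The map `f x ↦ g x` is well defined on `f '' S`, and `K`-Lipschitz.
  have : Nonempty α := ⟨x₀⟩
  have hinv : ∀ y ∈ f '' S, Function.invFunOn f S y ∈ S ∧ f (Function.invFunOn f S y) = y :=
    fun y hy => ⟨Function.invFunOn_mem hy, Function.invFunOn_eq hy⟩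
  have himg : (g ∘ Function.invFunOn f S) '' (f '' S) = g '' S := by
    rw [image_image]
    refine image_congr fun x hx => ?_
    obtain ⟨h1, h2⟩ := hinv (f x) (mem_image_of_mem f hx)
    have := h _ h1 x hx
    rw [h2, dist_self, mul_zero] at this
    exact dist_le_zero.1 this
  have hL : LipschitzOnWith K (g ∘ Function.invFunOn f S) (f '' S) := by
    refine LipschitzOnWith.of_dist_le_mul fun y hy z hz => ?_
    obtain ⟨h1, h2⟩ := hinv y hy
    obtain ⟨h3, h4⟩ := hinv z hz
    have := h _ h1 _ h3
    rwa [h2, h4] at this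
  have := hL.hausdorffMeasure_image_le (d := d) (by positivity)
  rw [himg] at this
  simp only [Measure.euclideanHausdorffMeasure_def, Measure.smul_apply, ENNReal.smul_def, smul_eq_mul]
  rw [ENNReal.rpow_natCast] at this
  calc _ ≤ _ := mul_le_mul_right this _
    _ = _ := by ring

section Jacobian

variable {k : ℕ}

/-- The trace of `B` along the hyperplane orthogonal to the unit vector `ν`. -/
def tanTrace (B : RN (k + 2) →L[ℝ] RN (k + 2)) (ν : RN (k + 2)) : ℝ :=
  LinearMap.trace ℝ _ (B : RN (k + 2) →ₗ[ℝ] RN (k + 2)) - ⟪B ν, ν⟫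

/-- The projection to the hyperplane orthogonal to the unit vector `ν`. -/
def hypProj (ν : RN (k + 2)) (x : RN (k + 2)) : RN (k + 2) := x - ⟪ν, x⟫ • ν

/-- The matrix, in the standard basis, of `Pᵀ Aᵀ A P + ν νᵀ`, where `P` is the projection to the
hyperplane orthogonal to `ν`. -/
def tanGram (A : RN (k + 2) →L[ℝ] RN (k + 2)) (ν : RN (k + 2)) :
    Matrix (Fin (k + 2)) (Fin (k + 2)) ℝ :=
  Matrix.of fun i j => ⟪A (hypProj ν (EuclideanSpace.basisFun _ ℝ i)),
    A (hypProj ν (EuclideanSpace.basisFun _ ℝ j))⟫ +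
      ⟪ν, EuclideanSpace.basisFun _ ℝ i⟫ * ⟪ν, EuclideanSpace.basisFun _ ℝ j⟫

/-- The tangential Jacobian of `A` on the hyperplane orthogonal to the unit vector `ν`. -/
def tanJac (A : RN (k + 2) →L[ℝ] RN (k + 2)) (ν : RN (k + 2)) : ℝ := √(tanGram A ν).det

theorem tanJac_eq (A : RN (k + 2) →L[ℝ] RN (k + 2)) (ν : RN (k + 2)) :
    tanJac A ν = √(tanGram A ν).det := rfl

theorem tanJac_nonneg (A : RN (k + 2) →L[ℝ] RN (k + 2)) (ν : RN (k + 2)) : 0 ≤ tanJac A ν :=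
  Real.sqrt_nonneg _

theorem hypProj_self {ν : RN (k + 2)} (hν : ‖ν‖ = 1) : hypProj ν ν = 0 := by
  simp [hypProj, hν]

theorem hypProj_of_inner_eq_zero {ν x : RN (k + 2)} (h : ⟪ν, x⟫ = 0) : hypProj ν x = x := by
  simp [hypProj, h]

theorem inner_hypProj {ν : RN (k + 2)} (hν : ‖ν‖ = 1) (x : RN (k + 2)) :
    ⟪ν, hypProj ν x⟫ = 0 := by
  simp [hypProj, inner_sub_right, inner_smul_right, hν]

theorem normSq_hypProj {ν : RN (k + 2)} (hν : ‖ν‖ = 1) (x : RN (k + 2)) :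
    ‖hypProj ν x‖ ^ 2 = ‖x‖ ^ 2 - ⟪ν, x⟫ ^ 2 := by
  rw [hypProj, norm_sub_sq_real, norm_smul, hν, inner_smul_right, real_inner_comm]
  simp
  ring

/-- `hypProj` as a linear map. -/
def hypProjL (ν : RN (k + 2)) : RN (k + 2) →ₗ[ℝ] RN (k + 2) where
  toFun := hypProj ν
  map_add' x y := by simp only [hypProj, inner_add_right]; module
  map_smul' c x := by simp only [hypProj, inner_smul_right, RingHom.id_apply]; module

/-- The determinant of `tanGram` can be computed in any orthonormal basis. -/
theorem det_tanGram_eq (A : RN (k + 2) →L[ℝ] RN (k + 2)) (ν : RN (k + 2))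
    (b : OrthonormalBasis (Fin (k + 2)) ℝ (RN (k + 2))) :
    (tanGram A ν).det = (Matrix.of fun i j => ⟪A (hypProj ν (b i)), A (hypProj ν (b j))⟫ +
      ⟪ν, b i⟫ * ⟪ν, b j⟫).det := by
  let C : RN (k + 2) →ₗ[ℝ] RN (k + 2) := A.toLinearMap ∘ₗ hypProjL ν
  let T : RN (k + 2) →ₗ[ℝ] RN (k + 2) := LinearMap.adjoint C ∘ₗ C +
    (innerₛₗ ℝ ν).smulRight ν
  have key : ∀ b' : OrthonormalBasis (Fin (k + 2)) ℝ (RN (k + 2)),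
      (Matrix.of fun i j => ⟪A (hypProj ν (b' i)), A (hypProj ν (b' j))⟫ +
      ⟪ν, b' i⟫ * ⟪ν, b' j⟫) = LinearMap.toMatrix b'.toBasis b'.toBasis T := by
    intro b'
    ext i j
    rw [LinearMap.toMatrix_apply, OrthonormalBasis.coe_toBasis, OrthonormalBasis.coe_toBasis_repr_apply,
      OrthonormalBasis.repr_apply_apply]
    simp only [Matrix.of_apply, T, LinearMap.add_apply, LinearMap.comp_apply, inner_add_right,
      LinearMap.adjoint_inner_right, LinearMap.smulRight_apply, inner_smul_right, innerₛₗ_apply_apply]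
    rw [real_inner_comm (b' i) ν, mul_comm]
    rfl
  rw [tanGram, key, key, LinearMap.det_toMatrix, LinearMap.det_toMatrix]

/-- An orthonormal basis of the hyperplane orthogonal to `ν`, completed by `ν`. -/
theorem exists_orthonormalBasis_cons {ν : RN (k + 2)} (hν : ‖ν‖ = 1) :
    ∃ (b : OrthonormalBasis (Fin (k + 2)) ℝ (RN (k + 2)))
      (c : OrthonormalBasis (Fin (k + 1)) ℝ (ℝ ∙ ν)ᗮ),
      b 0 = ν ∧ ∀ i : Fin (k + 1), b i.succ = (c i : RN (k + 2)) := by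
  have hν0 : ν ≠ 0 := by rintro rfl; simp at hν
  have : Fact (Module.finrank ℝ (RN (k + 2)) = (k + 1) + 1) := ⟨by simp⟩
  have hfin : Module.finrank ℝ (ℝ ∙ ν)ᗮ = k + 1 := Submodule.finrank_orthogonal_span_singleton hν0
  let c : OrthonormalBasis (Fin (k + 1)) ℝ (ℝ ∙ ν)ᗮ :=
    (stdOrthonormalBasis ℝ (ℝ ∙ ν)ᗮ).reindex (finCongr hfin)
  have horth : ∀ i, ⟪ν, (c i : RN (k + 2))⟫ = 0 := fun i =>
    Submodule.mem_orthogonal_singleton_iff_inner_right.1 (c i).2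
  have hon : Orthonormal ℝ (Fin.cons ν fun i => (c i : RN (k + 2)) : Fin (k + 2) → RN (k + 2)) := by
    rw [orthonormal_iff_ite]
    intro i j
    refine Fin.cases ?_ (fun i => ?_) i <;> refine Fin.cases ?_ (fun j => ?_) j
    · simp [hν]
    · simp [horth, (Fin.succ_ne_zero _).symm]
    · simp [real_inner_comm, horth, Fin.succ_ne_zero]
    · have := orthonormal_iff_ite.1 c.orthonormal i j
      simpa [Fin.cons_succ] using this
  refine ⟨OrthonormalBasis.mk hon ?_, c, by rw [OrthonormalBasis.coe_mk]; rfl,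
    fun i => by rw [OrthonormalBasis.coe_mk]; rfl⟩
  rw [hon.linearIndependent.span_eq_top_of_card_eq_finrank (by simp)]

/-- The tangential Jacobian is the factor by which `A`, restricted to the hyperplane orthogonal to
`ν`, multiplies volume. -/
theorem tanJac_eq_normDet (A : RN (k + 2) →L[ℝ] RN (k + 2)) {ν : RN (k + 2)} (hν : ‖ν‖ = 1) :
    tanJac A ν = (A.toLinearMap ∘ₗ (ℝ ∙ ν)ᗮ.subtype).normDet := by
  obtain ⟨b, c, hb0, hbs⟩ := exists_orthonormalBasis_cons hν
  have horth : ∀ i, ⟪ν, (c i : RN (k + 2))⟫ = 0 := fun i =>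
    Submodule.mem_orthogonal_singleton_iff_inner_right.1 (c i).2
  have h := LinearMap.normDet_sq_eq_det_gram (A.toLinearMap ∘ₗ (ℝ ∙ ν)ᗮ.subtype) c
  rw [tanJac, det_tanGram_eq A ν b, Matrix.det_succ_row_zero, Fin.sum_univ_succ]
  rw [Finset.sum_eq_zero]
  · simp only [Matrix.of_apply, hb0, hypProj_self hν, map_zero, inner_zero_left,
      real_inner_self_eq_norm_sq, hν]
    rw [show (Matrix.of fun i j => ⟪A (hypProj ν (b i)), A (hypProj ν (b j))⟫ +
      ⟪ν, b i⟫ * ⟪ν, b j⟫).submatrix Fin.succ (Fin.succAbove 0) = Matrix.gram ℝ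
        (fun i => (A.toLinearMap ∘ₗ (ℝ ∙ ν)ᗮ.subtype) (c i)) from ?_]
    · simp only [RCLike.ofReal_real_eq_id, id_eq] at h
      simp
      rw [show (Matrix.gram ℝ fun i => A (c i : RN (k+2))).det = _ from h.symm,
        Real.sqrt_sq (LinearMap.normDet_nonneg _)]
    · ext i j
      simp [hbs, horth, hypProj_of_inner_eq_zero, Matrix.gram]
  · intro i _
    simp [hb0, hbs, hypProj_self hν, horth]

/-- The tangential trace, computed by projecting the standard basis vectors to the hyperplane. -/
theorem tanTrace_eq_sum (B : RN (k + 2) →L[ℝ] RN (k + 2)) {ν : RN (k + 2)} (hν : ‖ν‖ = 1) :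
    tanTrace B ν = ∑ i, ⟪hypProj ν (EuclideanSpace.basisFun (Fin (k+2)) ℝ i),
      B (hypProj ν (EuclideanSpace.basisFun _ ℝ i))⟫ := by
  set e := EuclideanSpace.basisFun (Fin (k+2)) ℝ
  have h1 : ∑ i, ⟪ν, e i⟫ • e i = ν := by
    simpa [real_inner_comm] using e.sum_repr' ν
  have h2 : ∀ z, ∑ i, ⟪ν, e i⟫ * ⟪e i, z⟫ = ⟪ν, z⟫ := fun z => by
    conv_rhs => rw [← h1, sum_inner]
    simp [inner_smul_left]
  have h3 : ∀ z, ∑ i, ⟪ν, e i⟫ * ⟪z, B (e i)⟫ = ⟪z, B ν⟫ := fun z => by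
    conv_rhs => rw [← h1, map_sum, inner_sum]
    simp [inner_smul_right]
  have h4 : ∑ i, ⟪ν, e i⟫ * ⟪ν, e i⟫ = 1 := by
    have := h2 ν
    simp only [real_inner_self_eq_norm_sq, hν] at this
    rw [one_pow] at this
    exact (Finset.sum_congr rfl fun i _ => by rw [real_inner_comm ν (e i)]).trans this
  rw [tanTrace, LinearMap.trace_eq_sum_inner _ e]
  have : ∀ i, ⟪hypProj ν (e i), B (hypProj ν (e i))⟫ = ⟪e i, B (e i)⟫ - ⟪ν, e i⟫ * ⟪e i, B ν⟫
      - ⟪ν, e i⟫ * ⟪ν, B (e i)⟫ + ⟪ν, e i⟫ * ⟪ν, e i⟫ * ⟪ν, B ν⟫ := fun i => by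
    simp only [hypProj, map_sub, map_smul, inner_sub_left, inner_sub_right, inner_smul_left,
      inner_smul_right]
    simp; ring
  simp_rw [this, Finset.sum_add_distrib, Finset.sum_sub_distrib, ← Finset.sum_mul, h4, h2, h3,
    real_inner_comm]
  simp

theorem contDiff_det {m : ℕ} {r : WithTop ℕ∞} :
    ContDiff ℝ r (fun M : Fin m → Fin m → ℝ => (Matrix.of M).det) := by
  simp only [Matrix.det_apply, Matrix.of_apply]
  refine ContDiff.sum fun σ _ => ContDiff.const_smul _ (contDiff_prod fun i _ => ?_)
  fun_prop

/-- The derivative of the determinant at the identity matrix is the trace. -/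
theorem fderiv_det_one {m : ℕ} (H : Fin m → Fin m → ℝ) :
    fderiv ℝ (fun M : Fin m → Fin m → ℝ => (Matrix.of M).det) (1 : Matrix (Fin m) (Fin m) ℝ) H =
      (Matrix.of H).trace := by
  have h1 : HasFDerivAt (fun M : Fin m → Fin m → ℝ => (Matrix.of M).det)
      (fderiv ℝ (fun M : Fin m → Fin m → ℝ => (Matrix.of M).det) (1 : Matrix (Fin m) (Fin m) ℝ))
      (1 : Matrix (Fin m) (Fin m) ℝ) :=
    ((contDiff_det (r := 1)).differentiable (by simp) _).hasFDerivAt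
  have h2 : HasDerivAt (fun (s : ℝ) (i j : Fin m) => (1 : Matrix (Fin m) (Fin m) ℝ) i j + s * H i j)
      H 0 := by
    refine hasDerivAt_pi.2 fun i => hasDerivAt_pi.2 fun j => ?_
    simpa using ((hasDerivAt_id (0 : ℝ)).mul_const (H i j)).const_add
      ((1 : Matrix (Fin m) (Fin m) ℝ) i j)
  have h3 := HasFDerivAt.comp_hasDerivAt_of_eq (0 : ℝ) h1 h2 (by
    funext i j; simp)
  have h4 : HasDerivAt (fun s : ℝ => 1 + (Matrix.of H).trace * s +
      ((1 + (Polynomial.X : Polynomial ℝ) • (Matrix.of H).map Polynomial.C).det.divX.divX).eval s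
        * s ^ 2)
      ((Matrix.of H).trace) 0 := by
    have := ((hasDerivAt_id (0 : ℝ)).const_mul (Matrix.of H).trace).const_add 1 |>.add
      ((Polynomial.hasDerivAt
        ((1 + (Polynomial.X : Polynomial ℝ) • (Matrix.of H).map Polynomial.C).det.divX.divX)
        (0 : ℝ)).mul ((hasDerivAt_id (0 : ℝ)).pow 2))
    simp only [id, mul_one] at this
    refine (this.congr_deriv (by simp)).congr_of_eventuallyEq (Eventually.of_forall fun s => ?_)
    simp
  refine h3.unique (h4.congr_of_eventuallyEq (Eventually.of_forall fun s => ?_))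
  exact Matrix.det_one_add_smul s (Matrix.of H)

theorem contDiff_hypProj {r : WithTop ℕ∞} (x : RN (k + 2)) :
    ContDiff ℝ r (fun ν : RN (k + 2) => hypProj ν x) := by
  unfold hypProj
  exact contDiff_const.sub ((contDiff_id.inner ℝ contDiff_const).smul contDiff_id)

theorem contDiff_tanGram {r : WithTop ℕ∞} (i j : Fin (k + 2)) :
    ContDiff ℝ r (fun p : (RN (k + 2) →L[ℝ] RN (k + 2)) × RN (k + 2) => tanGram p.1 p.2 i j) := by
  unfold tanGram
  simp only [Matrix.of_apply]
  have h : ∀ x : RN (k + 2), ContDiff ℝ r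
      (fun p : (RN (k + 2) →L[ℝ] RN (k + 2)) × RN (k + 2) => p.1 (hypProj p.2 x)) := fun x =>
    contDiff_fst.clm_apply ((contDiff_hypProj x).comp contDiff_snd)
  refine ContDiff.add (ContDiff.inner ℝ (h _) (h _)) ?_
  exact (contDiff_snd.inner ℝ contDiff_const).mul (contDiff_snd.inner ℝ contDiff_const)

theorem contDiff_det_tanGram {r : WithTop ℕ∞} :
    ContDiff ℝ r
      (fun p : (RN (k + 2) →L[ℝ] RN (k + 2)) × RN (k + 2) => (tanGram p.1 p.2).det) :=
  contDiff_det.comp (contDiff_pi.2 fun i => contDiff_pi.2 fun j => contDiff_tanGram i j)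

theorem tanJac_pos {A : RN (k + 2) →L[ℝ] RN (k + 2)} {ν : RN (k + 2)} (hν : ‖ν‖ = 1)
    (hA : Function.Injective A) : 0 < tanJac A ν := by
  refine lt_of_le_of_ne (Real.sqrt_nonneg _) (Ne.symm ?_)
  rw [tanJac_eq_normDet _ hν, Ne, LinearMap.normDet_eq_zero_iff_ker_ne_bot, not_not,
    LinearMap.ker_eq_bot]
  exact hA.comp Subtype.val_injective

theorem det_tanGram_pos {A : RN (k + 2) →L[ℝ] RN (k + 2)} {ν : RN (k + 2)} (hν : ‖ν‖ = 1)
    (hA : Function.Injective A) : 0 < (tanGram A ν).det :=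
  Real.sqrt_pos.1 (tanJac_pos hν hA)

theorem continuous_tanJac :
    Continuous (fun p : (RN (k + 2) →L[ℝ] RN (k + 2)) × RN (k + 2) => tanJac p.1 p.2) :=
  Real.continuous_sqrt.comp (contDiff_det_tanGram (r := 1)).continuous

theorem tanGram_id {ν : RN (k + 2)} (hν : ‖ν‖ = 1) :
    tanGram (ContinuousLinearMap.id ℝ (RN (k + 2))) ν = 1 := by
  ext i j
  set e := EuclideanSpace.basisFun (Fin (k + 2)) ℝ with he
  simp only [tanGram, Matrix.of_apply, ContinuousLinearMap.id_apply, ← he]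
  have h1 : ⟪hypProj ν (e i), hypProj ν (e j)⟫ = ⟪e i, e j⟫ - ⟪ν, e i⟫ * ⟪ν, e j⟫ := by
    simp only [hypProj, inner_sub_left, inner_sub_right, inner_smul_left, inner_smul_right,
      real_inner_self_eq_norm_sq, hν, real_inner_comm ν (e i)]
    simp
  rw [h1, sub_add_cancel, orthonormal_iff_ite.1 e.orthonormal, Matrix.one_apply]

/-- The derivative of the squared tangential Jacobian at the identity is twice the tangential
trace. -/
theorem fderiv_det_tanGram_id (B : RN (k + 2) →L[ℝ] RN (k + 2)) {ν : RN (k + 2)} (hν : ‖ν‖ = 1) :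
    fderiv ℝ (fun p : (RN (k + 2) →L[ℝ] RN (k + 2)) × RN (k + 2) => (tanGram p.1 p.2).det)
      (ContinuousLinearMap.id ℝ (RN (k + 2)), ν) (B, 0) = 2 * tanTrace B ν := by
  set e := EuclideanSpace.basisFun (Fin (k + 2)) ℝ with he
  set I := ContinuousLinearMap.id ℝ (RN (k + 2))
  have h1 := ((contDiff_det_tanGram (k := k) (r := 1)).differentiable (by simp)
    (I, ν)).hasFDerivAt
  have h2 : HasDerivAt (fun s : ℝ => (I + s • B, ν)) (B, 0) 0 := by
    refine HasDerivAt.prodMk ?_ (hasDerivAt_const _ _)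
    simpa using ((hasDerivAt_id (0 : ℝ)).smul_const B).const_add I
  have h3 := HasFDerivAt.comp_hasDerivAt_of_eq (0 : ℝ) h1 h2
    (by rw [zero_smul ℝ B, add_zero])
  let H : Fin (k + 2) → Fin (k + 2) → ℝ := fun i j =>
    ⟪hypProj ν (e i), B (hypProj ν (e j))⟫ + ⟪B (hypProj ν (e i)), hypProj ν (e j)⟫
  have h4 : HasDerivAt (fun s : ℝ => (tanGram (I + s • B) ν : Fin (k + 2) → Fin (k + 2) → ℝ)) H 0 := by
    refine hasDerivAt_pi.2 fun i => hasDerivAt_pi.2 fun j => ?_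
    simp only [tanGram, Matrix.of_apply, ← he]
    refine HasDerivAt.add_const _ ?_
    have h5 : ∀ x : RN (k + 2), HasDerivAt (fun s : ℝ => (I + s • B) x) (B x) 0 := fun x => by
      simpa using ((hasDerivAt_id (0 : ℝ)).smul_const (B x)).const_add (I x)
    simpa [H, I] using (h5 (hypProj ν (e i))).inner ℝ (h5 (hypProj ν (e j)))
  have h6 : HasFDerivAt (fun M : Fin (k + 2) → Fin (k + 2) → ℝ => (Matrix.of M).det)
      (fderiv ℝ (fun M : Fin (k + 2) → Fin (k + 2) → ℝ => (Matrix.of M).det)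
        (1 : Matrix (Fin (k + 2)) (Fin (k + 2)) ℝ)) (1 : Matrix (Fin (k + 2)) (Fin (k + 2)) ℝ) :=
    ((contDiff_det (r := 1)).differentiable (by simp) _).hasFDerivAt
  have h7 := HasFDerivAt.comp_hasDerivAt_of_eq (0 : ℝ) h6 h4
    (by
      have : I + (0 : ℝ) • B = I := by rw [zero_smul ℝ B, add_zero]
      exact ((congrArg (fun A => tanGram A ν) this).trans (tanGram_id hν)).symm)
  refine (h3.unique h7).trans ?_
  rw [fderiv_det_one, tanTrace_eq_sum B hν, Matrix.trace, Finset.mul_sum]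
  refine Finset.sum_congr rfl fun i _ => ?_
  simp only [Matrix.diag_apply, Matrix.of_apply, H, ← he]
  rw [real_inner_comm]; ring

theorem ContinuousOn.tanJac_prod {X : Type*} [TopologicalSpace X] {s : Set X}
    {B : X → (RN (k + 2) →L[ℝ] RN (k + 2)) × RN (k + 2)} (hB : ContinuousOn B s) :
    ContinuousOn (fun x => tanJac (B x).1 (B x).2) s :=
  continuous_tanJac.comp_continuousOn hB

theorem ContinuousOn.tanJac' {X : Type*} [TopologicalSpace X] {s : Set X}
    {A : X → RN (k + 2) →L[ℝ] RN (k + 2)} {ν : X → RN (k + 2)} (hA : ContinuousOn A s)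
    (hν : ContinuousOn ν s) : ContinuousOn (fun x => tanJac (A x) (ν x)) s :=
  ContinuousOn.tanJac_prod (B := fun x => (A x, ν x)) (hA.prodMk hν)

attribute [irreducible] tanGram tanJac

end Jacobian

/-! ### The area formula -/

/-- A comparison of two measures on small measurable subsets of a compact set is a comparison on
the whole set. -/
theorem IsCompact.measure_le_mul_of_local {X : Type*} [TopologicalSpace X] [MeasurableSpace X]
    [OpensMeasurableSpace X] {K : Set X} (hK : IsCompact K) (hKm : MeasurableSet K)
    {μ₁ μ₂ : Measure X} {C : ℝ≥0∞}
    (h : ∀ p ∈ K, ∃ U ∈ 𝓝 p, ∀ S ⊆ K ∩ U, MeasurableSet S → μ₁ S ≤ C * μ₂ S) :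
    μ₁ K ≤ C * μ₂ K := by
  choose! U hU hle using h
  obtain ⟨t, htK, ht⟩ := hK.elim_nhds_subcover (fun p => interior (U p))
    fun p hp => interior_mem_nhds.2 (hU p hp)
  have key : ∀ s : Finset X, (∀ p ∈ s, p ∈ K) → ∀ S ⊆ K ∩ ⋃ p ∈ s, interior (U p),
      MeasurableSet S → μ₁ S ≤ C * μ₂ S := by
    classical
    intro s
    induction s using Finset.induction_on with
    | empty =>
      intro _ S hS _
      have : S = ∅ := by simpa using hS
      simp [this]
    | insert a s ha ih =>
      intro hs S hS hSm
      have h1 := hle a (hs a (Finset.mem_insert_self _ _)) (S ∩ interior (U a))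
        (fun x hx => ⟨(hS hx.1).1, interior_subset hx.2⟩) (hSm.inter isOpen_interior.measurableSet)
      have h2 := ih (fun p hp => hs p (Finset.mem_insert_of_mem hp)) (S \ interior (U a))
        (fun x hx => ⟨(hS hx.1).1, by
          have := (hS hx.1).2
          rw [Finset.set_biUnion_insert] at this
          exact this.resolve_left hx.2⟩) (hSm.diff isOpen_interior.measurableSet)
      rw [← measure_inter_add_sdiff S (isOpen_interior (s := U a)).measurableSet,
        ← measure_inter_add_sdiff (μ := μ₂) S (isOpen_interior (s := U a)).measurableSet, mul_add]
      exact add_le_add h1 h2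
  exact key t htK K (fun x hx => ⟨hx, ht hx⟩) hKm

section Area

variable {k : ℕ}

/-- `M` is a compact set, and `ν` is a continuous unit field on `M` to which `M` is orthogonal to
first order: secants of `M` near `p` are almost orthogonal to `ν p`. -/
structure IsFlatAlong (M : Set (RN (k + 2))) (ν : RN (k + 2) → RN (k + 2)) : Prop where
  isCompact : IsCompact M
  continuousOn : ContinuousOn ν M
  norm_eq : ∀ p ∈ M, ‖ν p‖ = 1
  flat : ∀ p ∈ M, ∀ ε > 0, ∃ U ∈ 𝓝 p, ∀ x ∈ M ∩ U, ∀ y ∈ M ∩ U,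
    |⟪ν p, x - y⟫| ≤ ε * ‖x - y‖

theorem hypProj_sub (ν x y : RN (k + 2)) : hypProj ν x - hypProj ν y = hypProj ν (x - y) :=
  ((hypProjL ν).map_sub x y).symm

theorem norm_hypProj_le {ν : RN (k + 2)} (hν : ‖ν‖ = 1) (x : RN (k + 2)) :
    ‖hypProj ν x‖ ≤ ‖x‖ := by
  refine le_of_sq_le_sq ?_ (norm_nonneg _)
  rw [normSq_hypProj hν]
  nlinarith [sq_nonneg ⟪ν, x⟫]

theorem norm_sub_hypProj {ν : RN (k + 2)} (hν : ‖ν‖ = 1) (x : RN (k + 2)) :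
    ‖x - hypProj ν x‖ = |⟪ν, x⟫| := by
  rw [hypProj, sub_sub_cancel, norm_smul, hν, mul_one, Real.norm_eq_abs]

/-- The projection of `S` lies in the hyperplane orthogonal to `ν`; so its measure can be computed
in that hyperplane, an inner product space of dimension `k + 1`. -/
theorem exists_image_val_eq_image_hypProj {ν : RN (k + 2)} (hν : ‖ν‖ = 1)
    (S : Set (RN (k + 2))) : ∃ S' : Set (ℝ ∙ ν)ᗮ, Subtype.val '' S' = hypProj ν '' S := by
  refine ⟨{z | (z : RN (k + 2)) ∈ hypProj ν '' S}, ?_⟩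
  ext z
  constructor
  · rintro ⟨w, hw, rfl⟩; exact hw
  · intro hz
    refine ⟨⟨z, ?_⟩, hz, rfl⟩
    obtain ⟨x, _, rfl⟩ := hz
    exact Submodule.mem_orthogonal_singleton_iff_inner_right.2 (inner_hypProj hν x)

/-- Change of variables for the linear map `A` on the hyperplane orthogonal to `ν`. -/
theorem euclideanHausdorffMeasure_image_hypProj (A : RN (k + 2) →L[ℝ] RN (k + 2))
    {ν : RN (k + 2)} (hν : ‖ν‖ = 1) (S : Set (RN (k + 2))) :
    μHE[k + 1] ((fun x => A (hypProj ν x)) '' S) =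
      ENNReal.ofReal (tanJac A ν) * μHE[k + 1] (hypProj ν '' S) := by
  have hν0 : ν ≠ 0 := by rintro rfl; simp at hν
  have : Fact (Module.finrank ℝ (RN (k + 2)) = (k + 1) + 1) := ⟨by simp⟩
  have hfin : Module.finrank ℝ (ℝ ∙ ν)ᗮ = k + 1 := Submodule.finrank_orthogonal_span_singleton hν0
  obtain ⟨S', hS'⟩ := exists_image_val_eq_image_hypProj hν S
  have h1 := LinearMap.euclideanHausdorffMeasure_image (A.toLinearMap ∘ₗ (ℝ ∙ ν)ᗮ.subtype) S'
  rw [hfin, ← tanJac_eq_normDet A hν] at h1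
  have h2 : (fun x => A (hypProj ν x)) '' S = (A.toLinearMap ∘ₗ (ℝ ∙ ν)ᗮ.subtype) '' S' := by
    rw [← Function.comp_def, image_comp, ← hS', ← image_comp]
    rfl
  rw [h2, h1, ← hS', isometry_subtype_coe.euclideanHausdorffMeasure_image]

/-- Near a point of `M`, a `C¹` map with injective derivative stretches the area of subsets of `M`
by its tangential Jacobian, up to a factor close to one. -/
theorem IsFlatAlong.area_image_local {M : Set (RN (k + 2))} {ν : RN (k + 2) → RN (k + 2)}
    (hM : IsFlatAlong M ν) {f : RN (k + 2) → RN (k + 2)} {p : RN (k + 2)} (hp : p ∈ M)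
    {A : RN (k + 2) →L[ℝ] RN (k + 2)} (hf : HasStrictFDerivAt f A p)
    (hA : Function.Injective A) {c : ℝ≥0} (hc : 1 < c) :
    ∃ U ∈ 𝓝 p, ∀ S ⊆ M ∩ U,
      μHE[k + 1] (f '' S) ≤ c ^ (k + 1) * (ENNReal.ofReal (tanJac A (ν p)) * μHE[k + 1] S) ∧
      ENNReal.ofReal (tanJac A (ν p)) * μHE[k + 1] S ≤
        (c ^ (k + 1)) ^ 2 * μHE[k + 1] (f '' S) := by
  have hν := hM.norm_eq p hp
  set n := ν p
  obtain ⟨a, ha, haA⟩ : ∃ a : ℝ, 0 < a ∧ ∀ v, a * ‖v‖ ≤ ‖A v‖ := by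
    obtain ⟨K, hK, hKA⟩ := (A : RN (k + 2) →ₗ[ℝ] RN (k + 2)).exists_antilipschitzWith
      (LinearMap.ker_eq_bot.2 hA)
    refine ⟨(K : ℝ)⁻¹, by positivity, fun v => ?_⟩
    have := hKA.le_mul_dist v 0
    simp only [dist_zero_right, map_zero] at this
    rw [inv_mul_le_iff₀ (by positivity)]
    simpa using this
  have hc' : (1 : ℝ) < c := by exact_mod_cast hc
  -- the tolerance: all relative errors below are at most `1 - 1 / c`
  set η : ℝ := 1 - 1 / c with hη
  have hη0 : 0 < η := by
    rw [hη, sub_pos, div_lt_one (by positivity)]; exact hc'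
  have hη1 : c * (1 - η) = 1 := by rw [hη]; field_simp; ring
  have hη2 : 1 + η ≤ c := by nlinarith
  -- Both the deviation of `S` from the hyperplane and that of `f` from `A` are at most `ε`,
  -- relative to `‖x - y‖`; with `‖A v‖ ≥ a ‖v‖`, the choice of `ε` turns this into errors relative
  -- to the images.
  set ε : ℝ := min (min η (1 / 2)) (η * (a / 2) / (1 + ‖A‖)) with hε
  have hε0 : 0 < ε := by positivity
  have hεη : ε ≤ η := (min_le_left _ _).trans (min_le_left _ _)
  have hε2 : ε ≤ 1 / 2 := (min_le_left _ _).trans (min_le_right _ _)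
  have hε3 : (1 + ‖A‖) * ε ≤ η * (a / 2) := by
    rw [mul_comm, ← le_div_iff₀ (by positivity)]; exact min_le_right _ _
  obtain ⟨U, hU, hflat⟩ := hM.flat p hp ε hε0
  obtain ⟨V, hV, hapx⟩ := hf.approximates_deriv_on_nhds (c := ⟨ε, hε0.le⟩) (Or.inr hε0)
  refine ⟨U ∩ V, inter_mem hU hV, fun S hS => ?_⟩
  have hw : ∀ x ∈ S, ∀ y ∈ S, |⟪n, x - y⟫| ≤ ε * ‖x - y‖ := fun x hx y hy =>
    hflat x ⟨(hS hx).1, (hS hx).2.1⟩ y ⟨(hS hy).1, (hS hy).2.1⟩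
  have hπ : ∀ x ∈ S, ∀ y ∈ S, (1 - ε) * ‖x - y‖ ≤ ‖hypProj n (x - y)‖ := fun x hx y hy => by
    have h1 := norm_sub_norm_le (x - y) (hypProj n (x - y))
    rw [norm_sub_hypProj hν] at h1
    linarith [hw x hx y hy]
  have hD : ∀ x ∈ S, ∀ y ∈ S,
      ‖(f x - f y) - A (hypProj n (x - y))‖ ≤ η * ‖A (hypProj n (x - y))‖ := by
    intro x hx y hy
    have h1 : ‖f x - f y - A (x - y)‖ ≤ ε * ‖x - y‖ := hapx x (hS hx).2.2 y (hS hy).2.2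
    have h2 : ‖A ((x - y) - hypProj n (x - y))‖ ≤ ‖A‖ * (ε * ‖x - y‖) := by
      refine (A.le_opNorm _).trans (mul_le_mul_of_nonneg_left ?_ (norm_nonneg _))
      rw [norm_sub_hypProj hν]; exact hw x hx y hy
    have h3 : ‖(f x - f y) - A (hypProj n (x - y))‖ ≤ (1 + ‖A‖) * ε * ‖x - y‖ := by
      calc _ = ‖(f x - f y - A (x - y)) + A ((x - y) - hypProj n (x - y))‖ := by
            rw [map_sub A (x - y) (hypProj n (x - y))]; congr 1; abel
        _ ≤ _ := (norm_add_le _ _).trans (by linarith)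
    have h4 : a / 2 * ‖x - y‖ ≤ ‖A (hypProj n (x - y))‖ := by
      refine le_trans ?_ (haA _)
      have h5 : 1 / 2 * ‖x - y‖ ≤ ‖hypProj n (x - y)‖ := by
        refine le_trans ?_ (hπ x hx y hy)
        gcongr
        linarith
      calc a / 2 * ‖x - y‖ = a * (1 / 2 * ‖x - y‖) := by ring
        _ ≤ _ := by gcongr
    calc _ ≤ (1 + ‖A‖) * ε * ‖x - y‖ := h3
      _ ≤ η * (a / 2) * ‖x - y‖ := by gcongr
      _ ≤ _ := by rw [mul_assoc]; gcongr
  -- On `S`, the distances of the points `f x` and of the points `A (hypProj n x)` agree up to the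
  -- factor `c`, and so do those of the points `x` and `hypProj n x`. Therefore `f` multiplies area
  -- approximately as `A` does on the hyperplane orthogonal to `n`.
  have e1 : ∀ x ∈ S, ∀ y ∈ S, dist (f x) (f y) ≤
      c * dist (A (hypProj n x)) (A (hypProj n y)) := by
    intro x hx y hy
    rw [dist_eq_norm, dist_eq_norm, ← map_sub, hypProj_sub]
    have h1 := hD x hx y hy
    have h2 := norm_sub_norm_le (f x - f y) (A (hypProj n (x - y)))
    nlinarith [norm_nonneg (A (hypProj n (x - y)))]
  have e2 : ∀ x ∈ S, ∀ y ∈ S, dist (A (hypProj n x)) (A (hypProj n y)) ≤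
      c * dist (f x) (f y) := by
    intro x hx y hy
    rw [dist_eq_norm, dist_eq_norm, ← map_sub, hypProj_sub]
    have h1 := hD x hx y hy
    have h2 := norm_sub_norm_le (A (hypProj n (x - y))) (f x - f y)
    rw [norm_sub_rev (A _) (f x - f y)] at h2
    have h3 : (1 - η) * ‖A (hypProj n (x - y))‖ ≤ ‖f x - f y‖ := by linarith
    calc _ = c * ((1 - η) * ‖A (hypProj n (x - y))‖) := by rw [← mul_assoc, hη1, one_mul]
      _ ≤ _ := by gcongr
  have e3 : ∀ x ∈ S, ∀ y ∈ S, dist x y ≤ c * dist (hypProj n x) (hypProj n y) := by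
    intro x hx y hy
    rw [dist_eq_norm, dist_eq_norm, hypProj_sub]
    have h3 : (1 - η) * ‖x - y‖ ≤ ‖hypProj n (x - y)‖ := by
      refine le_trans ?_ (hπ x hx y hy)
      gcongr
    calc _ = c * ((1 - η) * ‖x - y‖) := by rw [← mul_assoc, hη1, one_mul]
      _ ≤ _ := by gcongr
  have e4 : ∀ x ∈ S, ∀ y ∈ S, dist (hypProj n x) (hypProj n y) ≤ (1 : ℝ≥0) * dist x y := by
    intro x _ y _
    rw [dist_eq_norm, dist_eq_norm, hypProj_sub, NNReal.coe_one, one_mul]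
    exact norm_hypProj_le hν _
  have m1 := euclideanHausdorffMeasure_image_le_of_dist_le (k + 1) c e1
  have m2 := euclideanHausdorffMeasure_image_le_of_dist_le (k + 1) c e2
  have m3 := euclideanHausdorffMeasure_image_le_of_dist_le (f := hypProj n) (g := id) (k + 1) c e3
  have m4 := euclideanHausdorffMeasure_image_le_of_dist_le (f := id) (g := hypProj n) (k + 1) 1 e4
  rw [euclideanHausdorffMeasure_image_hypProj A hν] at m1 m2
  simp only [image_id, ENNReal.coe_one, one_pow, one_mul] at m3 m4
  constructor
  · refine m1.trans ?_
    gcongr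
  · calc _ ≤ ENNReal.ofReal (tanJac A n) * (c ^ (k + 1) * μHE[k + 1] (hypProj n '' S)) := by gcongr
      _ = c ^ (k + 1) * (ENNReal.ofReal (tanJac A n) * μHE[k + 1] (hypProj n '' S)) := by ring
      _ ≤ c ^ (k + 1) * (c ^ (k + 1) * μHE[k + 1] (f '' S)) := by gcongr
      _ = _ := by ring

theorem IsFlatAlong.measurableSet {M : Set (RN (k + 2))} {ν : RN (k + 2) → RN (k + 2)}
    (hM : IsFlatAlong M ν) : MeasurableSet M := hM.isCompact.isClosed.measurableSet

/-- The density form of `IsFlatAlong.area_image_local`. -/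
theorem IsFlatAlong.area_image_local_lintegral {M : Set (RN (k + 2))}
    {ν : RN (k + 2) → RN (k + 2)}
    (hM : IsFlatAlong M ν) {f : RN (k + 2) → RN (k + 2)} (hf : ContDiff ℝ 1 f)
    (hd : ∀ x, Function.Injective (fderiv ℝ f x)) {p : RN (k + 2)} (hp : p ∈ M)
    {c : ℝ≥0} (hc : 1 < c) :
    ∃ U ∈ 𝓝 p, ∀ S ⊆ M ∩ U, MeasurableSet S →
      μHE[k + 1] (f '' S) ≤ (c * (c ^ (k + 1)) ^ 2) *
        ∫⁻ x in S, ENNReal.ofReal (tanJac (fderiv ℝ f x) (ν x)) ∂μHE[k + 1] ∧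
      ∫⁻ x in S, ENNReal.ofReal (tanJac (fderiv ℝ f x) (ν x)) ∂μHE[k + 1] ≤
        (c * (c ^ (k + 1)) ^ 2) * μHE[k + 1] (f '' S) := by
  obtain ⟨U, hU, hS⟩ := hM.area_image_local hp
    (hf.contDiffAt.hasStrictFDerivAt (by simp)) (hd p) hc
  set J : RN (k + 2) → ℝ := fun x => tanJac (fderiv ℝ f x) (ν x) with hJ
  have hJc : ContinuousOn J M :=
    (hf.continuous_fderiv (by simp)).continuousOn.tanJac' hM.continuousOn
  have hc' : (1 : ℝ) < c := by exact_mod_cast hc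
  have hc'' : (1 : ℝ≥0∞) ≤ c := by exact_mod_cast hc.le
  have hJp : 0 < J p := tanJac_pos (hM.norm_eq p hp) (hd p)
  have hev : ∀ᶠ x in 𝓝[M] p, J x < c * J p ∧ J p < c * J x := by
    have t1 : Tendsto J (𝓝[M] p) (𝓝 (J p)) := hJc p hp
    refine (t1.eventually_lt_const (by nlinarith)).and ?_
    exact (t1.const_mul (c : ℝ)).eventually_const_lt (by nlinarith)
  rw [eventually_nhdsWithin_iff] at hev
  refine ⟨U ∩ {x | x ∈ M → J x < c * J p ∧ J p < c * J x}, inter_mem hU hev,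
    fun S hSU hSm => ?_⟩
  obtain ⟨b1, b2⟩ := hS S (hSU.trans (by intro x hx; exact ⟨hx.1, hx.2.1⟩))
  generalize (μHE[k + 1] : Measure (RN (k + 2))) = μ at b1 b2 ⊢
  have hSM : S ⊆ M := fun x hx => (hSU hx).1
  have hcJ : ∀ a : ℝ, ENNReal.ofReal (c * a) = c * ENNReal.ofReal a := fun a => by
    rw [ENNReal.ofReal_mul (by positivity), ENNReal.ofReal_coe_nnreal]
  have i1 : ENNReal.ofReal (J p) * μ S ≤ c * ∫⁻ x in S, ENNReal.ofReal (J x) ∂μ := by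
    rw [← lintegral_const_mul' _ _ ENNReal.coe_ne_top, ← setLIntegral_const]
    refine setLIntegral_mono' hSm fun x hx => ?_
    rw [← hcJ]
    exact ENNReal.ofReal_le_ofReal ((hSU hx).2.2 (hSM hx)).2.le
  have i2 : ∫⁻ x in S, ENNReal.ofReal (J x) ∂μ ≤ c * (ENNReal.ofReal (J p) * μ S) := by
    rw [← mul_assoc, ← hcJ, ← setLIntegral_const]
    refine setLIntegral_mono' hSm fun x hx => ?_
    exact ENNReal.ofReal_le_ofReal ((hSU hx).2.2 (hSM hx)).1.le
  have hpow : (c : ℝ≥0∞) ^ (k + 1) ≤ ((c : ℝ≥0∞) ^ (k + 1)) ^ 2 :=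
    le_self_pow₀ (one_le_pow₀ hc'') (by simp)
  generalize (c : ℝ≥0∞) ^ (k + 1) = C at b1 b2 hpow ⊢
  constructor
  · calc μ (f '' S) ≤ C * (ENNReal.ofReal (J p) * μ S) := b1
      _ ≤ C ^ 2 * (c * ∫⁻ x in S, ENNReal.ofReal (J x) ∂μ) := by gcongr
      _ = _ := by ring
  · calc _ ≤ c * (ENNReal.ofReal (J p) * μ S) := i2
      _ ≤ c * (C ^ 2 * μ (f '' S)) := by gcongr
      _ = _ := by ring

/-- Removes the factors close to one of the local comparisons. -/
theorem ENNReal.le_of_forall_one_lt_le_mul (m : ℕ) {a b : ℝ≥0∞}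
    (h : ∀ c : ℝ≥0, 1 < c → a ≤ (c * ((c : ℝ≥0∞) ^ m) ^ 2) * b) : a ≤ b := by
  have hlim : Tendsto (fun c : ℝ≥0 => (c * ((c : ℝ≥0∞) ^ m) ^ 2) * b) (𝓝[>] 1) (𝓝 b) := by
    have t : Tendsto (fun c : ℝ≥0 => ((c * (c ^ m) ^ 2 : ℝ≥0) : ℝ≥0∞)) (𝓝[>] 1) (𝓝 1) := by
      have : Tendsto (fun c : ℝ≥0 => c * (c ^ m) ^ 2) (𝓝[>] 1) (𝓝 (1 * (1 ^ m) ^ 2)) :=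
        (Continuous.tendsto (by fun_prop) 1).mono_left nhdsWithin_le_nhds
      simpa using ENNReal.tendsto_coe.2 this
    simpa using ENNReal.Tendsto.mul_const t (Or.inl one_ne_zero)
  exact ge_of_tendsto hlim (eventually_nhdsWithin_of_forall h)

/-- **Area formula** for a `C¹` embedding of a neighbourhood of a compact hypersurface. -/
theorem IsFlatAlong.area_image {M : Set (RN (k + 2))} {ν : RN (k + 2) → RN (k + 2)}
    (hM : IsFlatAlong M ν) {f : RN (k + 2) → RN (k + 2)} (hf : ContDiff ℝ 1 f)
    (hinj : Function.Injective f) (hd : ∀ x, Function.Injective (fderiv ℝ f x)) :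
    μHE[k + 1] (f '' M) =
      ∫⁻ x in M, ENNReal.ofReal (tanJac (fderiv ℝ f x) (ν x)) ∂μHE[k + 1] := by
  have hemb : MeasurableEmbedding f := hf.continuous.measurableEmbedding hinj
  have hloc := fun c (hc : 1 < c) p hp => hM.area_image_local_lintegral hf hd (p := p) hp (c := c) hc
  have h1 : ∀ S, (μHE[k + 1] : Measure (RN (k + 2))).comap f S = μHE[k + 1] (f '' S) :=
    fun S => hemb.comap_apply _ _
  have h2 : ∀ S ⊆ M, MeasurableSet S →
      ((μHE[k + 1] : Measure (RN (k + 2))).restrict M).withDensity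
        (fun x => ENNReal.ofReal (tanJac (fderiv ℝ f x) (ν x))) S =
      ∫⁻ x in S, ENNReal.ofReal (tanJac (fderiv ℝ f x) (ν x)) ∂μHE[k + 1] := by
    intro S hS hSm
    rw [withDensity_apply _ hSm, Measure.restrict_restrict hSm, inter_eq_left.2 hS]
  rw [← h1, ← h2 M Subset.rfl hM.measurableSet]
  -- Both sides are measures of `M`, so the local comparisons add up.
  refine le_antisymm (ENNReal.le_of_forall_one_lt_le_mul (k + 1) fun c hc => ?_)
    (ENNReal.le_of_forall_one_lt_le_mul (k + 1) fun c hc => ?_)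
  · refine hM.isCompact.measure_le_mul_of_local hM.measurableSet fun p hp => ?_
    obtain ⟨U, hU, h⟩ := hloc c hc p hp
    refine ⟨U, hU, fun S hS hSm => ?_⟩
    rw [h1, h2 S (fun x hx => (hS hx).1) hSm]
    exact (h S hS hSm).1
  · refine hM.isCompact.measure_le_mul_of_local hM.measurableSet fun p hp => ?_
    obtain ⟨U, hU, h⟩ := hloc c hc p hp
    refine ⟨U, hU, fun S hS hSm => ?_⟩
    rw [h1, h2 S (fun x hx => (hS hx).1) hSm]
    exact (h S hS hSm).2

/-- A compact hypersurface has finite area. -/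
theorem IsFlatAlong.area_lt_top {M : Set (RN (k + 2))} {ν : RN (k + 2) → RN (k + 2)}
    (hM : IsFlatAlong M ν) : μHE[k + 1] M < ∞ := by
  refine hM.isCompact.measure_lt_top_of_nhdsWithin fun p hp => ?_
  have hν := hM.norm_eq p hp
  set n := ν p
  have hν0 : n ≠ 0 := by intro h; rw [h] at hν; simp at hν
  obtain ⟨U, hU, hflat⟩ := hM.flat p hp (1 / 2) (by norm_num)
  refine ⟨M ∩ U, inter_comm M U ▸ inter_mem_nhdsWithin M hU |> fun h => ?_, ?_⟩
  · simpa [inter_comm] using h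
  have e3 : ∀ x ∈ M ∩ U, ∀ y ∈ M ∩ U, dist x y ≤ (2 : ℝ≥0) * dist (hypProj n x) (hypProj n y) := by
    intro x hx y hy
    rw [dist_eq_norm, dist_eq_norm, hypProj_sub]
    have h1 := norm_sub_norm_le (x - y) (hypProj n (x - y))
    rw [norm_sub_hypProj hν] at h1
    push_cast
    linarith [hflat x hx y hy]
  have m3 := euclideanHausdorffMeasure_image_le_of_dist_le (f := hypProj n) (g := id) (k + 1) 2 e3
  rw [image_id] at m3
  refine m3.trans_lt (ENNReal.mul_lt_top (by simp) ?_)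
  have : Fact (Module.finrank ℝ (RN (k + 2)) = (k + 1) + 1) := ⟨by simp⟩
  have hfin : Module.finrank ℝ (ℝ ∙ n)ᗮ = k + 1 := Submodule.finrank_orthogonal_span_singleton hν0
  have hb : Bornology.IsBounded (hypProj n '' (M ∩ U)) := by
    obtain ⟨R, hR⟩ := hM.isCompact.isBounded.subset_closedBall 0
    refine (Metric.isBounded_closedBall (x := (0 : RN (k + 2))) (r := R)).subset ?_
    rintro _ ⟨x, hx, rfl⟩
    have := hR hx.1
    rw [mem_closedBall_zero_iff] at this ⊢
    exact (norm_hypProj_le hν x).trans this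
  obtain ⟨S', hS'⟩ := exists_image_val_eq_image_hypProj hν (M ∩ U)
  rw [← hS', isometry_subtype_coe.euclideanHausdorffMeasure_image, ← hfin,
    InnerProductSpace.euclideanHausdorffMeasure_eq_volume]
  refine Bornology.IsBounded.measure_lt_top ?_
  refine (isometry_subtype_coe.antilipschitz.isBounded_preimage hb).subset ?_
  rw [← hS']
  exact subset_preimage_image _ _

end Area

/-! ### First variation of area and volume -/

/-- Differentiation under the integral sign; the derivative is bounded by compactness. -/
theorem hasDerivAt_setIntegral_of_continuousOn {X : Type*} [TopologicalSpace X]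
    [MeasurableSpace X] [OpensMeasurableSpace X] [SecondCountableTopology X] [T2Space X]
    {μ : Measure X} {S K : Set X} (hK : IsCompact K) (hSK : S ⊆ K) (hS : MeasurableSet S)
    (hμ : μ S < ∞) {δ : ℝ} (hδ : 0 < δ) {F F' : ℝ → X → ℝ}
    (hF : ∀ t ∈ Ioo (-δ) δ, ContinuousOn (F t) K)
    (hd : ∀ t ∈ Ioo (-δ) δ, ∀ x ∈ K, HasDerivAt (fun s => F s x) (F' t x) t)
    (hF' : ContinuousOn (fun q : ℝ × X => F' q.1 q.2) (Ioo (-δ) δ ×ˢ K)) :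
    HasDerivAt (fun t => ∫ x in S, F t x ∂μ) (∫ x in S, F' 0 x ∂μ) 0 := by
  have hsub : Icc (-(δ / 2)) (δ / 2) ⊆ Ioo (-δ) δ := fun t ht =>
    ⟨by linarith [ht.1], by linarith [ht.2]⟩
  have h0 : (0 : ℝ) ∈ Ioo (-δ) δ := ⟨by linarith, hδ⟩
  obtain ⟨C, hC⟩ := (isCompact_Icc.prod hK).exists_bound_of_continuousOn
    (hF'.mono (prod_mono hsub Subset.rfl))
  have hfin : IsFiniteMeasure (μ.restrict S) := ⟨by simpa using hμ⟩
  have hmeas : ∀ f : X → ℝ, ContinuousOn f K → AEStronglyMeasurable f (μ.restrict S) :=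
    fun f hf => (hf.mono hSK).aestronglyMeasurable hS
  have hint : ∀ f : X → ℝ, ContinuousOn f K → Integrable f (μ.restrict S) := by
    intro f hf
    obtain ⟨B, hB⟩ := hK.exists_bound_of_continuousOn hf
    refine Integrable.of_bound (hmeas f hf) B ?_
    filter_upwards [ae_restrict_mem hS] with x hx using hB x (hSK hx)
  have hF'0 : ContinuousOn (F' 0) K :=
    hF'.comp (f := fun x => ((0 : ℝ), x)) (by fun_prop) fun x hx => ⟨h0, hx⟩
  refine (hasDerivAt_integral_of_dominated_loc_of_deriv_le (bound := fun _ => C)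
    (s := Ioo (-(δ / 2)) (δ / 2)) (Ioo_mem_nhds (by linarith) (by linarith)) ?_
    (hint _ (hF 0 h0)) (hmeas _ hF'0) ?_ (integrable_const C) ?_).2
  · filter_upwards [Ioo_mem_nhds h0.1 h0.2] with t ht using hmeas _ (hF t ht)
  · filter_upwards [ae_restrict_mem hS] with x hx t ht
    exact hC (t, x) ⟨Ioo_subset_Icc_self ht, hSK hx⟩
  · filter_upwards [ae_restrict_mem hS] with x hx t ht
    exact hd t (hsub (Ioo_subset_Icc_self ht)) x (hSK hx)

/-- The initial velocity of a family of maps. -/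
def velocity {n : ℕ} (ξ : ℝ → RN n → RN n) (x : RN n) : RN n := deriv (fun t => ξ t x) 0

/-- The mixed second derivative `∂_t D_x ξ` of a family of maps, as a function of `(t, x)`. -/
def mixedDeriv {n : ℕ} (ξ : ℝ → RN n → RN n) (q : ℝ × RN n) : RN n →L[ℝ] RN n :=
  (fderiv ℝ (fderiv ℝ fun q : ℝ × RN n => ξ q.1 q.2) q (1, 0)).comp
    (ContinuousLinearMap.inr ℝ ℝ (RN n))

namespace IsVariation

variable {n : ℕ} {δ : ℝ} {ξ : ℝ → RN n → RN n}

theorem zero_mem (h : IsVariation δ ξ) : (0 : ℝ) ∈ Ioo (-δ) δ := ⟨by linarith [h.pos], h.pos⟩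

theorem contDiffAt (h : IsVariation δ ξ) {t : ℝ} (ht : t ∈ Ioo (-δ) δ) (x : RN n) :
    ContDiffAt ℝ 2 (fun q : ℝ × RN n => ξ q.1 q.2) (t, x) :=
  h.contDiffOn.contDiffAt ((isOpen_Ioo.prod isOpen_univ).mem_nhds ⟨ht, mem_univ _⟩)

theorem contDiff (h : IsVariation δ ξ) {t : ℝ} (ht : t ∈ Ioo (-δ) δ) : ContDiff ℝ 2 (ξ t) :=
  contDiff_iff_contDiffAt.2 fun x =>
    (h.contDiffAt ht x).comp (f := fun x => (t, x)) x (by fun_prop)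

theorem hasFDerivAt (h : IsVariation δ ξ) {t : ℝ} (ht : t ∈ Ioo (-δ) δ) (x : RN n) :
    HasFDerivAt (ξ t) ((fderiv ℝ (fun q : ℝ × RN n => ξ q.1 q.2) (t, x)).comp
      (ContinuousLinearMap.inr ℝ ℝ (RN n))) x := by
  have h1 := ((h.contDiffAt ht x).differentiableAt (by simp)).hasFDerivAt
  exact h1.comp (f := fun x => (t, x)) x (hasFDerivAt_prodMk_right t x)

theorem fderiv_eq (h : IsVariation δ ξ) {t : ℝ} (ht : t ∈ Ioo (-δ) δ) (x : RN n) :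
    fderiv ℝ (ξ t) x = (fderiv ℝ (fun q : ℝ × RN n => ξ q.1 q.2) (t, x)).comp
      (ContinuousLinearMap.inr ℝ ℝ (RN n)) := (h.hasFDerivAt ht x).fderiv

theorem contDiffAt_fderiv (h : IsVariation δ ξ) {t : ℝ} (ht : t ∈ Ioo (-δ) δ) (x : RN n) :
    ContDiffAt ℝ 1 (fderiv ℝ fun q : ℝ × RN n => ξ q.1 q.2) (t, x) :=
  (h.contDiffAt ht x).fderiv_right (by norm_num)

theorem continuousOn_fderiv (h : IsVariation δ ξ) (K : Set (RN n)) :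
    ContinuousOn (fun q : ℝ × RN n => fderiv ℝ (ξ q.1) q.2) (Ioo (-δ) δ ×ˢ K) := by
  refine ContinuousOn.congr (f := fun q : ℝ × RN n =>
    (fderiv ℝ (fun q : ℝ × RN n => ξ q.1 q.2) q).comp (ContinuousLinearMap.inr ℝ ℝ (RN n))) ?_
    fun q hq => h.fderiv_eq hq.1 q.2
  intro q hq
  have := (h.contDiffAt_fderiv hq.1 q.2).continuousAt.continuousWithinAt (s := Ioo (-δ) δ ×ˢ K)
  exact this.clm_comp continuousWithinAt_const

theorem continuousOn_mixedDeriv (h : IsVariation δ ξ) (K : Set (RN n)) :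
    ContinuousOn (mixedDeriv ξ) (Ioo (-δ) δ ×ˢ K) := by
  intro q hq
  have h1 : ContinuousAt (fderiv ℝ (fderiv ℝ fun q : ℝ × RN n => ξ q.1 q.2)) q :=
    ((h.contDiffAt_fderiv hq.1 q.2).fderiv_right (m := 0) (by norm_num)).continuousAt
  have h2 := (h1.clm_apply (continuousAt_const (y := ((1 : ℝ), (0 : RN n))))).clm_comp
    (continuousAt_const (y := ContinuousLinearMap.inr ℝ ℝ (RN n)))
  exact h2.continuousWithinAt

theorem hasDerivAt_fderiv (h : IsVariation δ ξ) {t : ℝ} (ht : t ∈ Ioo (-δ) δ) (x : RN n) :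
    HasDerivAt (fun s => fderiv ℝ (ξ s) x) (mixedDeriv ξ (t, x)) t := by
  have h1 := ((h.contDiffAt_fderiv ht x).differentiableAt (by simp)).hasFDerivAt
  have h2 : HasDerivAt (fun s : ℝ => (s, x)) (1, 0) t :=
    (hasDerivAt_id t).prodMk (hasDerivAt_const t x)
  have h3 := h1.comp_hasDerivAt t h2
  have h4 := h3.clm_comp (hasDerivAt_const t (ContinuousLinearMap.inr ℝ ℝ (RN n)))
  refine (h4.congr_deriv ?_).congr_of_eventuallyEq ?_
  · simp [mixedDeriv]
  · filter_upwards [isOpen_Ioo.mem_nhds ht] with s hs using h.fderiv_eq hs x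

theorem hasDerivAt (h : IsVariation δ ξ) (x : RN n) :
    HasDerivAt (fun t => ξ t x) (velocity ξ x) 0 := by
  have h1 : DifferentiableAt ℝ (fun t => ξ t x) 0 :=
    ((h.contDiffAt h.zero_mem x).differentiableAt (by simp)).comp (f := fun t : ℝ => (t, x)) 0
      (by fun_prop)
  exact h1.hasDerivAt

theorem velocity_eq (h : IsVariation δ ξ) (x : RN n) :
    velocity ξ x = fderiv ℝ (fun q : ℝ × RN n => ξ q.1 q.2) (0, x) (1, 0) := by
  have h1 := ((h.contDiffAt h.zero_mem x).differentiableAt (by simp)).hasFDerivAt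
  have h2 : HasDerivAt (fun s : ℝ => (s, x)) (1, 0) 0 :=
    (hasDerivAt_id 0).prodMk (hasDerivAt_const 0 x)
  exact (h1.comp_hasDerivAt (0 : ℝ) h2).deriv

theorem contDiff_velocity (h : IsVariation δ ξ) : ContDiff ℝ 1 (velocity ξ) := by
  rw [funext h.velocity_eq, contDiff_iff_contDiffAt]
  intro x
  have := (h.contDiffAt_fderiv h.zero_mem x).comp (f := fun x : RN n => ((0 : ℝ), x)) x (by fun_prop)
  exact this.clm_apply contDiffAt_const

/-- The mixed derivatives commute: `D_x ∂_t ξ = ∂_t D_x ξ` at `t = 0`. -/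
theorem fderiv_velocity (h : IsVariation δ ξ) (x : RN n) :
    fderiv ℝ (velocity ξ) x = mixedDeriv ξ (0, x) := by
  rw [funext h.velocity_eq]
  have h1 := ((h.contDiffAt_fderiv h.zero_mem x).differentiableAt (by simp)).hasFDerivAt
  have h2 := h1.comp (f := fun x : RN n => ((0 : ℝ), x)) x (hasFDerivAt_prodMk_right (0 : ℝ) x)
  have h3 := h2.clm_apply (hasFDerivAt_const ((1 : ℝ), (0 : RN n)) x)
  have h4 := h3.fderiv
  refine h4.trans ?_
  ext1 v
  have hsym := (h.contDiffAt h.zero_mem x).isSymmSndFDerivAt (by simp)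
  simpa [mixedDeriv] using hsym (0, v) (1, 0)

theorem injective_fderiv (h : IsVariation δ ξ) {t : ℝ} (ht : t ∈ Ioo (-δ) δ) (x : RN n) :
    Function.Injective (fderiv ℝ (ξ t) x) := by
  obtain ⟨η, hη, hl, -⟩ := h.diffeo t ht
  have h1 : HasFDerivAt (η ∘ ξ t) ((fderiv ℝ η (ξ t x)).comp (fderiv ℝ (ξ t) x)) x :=
    ((hη.differentiable (by simp)) _).hasFDerivAt.comp x
      (((h.contDiff ht).differentiable (by simp)) x).hasFDerivAt
  rw [hl.comp_eq_id] at h1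
  have h2 := h1.unique (hasFDerivAt_id x)
  exact Function.LeftInverse.injective (g := fderiv ℝ η (ξ t x)) fun v => by
    simpa using congrArg (fun A : RN n →L[ℝ] RN n => A v) h2

theorem injective (h : IsVariation δ ξ) {t : ℝ} (ht : t ∈ Ioo (-δ) δ) :
    Function.Injective (ξ t) := by
  obtain ⟨η, -, hl, -⟩ := h.diffeo t ht
  exact hl.injective

theorem bijective (h : IsVariation δ ξ) {t : ℝ} (ht : t ∈ Ioo (-δ) δ) :
    Function.Bijective (ξ t) := by
  obtain ⟨η, -, hl, hr⟩ := h.diffeo t ht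
  exact ⟨hl.injective, hr.surjective⟩

theorem fderiv_zero (h : IsVariation δ ξ) (x : RN n) :
    fderiv ℝ (ξ 0) x = ContinuousLinearMap.id ℝ (RN n) := by
  rw [h.zero]; exact fderiv_id

/-- Differentiation under the integral sign of the square root of a positive function of
`D_x ξ`. -/
theorem hasDerivAt_integral_sqrt {k : ℕ} {ξ : ℝ → RN (k + 2) → RN (k + 2)}
    (h : IsVariation δ ξ) {μ : Measure (RN (k + 2))}
    {S K : Set (RN (k + 2))} (hK : IsCompact K) (hSK : S ⊆ K) (hS : MeasurableSet S)
    (hμ : μ S < ∞) {ν : RN (k + 2) → RN (k + 2)} (hν : ContinuousOn ν K)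
    {D : (RN (k + 2) →L[ℝ] RN (k + 2)) × RN (k + 2) → ℝ} (hD : ContDiff ℝ 1 D)
    (hpos : ∀ A : RN (k + 2) →L[ℝ] RN (k + 2), Function.Injective A → ∀ x ∈ K, 0 < D (A, ν x)) :
    HasDerivAt (fun t => ∫ x in S, √(D (fderiv ℝ (ξ t) x, ν x)) ∂μ)
      (∫ x in S, fderiv ℝ D (ContinuousLinearMap.id ℝ _, ν x) (fderiv ℝ (velocity ξ) x, 0) /
        (2 * √(D (ContinuousLinearMap.id ℝ _, ν x))) ∂μ) 0 := by
  have hA := h.continuousOn_fderiv K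
  have hpair : ContinuousOn (fun q : ℝ × RN (k + 2) => (fderiv ℝ (ξ q.1) q.2, ν q.2))
      (Ioo (-δ) δ ×ˢ K) :=
    hA.prodMk (hν.comp continuousOn_snd fun q hq => hq.2)
  have hDc : ContinuousOn (fun q : ℝ × RN (k + 2) => √(D (fderiv ℝ (ξ q.1) q.2, ν q.2)))
      (Ioo (-δ) δ ×ˢ K) :=
    Real.continuous_sqrt.comp_continuousOn (hD.continuous.comp_continuousOn hpair)
  have hpos' : ∀ t ∈ Ioo (-δ) δ, ∀ x ∈ K, 0 < D (fderiv ℝ (ξ t) x, ν x) := fun t ht x hx =>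
    hpos _ (h.injective_fderiv ht x) x hx
  have key := hasDerivAt_setIntegral_of_continuousOn (μ := μ) hK hSK hS hμ h.pos
    (F := fun t x => √(D (fderiv ℝ (ξ t) x, ν x)))
    (F' := fun t x => fderiv ℝ D (fderiv ℝ (ξ t) x, ν x) (mixedDeriv ξ (t, x), 0) /
      (2 * √(D (fderiv ℝ (ξ t) x, ν x)))) ?_ ?_ ?_
  · refine key.congr_deriv ?_
    simp only [h.fderiv_zero, h.fderiv_velocity]
  · intro t ht
    exact hDc.comp (f := fun x => (t, x)) (by fun_prop) fun x hx => ⟨ht, hx⟩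
  · intro t ht x hx
    have h1 := ((hD.differentiable (by simp)) (fderiv ℝ (ξ t) x, ν x)).hasFDerivAt
    have h2 : HasDerivAt (fun s => (fderiv ℝ (ξ s) x, ν x)) (mixedDeriv ξ (t, x), 0) t :=
      (h.hasDerivAt_fderiv ht x).prodMk (hasDerivAt_const _ _)
    have h3 := h1.comp_hasDerivAt t h2
    exact h3.sqrt (hpos' t ht x hx).ne'
  · refine ContinuousOn.div ?_ (hDc.const_mul 2) ?_
    · have h1 := (hD.continuous_fderiv (by simp)).comp_continuousOn hpair
      exact h1.clm_apply ((h.continuousOn_mixedDeriv K).prodMk continuousOn_const)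
    · intro q hq
      have := Real.sqrt_pos.2 (hpos' q.1 hq.1 q.2 hq.2)
      positivity

end IsVariation

section

variable {k : ℕ} {δ : ℝ} {ξ : ℝ → RN (k + 2) → RN (k + 2)}

/-- The divergence of a vector field. -/
def divergence (X : RN (k + 2) → RN (k + 2)) (x : RN (k + 2)) : ℝ :=
  LinearMap.trace ℝ _ (fderiv ℝ X x : RN (k + 2) →ₗ[ℝ] RN (k + 2))

/-- The first variation of the area of `M`, with unit normal `ν`, in the direction of the vector
field `X`: the integral over `M` of the tangential divergence of `X`. -/
def firstVar (M : Set (RN (k + 2))) (ν X : RN (k + 2) → RN (k + 2)) : ℝ :=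
  ∫ x in M, tanTrace (fderiv ℝ X x) (ν x) ∂μHE[k + 1]

/-- **First variation of area**: the area formula, differentiated under the integral sign. -/
theorem IsVariation.hasDerivAt_area (h : IsVariation δ ξ) {M : Set (RN (k + 2))}
    {ν : RN (k + 2) → RN (k + 2)} (hM : IsFlatAlong M ν) :
    HasDerivAt (fun t => area (ξ t '' M)) (firstVar M ν (velocity ξ)) 0 := by
  have h1 := h.hasDerivAt_integral_sqrt (μ := μHE[k + 1]) hM.isCompact Subset.rfl hM.measurableSet
    hM.area_lt_top hM.continuousOn contDiff_det_tanGram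
    (fun A hA x hx => det_tanGram_pos (hM.norm_eq x hx) hA)
  refine (h1.congr_deriv ?_).congr_of_eventuallyEq ?_
  · refine setIntegral_congr_fun hM.measurableSet fun x hx => ?_
    have hν := hM.norm_eq x hx
    simp only [fderiv_det_tanGram_id _ hν, tanGram_id hν]
    simp
  · filter_upwards [isOpen_Ioo.mem_nhds h.zero_mem] with t ht
    have hC := (h.contDiff ht).of_le (m := 1) (by norm_num)
    change (μHE[k + 1] (ξ t '' M)).toReal = _
    rw [hM.area_image hC (h.injective ht) (h.injective_fderiv ht)]
    have hc : ContinuousOn (fun x => tanJac (fderiv ℝ (ξ t) x) (ν x)) M :=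
      (hC.continuous_fderiv (by simp)).continuousOn.tanJac' hM.continuousOn
    rw [← integral_eq_lintegral_of_nonneg_ae]
    · refine setIntegral_congr_fun hM.measurableSet fun x hx => ?_
      rw [tanJac_eq]
    · exact Eventually.of_forall fun x => tanJac_nonneg _ _
    · exact hc.aestronglyMeasurable hM.measurableSet

theorem det_eq_matrix_det (A : RN (k + 2) →L[ℝ] RN (k + 2)) :
    A.det = (Matrix.of fun i j => ⟪EuclideanSpace.basisFun (Fin (k + 2)) ℝ i,
      A (EuclideanSpace.basisFun (Fin (k + 2)) ℝ j)⟫).det := by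
  set e := EuclideanSpace.basisFun (Fin (k + 2)) ℝ
  rw [ContinuousLinearMap.det, ← LinearMap.det_toMatrix e.toBasis]
  congr 1
  ext i j
  rw [LinearMap.toMatrix_apply, OrthonormalBasis.coe_toBasis, OrthonormalBasis.coe_toBasis_repr_apply,
    OrthonormalBasis.repr_apply_apply]
  rfl

theorem clm_det_id : (ContinuousLinearMap.id ℝ (RN (k + 2))).det = 1 := LinearMap.det_id

theorem contDiff_clm_det {r : WithTop ℕ∞} :
    ContDiff ℝ r (fun A : RN (k + 2) →L[ℝ] RN (k + 2) => A.det) := by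
  simp only [det_eq_matrix_det]
  refine contDiff_det.comp (contDiff_pi.2 fun i => contDiff_pi.2 fun j => ?_)
  exact contDiff_const.inner ℝ (contDiff_id.clm_apply contDiff_const)

theorem fderiv_clm_det_id (B : RN (k + 2) →L[ℝ] RN (k + 2)) :
    fderiv ℝ (fun A : RN (k + 2) →L[ℝ] RN (k + 2) => A.det) (ContinuousLinearMap.id ℝ _) B =
      LinearMap.trace ℝ _ (B : RN (k + 2) →ₗ[ℝ] RN (k + 2)) := by
  set e := EuclideanSpace.basisFun (Fin (k + 2)) ℝ with he
  let Lm : (RN (k + 2) →L[ℝ] RN (k + 2)) →L[ℝ] (Fin (k + 2) → Fin (k + 2) → ℝ) :=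
    ContinuousLinearMap.pi fun i => ContinuousLinearMap.pi fun j =>
      (innerSL ℝ (e i)).comp (ContinuousLinearMap.apply ℝ (RN (k + 2)) (e j))
  have hL : ∀ A, Lm A = fun i j => ⟪e i, A (e j)⟫ := fun A => rfl
  have h0 : Lm (ContinuousLinearMap.id ℝ _) = (1 : Matrix (Fin (k + 2)) (Fin (k + 2)) ℝ) := by
    rw [hL]; ext i j
    simp [orthonormal_iff_ite.1 e.orthonormal i j, Matrix.one_apply]
  have h1 : HasFDerivAt (fun M : Fin (k + 2) → Fin (k + 2) → ℝ => (Matrix.of M).det)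
      (fderiv ℝ (fun M : Fin (k + 2) → Fin (k + 2) → ℝ => (Matrix.of M).det)
        (1 : Matrix (Fin (k + 2)) (Fin (k + 2)) ℝ)) (Lm (ContinuousLinearMap.id ℝ _)) := by
    rw [h0]
    exact ((contDiff_det (r := 1)).differentiable (by simp) _).hasFDerivAt
  have h2 := h1.comp (ContinuousLinearMap.id ℝ (RN (k + 2))) Lm.hasFDerivAt
  have h3 : (fun A : RN (k + 2) →L[ℝ] RN (k + 2) => A.det) =
      (fun M : Fin (k + 2) → Fin (k + 2) → ℝ => (Matrix.of M).det) ∘ Lm := by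
    funext A
    exact det_eq_matrix_det A
  rw [h3, h2.fderiv, ContinuousLinearMap.comp_apply, fderiv_det_one, Matrix.trace,
    LinearMap.trace_eq_sum_inner _ e]
  rfl

/-- **First variation of volume**: the change of variables formula, differentiated under the
integral sign. The Jacobian `|det D_x ξ|` is treated as `√(det²)`, parallel to the case of area.
-/
theorem IsVariation.hasDerivAt_volume (h : IsVariation δ ξ) {S : Set (RN (k + 2))}
    (hS : MeasurableSet S) (hb : Bornology.IsBounded S) :
    HasDerivAt (fun t => (volume (ξ t '' S)).toReal) (∫ x in S, divergence (velocity ξ) x) 0 := by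
  have hK : IsCompact (closure S) := hb.isCompact_closure
  let D : (RN (k + 2) →L[ℝ] RN (k + 2)) × RN (k + 2) → ℝ := fun p => p.1.det ^ 2
  have hD : ContDiff ℝ 1 D := (contDiff_clm_det.comp contDiff_fst).pow 2
  have hdet : ∀ A : RN (k + 2) →L[ℝ] RN (k + 2), Function.Injective A → A.det ≠ 0 := by
    intro A hA
    rw [ContinuousLinearMap.det, ← isUnit_iff_ne_zero, ← LinearMap.isUnit_iff_isUnit_det,
      LinearMap.isUnit_iff_ker_eq_bot, LinearMap.ker_eq_bot]
    exact hA
  have h1 := h.hasDerivAt_integral_sqrt (μ := volume) hK subset_closure hS hb.measure_lt_top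
    (ν := fun _ => 0) continuousOn_const hD
    (fun A hA x hx => by have := hdet A hA; positivity)
  refine (h1.congr_deriv ?_).congr_of_eventuallyEq ?_
  · refine setIntegral_congr_fun hS fun x _ => ?_
    have e1 : fderiv ℝ D (ContinuousLinearMap.id ℝ _, 0) (fderiv ℝ (velocity ξ) x, 0) =
        2 * divergence (velocity ξ) x := by
      have a1 : HasFDerivAt (fun A : RN (k + 2) →L[ℝ] RN (k + 2) => A.det) _
          (ContinuousLinearMap.id ℝ (RN (k + 2)), (0 : RN (k + 2))).1 :=
        ((contDiff_clm_det (r := 1)).differentiable (by simp) _).hasFDerivAt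
      have a2 := (a1.comp (f := Prod.fst) (ContinuousLinearMap.id ℝ (RN (k + 2)), (0 : RN (k + 2)))
        hasFDerivAt_fst).pow 2
      have a3 : D = fun p => ((fun A : RN (k + 2) →L[ℝ] RN (k + 2) => A.det) ∘ Prod.fst) p ^ 2 := rfl
      rw [a3, a2.fderiv]
      simp [fderiv_clm_det_id, divergence, clm_det_id]
    simp only [e1, D, clm_det_id]
    simp
  · filter_upwards [isOpen_Ioo.mem_nhds h.zero_mem] with t ht
    have hC := (h.contDiff ht).of_le (m := 1) (by norm_num)
    rw [← lintegral_abs_det_fderiv_eq_addHaar_image volume hS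
      (fun x _ => ((hC.differentiable (by simp)) x).hasFDerivAt.hasFDerivWithinAt)
      (h.injective ht).injOn, ← integral_eq_lintegral_of_nonneg_ae]
    · refine setIntegral_congr_fun hS fun x _ => ?_
      simp only [D]
      rw [Real.sqrt_sq_eq_abs]
    · exact Eventually.of_forall fun x => abs_nonneg _
    · have : Continuous fun x => |(fderiv ℝ (ξ t) x).det| :=
        ((contDiff_clm_det (r := 1)).continuous.comp (hC.continuous_fderiv (by simp))).abs
      exact this.aestronglyMeasurable

end

/-! ### Local structure of a hypersurface with boundary -/

theorem fderiv_ne_zero_of_linearIndependent {n : ℕ} {u v : RN n → ℝ} {p : RN n}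
    (h : LinearIndependent ℝ ![fderiv ℝ u p, fderiv ℝ v p]) : fderiv ℝ u p ≠ 0 := by
  simpa using h.ne_zero 0

theorem IsHypersurface.isLocalEquation {n : ℕ} {M : Set (RN n)} (hM : IsHypersurface M) {p : RN n}
    (hp : p ∈ M) : IsLocalEquation M p (localEquation M p) := by
  have h : ∃ u, IsLocalEquation M p u := by
    rcases hM.2 p hp with ⟨u, hu, hup, hdu, hev⟩ | ⟨u, v, hu, -, hup, -, hli, hev⟩
    · exact ⟨u, hu, hup, hdu, hev.mono fun x hx => hx.1⟩
    · exact ⟨u, hu, hup, fderiv_ne_zero_of_linearIndependent hli, hev.mono fun x hx h => (hx.1 h).1⟩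
  rw [localEquation, dif_pos h]
  exact h.choose_spec

/-- A hypersurface is flat to first order along its unit normal: near `p`, the strict derivative of
a local equation is small on secants of `M`. -/
theorem IsHypersurface.isFlatAlong {k : ℕ} {M : Set (RN (k + 2))} (hM : IsHypersurface M)
    {N : RN (k + 2) → RN (k + 2)} (hN : IsUnitNormal M N) : IsFlatAlong M N where
  isCompact := hM.1
  continuousOn := hN.1
  norm_eq p hp := (hN.2 p hp).1
  flat p hp ε hε := by
    obtain ⟨hu, hup, hdu, hev⟩ := hM.isLocalEquation hp
    have hperp := (hN.2 p hp).2
    rw [tangentM, levelTangent] at hperp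
    set u := localEquation M p
    obtain ⟨w, hw⟩ : ∃ w, fderiv ℝ u p w ≠ 0 := by
      by_contra! h
      exact hdu (ContinuousLinearMap.ext h)
    -- `N p` is a multiple of the differential of `u`, hence is controlled by it
    set C : ℝ := |⟪N p, (fderiv ℝ u p w)⁻¹ • w⟫|
    have hC : ∀ z, |⟪N p, z⟫| = |fderiv ℝ u p z| * C := by
      intro z
      have h1 : z - (fderiv ℝ u p z) • (fderiv ℝ u p w)⁻¹ • w ∈
          LinearMap.ker (fderiv ℝ u p).toLinearMap := by
        simp [hw]
      have h2 := hperp _ h1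
      rw [inner_sub_right, inner_smul_right, sub_eq_zero] at h2
      rw [h2, abs_mul]
    have hC0 : 0 ≤ C := abs_nonneg _
    have hc : 0 < ε / (C + 1) := by positivity
    obtain ⟨V, hV, hapx⟩ := (hu.hasStrictFDerivAt (by simp)).approximates_deriv_on_nhds
      (c := ⟨ε / (C + 1), hc.le⟩) (Or.inr hc)
    refine ⟨V ∩ {x | x ∈ M → u x = 0}, inter_mem hV hev, fun x hx y hy => ?_⟩
    have h1 : ‖u x - u y - fderiv ℝ u p (x - y)‖ ≤ ε / (C + 1) * ‖x - y‖ :=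
      hapx x hx.2.1 y hy.2.1
    rw [hx.2.2 hx.1, hy.2.2 hy.1, sub_zero, zero_sub, norm_neg, Real.norm_eq_abs] at h1
    rw [hC]
    calc |fderiv ℝ u p (x - y)| * C ≤ ε / (C + 1) * ‖x - y‖ * (C + 1) := by
          gcongr
          linarith
      _ = _ := by field_simp

/-- Boundary points are not interior points. If near `p` the set `{u = 0, v ≥ 0}` were the set `{w
= 0}`, then `u` and `v` would both be minimal at `p` under the constraint `w = 0`, so that `du` and
`dv` would both be multiples of `dw`. -/
theorem not_isInteriorPoint_of_isBoundaryPoint {n : ℕ} {M : Set (RN n)} {p : RN n}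
    (hb : IsBoundaryPoint M p) : ¬ IsInteriorPoint M p := by
  rintro ⟨w, hw, hwp, hdw, hevw⟩
  obtain ⟨u, v, hu, hv, hup, hvp, hli, hev⟩ := hb
  have hmul : ∀ φ : RN n → ℝ, ContDiffAt ℝ 2 φ p → (∀ᶠ x in 𝓝 p, w x = 0 → φ p ≤ φ x) →
      ∃ c : ℝ, fderiv ℝ φ p = c • fderiv ℝ w p := by
    intro φ hφ hmin
    have hext : IsLocalExtrOn φ {x | w x = w p} p := by
      left
      rw [hwp]
      change ∀ᶠ x in 𝓝[{x | w x = 0}] p, φ p ≤ φ x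
      rw [eventually_nhdsWithin_iff]
      exact hmin
    obtain ⟨a, b, hab, h⟩ := hext.exists_multipliers_of_hasStrictFDerivAt_1d
      (hw.hasStrictFDerivAt (by simp)) (hφ.hasStrictFDerivAt (by simp))
    have hb : b ≠ 0 := by
      rintro rfl
      rw [zero_smul, add_zero] at h
      rcases smul_eq_zero.1 h with h | h
      · exact hab (by rw [h]; rfl)
      · exact hdw h
    refine ⟨-(a / b), ?_⟩
    have : b • fderiv ℝ φ p = -(a • fderiv ℝ w p) := by rw [eq_neg_iff_add_eq_zero, add_comm]; exact h
    rw [neg_smul, div_eq_inv_mul, mul_smul, ← smul_neg, ← this, smul_smul, inv_mul_cancel₀ hb, one_smul]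
  have hboth : ∀ᶠ x in 𝓝 p, w x = 0 → u x = 0 ∧ 0 ≤ v x := by
    filter_upwards [hev, hevw] with x h1 h2 h3 using h1.1 (h2.2 h3)
  obtain ⟨c, hc⟩ := hmul u hu (hboth.mono fun x h hx => by rw [hup, (h hx).1])
  obtain ⟨d, hd⟩ := hmul v hv (hboth.mono fun x h hx => by rw [hvp]; exact (h hx).2)
  rw [LinearIndependent.pair_iff, hc, hd] at hli
  have h1 := hli d (-c) (by module)
  rw [h1.1] at hd
  have h2 := hli 0 1 (by rw [h1.1]; simp)
  exact one_ne_zero h2.2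

/-- Near a boundary point of `M`, defining functions `u`, `v` of `M` at that point describe `∂M` as
`u = v = 0`. -/
theorem eventually_mem_bdry_iff {n : ℕ} {M : Set (RN n)} {p : RN n} {u v : RN n → ℝ}
    (hu : ContDiffAt ℝ 2 u p) (hv : ContDiffAt ℝ 2 v p)
    (hli : LinearIndependent ℝ ![fderiv ℝ u p, fderiv ℝ v p])
    (hev : ∀ᶠ x in 𝓝 p, (x ∈ M ↔ u x = 0 ∧ 0 ≤ v x)) :
    ∀ᶠ x in 𝓝 p, (x ∈ bdry M ↔ u x = 0 ∧ v x = 0) := by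
  have hli' : ∀ᶠ x in 𝓝 p, LinearIndependent ℝ ![fderiv ℝ u x, fderiv ℝ v x] := by
    have hc : ContinuousAt (fun x => ![fderiv ℝ u x, fderiv ℝ v x]) p := by
      rw [continuousAt_pi]
      intro i
      fin_cases i
      · exact (hu.fderiv_right (m := 1) (by norm_num)).continuousAt
      · exact (hv.fderiv_right (m := 1) (by norm_num)).continuousAt
    exact hc.eventually (isOpen_setOfPred_linearIndependent.mem_nhds hli)
  filter_upwards [hev.eventually_nhds, hli', hu.eventually (by simp), hv.eventually (by simp)]
    with x hx hlx hux hvx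
  constructor
  · rintro ⟨hxM, hxb⟩
    obtain ⟨h1, h2⟩ := hx.self_of_nhds.1 hxM
    refine ⟨h1, h2.antisymm' (le_of_not_gt fun h3 => ?_)⟩
    refine not_isInteriorPoint_of_isBoundaryPoint hxb
      ⟨u, hux, h1, fderiv_ne_zero_of_linearIndependent hlx, ?_⟩
    filter_upwards [hx, hvx.continuousAt.eventually (lt_mem_nhds h3)] with y hy hvy
    rw [hy]
    exact ⟨fun h => h.1, fun h => ⟨h, le_of_lt hvy⟩⟩
  · rintro ⟨h1, h2⟩
    exact ⟨hx.self_of_nhds.2 ⟨h1, h2.ge⟩, u, v, hux, hvx, h1, h2, hlx, hx⟩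

theorem IsHypersurface.isCompact_bdry {n : ℕ} {M : Set (RN n)} (hM : IsHypersurface M) :
    IsCompact (bdry M) := by
  refine hM.1.of_isClosed_subset ?_ fun p hp => hp.1
  rw [← isOpen_compl_iff, isOpen_iff_mem_nhds]
  intro p hp
  by_cases hpM : p ∈ M
  · rcases hM.2 p hpM with ⟨u, hu, hup, hdu, hev⟩ | hb
    · have hdu' : ∀ᶠ x in 𝓝 p, fderiv ℝ u x ≠ 0 :=
        (hu.fderiv_right (m := 1) (by norm_num)).continuousAt.eventually_ne hdu
      filter_upwards [hev.eventually_nhds, hdu', hu.eventually (by simp)] with x hx hdx hux hxb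
      exact not_isInteriorPoint_of_isBoundaryPoint hxb.2
        ⟨u, hux, hx.self_of_nhds.1 hxb.1, hdx, hx⟩
    · exact absurd ⟨hpM, hb⟩ hp
  · filter_upwards [hM.1.isClosed.isOpen_compl.mem_nhds hpM] with x hx hxb using hx hxb.1

section Chart

variable {k : ℕ}

/-- Two independent functionals are the first two coordinates of a linear automorphism. -/
theorem exists_linearEquiv_of_linearIndependent {ℓ₀ ℓ₁ : RN (k + 2) →L[ℝ] ℝ}
    (h : LinearIndependent ℝ ![ℓ₀, ℓ₁]) :
    ∃ T : RN (k + 2) ≃L[ℝ] RN (k + 2), ∀ w, T w 0 = ℓ₀ w ∧ T w 1 = ℓ₁ w := by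
  let D := InnerProductSpace.toDual ℝ (RN (k + 2))
  have hD : ∀ (ℓ : RN (k + 2) →L[ℝ] ℝ) w, ⟪D.symm ℓ, w⟫ = ℓ w := fun ℓ w =>
    InnerProductSpace.toDual_symm_apply
  have hab : LinearIndependent ℝ ![D.symm ℓ₀, D.symm ℓ₁] := by
    rw [LinearIndependent.pair_iff] at h ⊢
    intro s t hst
    refine h s t (ContinuousLinearMap.ext fun w => ?_)
    have := congrArg (fun z => ⟪z, w⟫) hst
    simpa [inner_add_left, inner_smul_left, hD] using this
  set S := Submodule.span ℝ (Set.range ![D.symm ℓ₀, D.symm ℓ₁])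
  have hS : Module.finrank ℝ S = 2 := by
    rw [finrank_span_eq_card hab]; simp
  have hSo : Module.finrank ℝ Sᗮ = k := by
    have := Submodule.finrank_add_finrank_orthogonal S
    rw [hS, finrank_euclideanSpace_fin] at this
    omega
  let c : OrthonormalBasis (Fin k) ℝ Sᗮ := (stdOrthonormalBasis ℝ Sᗮ).reindex (finCongr hSo)
  let T₀ : RN (k + 2) →ₗ[ℝ] RN (k + 2) :=
    { toFun := fun w => WithLp.toLp 2
        (Fin.cons (ℓ₀ w) (Fin.cons (ℓ₁ w) fun i => ⟪(c i : RN (k + 2)), w⟫))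
      map_add' := fun x y => by
        ext i
        refine Fin.cases ?_ (fun i => Fin.cases ?_ (fun i => ?_) i) i <;>
          simp [inner_add_right]
      map_smul' := fun a x => by
        ext i
        refine Fin.cases ?_ (fun i => Fin.cases ?_ (fun i => ?_) i) i <;>
          simp [inner_smul_right] }
  have hinj : Function.Injective T₀ := by
    rw [← LinearMap.ker_eq_bot, LinearMap.ker_eq_bot']
    intro w hw
    have e0 : ℓ₀ w = 0 := congrArg (fun z : RN (k + 2) => z 0) hw
    have e1 : ℓ₁ w = 0 := congrArg (fun z : RN (k + 2) => z 1) hw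
    have e2 : ∀ i : Fin k, ⟪(c i : RN (k + 2)), w⟫ = 0 := fun i =>
      congrArg (fun z : RN (k + 2) => z i.succ.succ) hw
    have hwS : w ∈ Sᗮ := by
      rw [Submodule.mem_orthogonal]
      intro z hz
      induction hz using Submodule.span_induction with
      | mem x hx =>
        obtain ⟨i, rfl⟩ := hx
        fin_cases i
        · simpa [hD] using e0
        · simpa [hD] using e1
      | zero => simp
      | add x y _ _ hx hy => rw [inner_add_left, hx, hy, add_zero]
      | smul a x _ hx => rw [inner_smul_left, hx, mul_zero]
    have : (⟨w, hwS⟩ : Sᗮ) = 0 := by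
      refine c.toBasis.ext_elem fun i => ?_
      simp [OrthonormalBasis.repr_apply_apply, e2]
    exact congrArg Subtype.val this
  refine ⟨(LinearEquiv.ofInjectiveEndo T₀ hinj).toContinuousLinearEquiv, fun w => ⟨rfl, rfl⟩⟩

/-- Functions with independent differentials at `p` are the first two coordinates of a local
bi-Lipschitz chart at `p`. -/
theorem exists_chart {u v : RN (k + 2) → ℝ} {p : RN (k + 2)} (hu : ContDiffAt ℝ 2 u p)
    (hv : ContDiffAt ℝ 2 v p) (hup : u p = 0) (hvp : v p = 0)
    (hli : LinearIndependent ℝ ![fderiv ℝ u p, fderiv ℝ v p]) :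
    ∃ (Ψ : RN (k + 2) → RN (k + 2)) (K : ℝ≥0) (s : Set (RN (k + 2))), IsOpen s ∧ p ∈ s ∧ Ψ p = 0 ∧
      (∀ x, Ψ x 0 = u x ∧ Ψ x 1 = v x) ∧ map Ψ (𝓝 p) = 𝓝 0 ∧
      (∀ x ∈ s, ∀ y ∈ s, dist (Ψ x) (Ψ y) ≤ K * dist x y) ∧
      (∀ x ∈ s, ∀ y ∈ s, dist x y ≤ K * dist (Ψ x) (Ψ y)) := by
  obtain ⟨T, hT⟩ := exists_linearEquiv_of_linearIndependent hli
  let e₀ : RN (k + 2) := EuclideanSpace.single 0 1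
  let e₁ : RN (k + 2) := EuclideanSpace.single 1 1
  -- The linear chart `T`, with its first two coordinates corrected to be `u` and `v`.
  let Ψ : RN (k + 2) → RN (k + 2) := fun x => T (x - p) + (u x - fderiv ℝ u p (x - p)) • e₀ +
    (v x - fderiv ℝ v p (x - p)) • e₁
  have hΨp : Ψ p = 0 := by simp [Ψ, hup, hvp]
  have hΨd : HasStrictFDerivAt Ψ (T : RN (k + 2) →L[ℝ] RN (k + 2)) p := by
    have hid : HasStrictFDerivAt (fun x : RN (k + 2) => x - p)
      (ContinuousLinearMap.id ℝ (RN (k + 2))) p := (hasStrictFDerivAt_id p).sub_const p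
    have h1 := T.toContinuousLinearMap.hasStrictFDerivAt.comp p hid
    have h2 := (hu.hasStrictFDerivAt (by simp)).sub
      ((fderiv ℝ u p).hasStrictFDerivAt.comp p hid)
    have h3 := (hv.hasStrictFDerivAt (by simp)).sub
      ((fderiv ℝ v p).hasStrictFDerivAt.comp p hid)
    refine ((h1.add (h2.smul_const e₀)).add (h3.smul_const e₁)).congr_fderiv ?_
    ext w i
    simp
  obtain ⟨s, hps, hs, hapx⟩ := hΨd.approximates_deriv_on_open_nhds
  have hmap := hΨd.map_nhds_eq_of_equiv
  rw [hΨp] at hmap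
  have hN : Nontrivial (RN (k + 2)) := inferInstance
  have hNpos : 0 < ‖(T.symm : RN (k + 2) →L[ℝ] RN (k + 2))‖₊ := by
    have := T.symm.norm_pos
    exact_mod_cast this
  have hanti := hapx.antilipschitz (Or.inr (NNReal.half_lt_self (inv_pos.2 hNpos).ne'))
  have hlip := hapx.lipschitz
  refine ⟨Ψ, max (‖(T : RN (k + 2) →L[ℝ] RN (k + 2))‖₊ + ‖(T.symm : RN (k + 2) →L[ℝ] RN (k + 2))‖₊⁻¹ / 2)
    (‖(T.symm : RN (k + 2) →L[ℝ] RN (k + 2))‖₊⁻¹ - ‖(T.symm : RN (k + 2) →L[ℝ] RN (k + 2))‖₊⁻¹ / 2)⁻¹,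
    s, hs, hps, hΨp, fun x => ⟨?_, ?_⟩, hmap, fun x hx y hy => ?_, fun x hx y hy => ?_⟩
  · simp [Ψ, e₀, e₁, hT]
  · simp [Ψ, e₀, e₁, hT]
  · refine (hlip.dist_le_mul ⟨x, hx⟩ ⟨y, hy⟩).trans ?_
    exact mul_le_mul_of_nonneg_right (NNReal.coe_le_coe.2 (le_max_left _ _)) dist_nonneg
  · refine (hanti.le_mul_dist ⟨x, hx⟩ ⟨y, hy⟩).trans ?_
    exact mul_le_mul_of_nonneg_right (NNReal.coe_le_coe.2 (le_max_right _ _)) dist_nonneg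

/-- Dropping the first coordinate. -/
def dropFirst {m : ℕ} (x : RN (m + 1)) : RN m := WithLp.toLp 2 fun i => x i.succ

/-- Prepending a first coordinate. -/
def consCoord {m : ℕ} (a : ℝ) (x : RN m) : RN (m + 1) := WithLp.toLp 2 (Fin.cons a x)

@[simp] theorem dropFirst_consCoord {m : ℕ} (a : ℝ) (x : RN m) : dropFirst (consCoord a x) = x := rfl

@[simp] theorem consCoord_zero {m : ℕ} (a : ℝ) (x : RN m) : consCoord a x 0 = a := rfl

@[simp] theorem consCoord_succ {m : ℕ} (a : ℝ) (x : RN m) (i : Fin m) :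
    consCoord a x i.succ = x i := rfl

@[simp] theorem dropFirst_apply {m : ℕ} (x : RN (m + 1)) (i : Fin m) : dropFirst x i = x i.succ := rfl

theorem dist_sq_dropFirst {m : ℕ} (x y : RN (m + 1)) :
    dist x y ^ 2 = (x 0 - y 0) ^ 2 + dist (dropFirst x) (dropFirst y) ^ 2 := by
  simp only [EuclideanSpace.dist_eq]
  rw [Real.sq_sqrt (Finset.sum_nonneg fun i _ => by positivity),
    Real.sq_sqrt (Finset.sum_nonneg fun i _ => by positivity), Fin.sum_univ_succ]
  simp [Real.dist_eq, sq_abs]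

theorem dist_dropFirst_le {m : ℕ} (x y : RN (m + 1)) : dist (dropFirst x) (dropFirst y) ≤ dist x y := by
  refine le_of_sq_le_sq ?_ dist_nonneg
  rw [dist_sq_dropFirst x y]
  nlinarith [sq_nonneg (x 0 - y 0)]

theorem dist_dropFirst_eq {m : ℕ} {x y : RN (m + 1)} (h : x 0 = y 0) :
    dist (dropFirst x) (dropFirst y) = dist x y := by
  have := dist_sq_dropFirst x y
  rw [h, sub_self] at this
  exact (sq_eq_sq₀ dist_nonneg dist_nonneg).1 (by linarith)

/-- The volume of a coordinate box in Euclidean space. -/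
theorem volume_box {m : ℕ} (a b : Fin m → ℝ) :
    volume {x : RN m | ∀ i, x i ∈ Icc (a i) (b i)} = ∏ i, ENNReal.ofReal (b i - a i) := by
  rw [← Real.volume_Icc_pi, ← (PiLp.volume_preserving_ofLp (Fin m)).measure_preimage
    measurableSet_Icc.nullMeasurableSet]
  congr 1
  ext x
  simp [Pi.le_def, forall_and]

end Chart

/-! ### The size of the boundary and of its neighbourhoods -/

variable {k : ℕ}

/-- `Ψ` is a bi-Lipschitz chart on the open set `s ∋ p`, with `C²` coordinates `0` and `1`, in which
`M` is the set where coordinate `0` vanishes and coordinate `1` is nonnegative. -/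
structure IsBdryChart (M : Set (RN (k + 2))) (p : RN (k + 2)) (Ψ : RN (k + 2) → RN (k + 2))
    (K : ℝ≥0) (s : Set (RN (k + 2))) : Prop where
  isOpen : IsOpen s
  mem : p ∈ s
  apply_eq : Ψ p = 0
  contDiffAt : ∀ x ∈ s, ContDiffAt ℝ 2 (fun y => Ψ y 0) x ∧ ContDiffAt ℝ 2 (fun y => Ψ y 1) x
  linearIndependent : LinearIndependent ℝ ![fderiv ℝ (fun y => Ψ y 0) p, fderiv ℝ (fun y => Ψ y 1) p]
  map_nhds : map Ψ (𝓝 p) = 𝓝 0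
  lip : ∀ x ∈ s, ∀ y ∈ s, dist (Ψ x) (Ψ y) ≤ K * dist x y
  antilip : ∀ x ∈ s, ∀ y ∈ s, dist x y ≤ K * dist (Ψ x) (Ψ y)
  mem_iff : ∀ x ∈ s, (x ∈ M ↔ Ψ x 0 = 0 ∧ 0 ≤ Ψ x 1)
  mem_bdry_iff : ∀ x ∈ s, (x ∈ bdry M ↔ Ψ x 0 = 0 ∧ Ψ x 1 = 0)

/-- Near each point of `∂M` there is a chart straightening `M` and `∂M`. -/
theorem exists_isBdryChart {M : Set (RN (k + 2))} {p : RN (k + 2)} (hp : p ∈ bdry M)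
    {W : Set (RN (k + 2))} (hW : W ∈ 𝓝 p) :
    ∃ Ψ K s, IsBdryChart M p Ψ K s ∧ s ⊆ W := by
  obtain ⟨-, u, v, hu, hv, hup, hvp, hli, hev⟩ := hp
  obtain ⟨Ψ, K, s, hs, hps, hΨp, hΨ, hmap, hlip, hanti⟩ := exists_chart hu hv hup hvp hli
  have e0 : (fun y => Ψ y 0) = u := funext fun x => (hΨ x).1
  have e1 : (fun y => Ψ y 1) = v := funext fun x => (hΨ x).2
  have hall : ∀ᶠ x in 𝓝 p, (x ∈ M ↔ u x = 0 ∧ 0 ≤ v x) ∧ (x ∈ bdry M ↔ u x = 0 ∧ v x = 0) ∧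
      ContDiffAt ℝ 2 u x ∧ ContDiffAt ℝ 2 v x ∧ x ∈ W ∧ x ∈ s :=
    hev.and ((eventually_mem_bdry_iff hu hv hli hev).and ((hu.eventually (by simp)).and
      ((hv.eventually (by simp)).and (Filter.Eventually.and hW (hs.mem_nhds hps)))))
  obtain ⟨s', hs', hs'o, hps'⟩ := mem_nhds_iff.1 hall
  refine ⟨Ψ, K, s', ⟨hs'o, hps', hΨp, fun x hx => ?_, ?_, hmap, fun x hx y hy => ?_,
    fun x hx y hy => ?_, fun x hx => ?_, fun x hx => ?_⟩, fun x hx => (hs' hx).2.2.2.2.1⟩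
  · rw [e0, e1]; exact ⟨(hs' hx).2.2.1, (hs' hx).2.2.2.1⟩
  · rw [e0, e1]; exact hli
  · exact hlip x (hs' hx).2.2.2.2.2 y (hs' hy).2.2.2.2.2
  · exact hanti x (hs' hx).2.2.2.2.2 y (hs' hy).2.2.2.2.2
  · rw [(hΨ x).1, (hΨ x).2]; exact (hs' hx).1
  · rw [(hΨ x).1, (hΨ x).2]; exact (hs' hx).2.1

namespace IsBdryChart

variable {M : Set (RN (k + 2))} {p : RN (k + 2)} {Ψ : RN (k + 2) → RN (k + 2)} {K : ℝ≥0}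
  {s : Set (RN (k + 2))}

/-- The image under the chart of a neighbourhood of `p` contains a cube. -/
theorem exists_cube_subset (h : IsBdryChart M p Ψ K s) {W : Set (RN (k + 2))} (hW : W ∈ 𝓝 p) :
    ∃ r > 0, ∀ z : RN (k + 2), (∀ i, |z i| ≤ r) → ∃ x ∈ W ∩ s, Ψ x = z := by
  have h1 : Ψ '' (W ∩ s) ∈ 𝓝 (0 : RN (k + 2)) := by
    rw [← h.map_nhds]
    exact image_mem_map (inter_mem hW (h.isOpen.mem_nhds h.mem))
  have h2 : (fun z : Fin (k + 2) → ℝ => (WithLp.toLp 2 z : RN (k + 2))) ⁻¹' (Ψ '' (W ∩ s)) ∈ 𝓝 0 :=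
    (PiLp.continuous_toLp 2 (fun _ : Fin (k + 2) => ℝ)).continuousAt.preimage_mem_nhds (by simpa using h1)
  obtain ⟨r, hr, hsub⟩ := Metric.nhds_basis_closedBall.mem_iff.1 h2
  refine ⟨r, hr, fun z hz => ?_⟩
  have : z.ofLp ∈ Metric.closedBall (0 : Fin (k + 2) → ℝ) r := by
    rw [mem_closedBall_zero_iff, pi_norm_le_iff_of_nonneg hr.le]
    exact hz
  exact hsub this

/-- The codimension two measure of `∂M` is positive near each of its points. -/
theorem measure_bdry_inter_ne_zero (h : IsBdryChart M p Ψ K s) {W : Set (RN (k + 2))}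
    (hW : W ∈ 𝓝 p) : μHE[k] (bdry M ∩ W) ≠ 0 := by
  obtain ⟨r, hr, hcube⟩ := h.exists_cube_subset hW
  intro h0
  have hle := euclideanHausdorffMeasure_image_le_of_dist_le k K (f := id)
    (g := fun x => dropFirst (dropFirst (Ψ x))) (S := bdry M ∩ W ∩ s) fun x hx y hy =>
      (dist_dropFirst_le _ _).trans <| (dist_dropFirst_le _ _).trans (h.lip x hx.2 y hy.2)
  rw [image_id, measure_mono_null (t := bdry M ∩ W) inter_subset_left h0, mul_zero,
    EuclideanSpace.euclideanHausdorffMeasure_eq_volume] at hle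
  -- The points of `∂M` near `p` project onto a ball of `ℝᵏ`.
  have hsub : Metric.ball (0 : RN k) r ⊆
      (fun x => dropFirst (dropFirst (Ψ x))) '' (bdry M ∩ W ∩ s) := by
    intro y hy
    rw [mem_ball_zero_iff] at hy
    obtain ⟨x, hx, hxy⟩ := hcube (consCoord 0 (consCoord 0 y)) (by
      intro i
      refine Fin.cases (by simpa using hr.le)
        (fun i => Fin.cases (show |(0 : ℝ)| ≤ r by simpa using hr.le) (fun i => ?_) i) i
      simpa using (PiLp.norm_apply_le y i).trans hy.le)
    refine ⟨x, ⟨⟨(h.mem_bdry_iff x hx.2).2 ?_, hx.1⟩, hx.2⟩, by simp [hxy]⟩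
    rw [hxy]
    exact ⟨rfl, rfl⟩
  exact (Metric.measure_ball_pos volume (0 : RN k) hr).ne' (measure_mono_null hsub (le_zero_iff.1 hle))

/-- The area of the strip `a ≤ v ≤ b` of `M` is bounded below by a multiple of its width. -/
theorem exists_le_measure_strip (h : IsBdryChart M p Ψ K s) {W : Set (RN (k + 2))} (hW : W ∈ 𝓝 p) :
    ∃ c > 0, ∃ r > 0, ∀ a b : ℝ, 0 ≤ a → b ≤ r →
      ENNReal.ofReal (c * (b - a)) ≤ μHE[k + 1] (M ∩ W ∩ s ∩ {x | a ≤ Ψ x 1 ∧ Ψ x 1 ≤ b}) := by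
  obtain ⟨r, hr, hcube⟩ := h.exists_cube_subset hW
  refine ⟨(2 * r) ^ k / (K + 1) ^ (k + 1), by positivity, r, hr, fun a b ha hb => ?_⟩
  set S := M ∩ W ∩ s ∩ {x | a ≤ Ψ x 1 ∧ Ψ x 1 ≤ b}
  have hle := euclideanHausdorffMeasure_image_le_of_dist_le (k + 1) (K + 1) (f := id)
    (g := fun x => dropFirst (Ψ x)) (S := S) fun x hx y hy =>
      (dist_dropFirst_le _ _).trans <| (h.lip x hx.1.2 y hy.1.2).trans <| by
        have : (0 : ℝ) ≤ dist x y := dist_nonneg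
        push_cast
        simp only [id]
        linarith
  rw [image_id, EuclideanSpace.euclideanHausdorffMeasure_eq_volume] at hle
  let α : Fin (k + 1) → ℝ := Fin.cons a fun _ => -r
  let β : Fin (k + 1) → ℝ := Fin.cons b fun _ => r
  -- The strip projects onto a box of `ℝᵏ⁺¹` of width `b - a`.
  have hsub : {x : RN (k + 1) | ∀ i, x i ∈ Icc (α i) (β i)} ⊆ (fun x => dropFirst (Ψ x)) '' S := by
    intro y hy
    have hy0 : a ≤ y 0 ∧ y 0 ≤ b := hy 0
    obtain ⟨x, hx, hxy⟩ := hcube (consCoord 0 y) (by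
      intro i
      refine Fin.cases (by simpa using hr.le) (fun i => ?_) i
      rw [consCoord_succ, abs_le]
      refine Fin.cases ⟨by linarith, by linarith⟩ (fun i => ?_) i
      exact hy i.succ)
    have h1 : Ψ x 1 = y 0 := by rw [hxy]; rfl
    refine ⟨x, ⟨⟨⟨(h.mem_iff x hx.2).2 ?_, hx.1⟩, hx.2⟩, ?_⟩, by simp [hxy]⟩
    · rw [h1, hxy]
      exact ⟨rfl, by linarith⟩
    · simpa [h1] using hy0
  have hvol := (measure_mono hsub).trans hle
  rw [volume_box, Fin.prod_univ_succ] at hvol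
  simp only [α, β, Fin.cons_zero, Fin.cons_succ, Finset.prod_const, Finset.card_univ,
    Fintype.card_fin] at hvol
  rw [div_mul_eq_mul_div, ENNReal.ofReal_div_of_pos (by positivity)]
  refine ENNReal.div_le_of_le_mul' ?_
  calc ENNReal.ofReal ((2 * r) ^ k * (b - a)) = ENNReal.ofReal (b - a) * ENNReal.ofReal (r - -r) ^ k := by
        rw [ENNReal.ofReal_mul (by positivity), mul_comm, ENNReal.ofReal_pow (by positivity)]
        ring_nf
    _ ≤ _ := hvol
    _ = _ := by
      congr 1
      rw [ENNReal.ofReal_pow (by positivity)]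
      congr 1
      rw [ENNReal.ofReal_add (by positivity) (by positivity)]
      simp

/-- The set of points of the chart whose first two coordinates are at most `ε` has volume
`O(ε²)`. -/
theorem exists_volume_le (h : IsBdryChart M p Ψ K s) :
    ∃ C : ℝ, 0 ≤ C ∧ ∀ ε > 0,
      volume {x ∈ s ∩ Metric.ball p 1 | |Ψ x 0| ≤ ε ∧ |Ψ x 1| ≤ ε} ≤ ENNReal.ofReal (C * ε ^ 2) := by
  refine ⟨K ^ (k + 2) * (4 * (2 * K) ^ k), by positivity, fun ε hε => ?_⟩
  set S := {x ∈ s ∩ Metric.ball p 1 | |Ψ x 0| ≤ ε ∧ |Ψ x 1| ≤ ε}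
  have hle := euclideanHausdorffMeasure_image_le_of_dist_le (k + 2) K (f := Ψ)
    (g := id) (S := S) fun x hx y hy => h.antilip x hx.1.1 y hy.1.1
  rw [image_id, EuclideanSpace.euclideanHausdorffMeasure_eq_volume] at hle
  let β : Fin (k + 2) → ℝ := Fin.cons ε (Fin.cons ε fun _ => (K : ℝ))
  -- The chart maps the set into a box with two sides of length `2 ε`.
  have hsub : Ψ '' S ⊆ {x : RN (k + 2) | ∀ i, x i ∈ Icc (-β i) (β i)} := by
    rintro _ ⟨x, hx, rfl⟩ i
    rw [mem_Icc, ← abs_le]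
    refine Fin.cases hx.2.1 (fun i => Fin.cases hx.2.2 (fun i => ?_) i) i
    have h1 := h.lip x hx.1.1 p h.mem
    rw [h.apply_eq, dist_zero_right] at h1
    have h2 : dist x p < 1 := hx.1.2
    refine (PiLp.norm_apply_le (Ψ x) _).trans (h1.trans ?_)
    change (K : ℝ) * dist x p ≤ K
    nlinarith [K.coe_nonneg]
  refine hle.trans ?_
  calc (K : ℝ≥0∞) ^ (k + 2) * volume (Ψ '' S) ≤ (K : ℝ≥0∞) ^ (k + 2) *
        ∏ i, ENNReal.ofReal (β i - -β i) := by
        rw [← volume_box]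
        exact mul_le_mul_right (measure_mono hsub) _
    _ = (K : ℝ≥0∞) ^ (k + 2) * (ENNReal.ofReal (2 * ε) * (ENNReal.ofReal (2 * ε) *
        ENNReal.ofReal (2 * K) ^ k)) := by
        rw [Fin.prod_univ_succ, Fin.prod_univ_succ]
        simp only [β, Fin.cons_zero, Fin.cons_succ, Finset.prod_const, Finset.card_univ,
          Fintype.card_fin]
        ring_nf
    _ = _ := by
        rw [← ENNReal.ofReal_coe_nnreal, ← ENNReal.ofReal_pow (by positivity),
          ← ENNReal.ofReal_pow (by positivity), ← ENNReal.ofReal_mul (by positivity),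
          ← ENNReal.ofReal_mul (by positivity), ← ENNReal.ofReal_mul (by positivity)]
        congr 1
        ring

end IsBdryChart

namespace IsHypersurface

variable {M : Set (RN (k + 2))}

/-- The boundary has finite measure of codimension two: in a chart, its projection to the last `k`
coordinates is bi-Lipschitz. -/
theorem measure_bdry_lt_top (hM : IsHypersurface M) : μHE[k] (bdry M) < ∞ := by
  refine hM.isCompact_bdry.measure_lt_top_of_nhdsWithin fun p hp => ?_
  obtain ⟨Ψ, K, s, h, hs⟩ := exists_isBdryChart hp (Metric.ball_mem_nhds p one_pos)
  refine ⟨bdry M ∩ s, inter_mem_nhdsWithin _ (h.isOpen.mem_nhds h.mem), ?_⟩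
  have hle := euclideanHausdorffMeasure_image_le_of_dist_le k K
    (f := fun x => dropFirst (dropFirst (Ψ x))) (g := id) (S := bdry M ∩ s) fun x hx y hy => by
      obtain ⟨hx0, hx1⟩ := (h.mem_bdry_iff x hx.2).1 hx.1
      obtain ⟨hy0, hy1⟩ := (h.mem_bdry_iff y hy.2).1 hy.1
      have e0 : dist (dropFirst (Ψ x)) (dropFirst (Ψ y)) = dist (Ψ x) (Ψ y) :=
        dist_dropFirst_eq (by rw [hx0, hy0])
      have e1 : dist (dropFirst (dropFirst (Ψ x))) (dropFirst (dropFirst (Ψ y))) =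
          dist (dropFirst (Ψ x)) (dropFirst (Ψ y)) :=
        dist_dropFirst_eq (hx1.trans hy1.symm)
      rw [e1, e0]
      exact h.antilip x hx.2 y hy.2
  rw [image_id, EuclideanSpace.euclideanHausdorffMeasure_eq_volume] at hle
  refine hle.trans_lt (ENNReal.mul_lt_top (by simp) ?_)
  refine Bornology.IsBounded.measure_lt_top
    ((Metric.isBounded_closedBall (x := dropFirst (dropFirst (0 : RN (k + 2)))) (r := K)).subset ?_)
  rintro _ ⟨x, hx, rfl⟩
  have h1 := h.lip x hx.2 p h.mem
  have h2 : dist x p < 1 := hs hx.2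
  rw [h.apply_eq] at h1
  refine ((dist_dropFirst_le _ _).trans (dist_dropFirst_le _ _)).trans (h1.trans ?_)
  nlinarith [K.coe_nonneg]

theorem area_bdry_eq_zero (hM : IsHypersurface M) : μHE[k + 1] (bdry M) = 0 :=
  (Measure.euclideanHausdorffMeasure_zero_or_top (Nat.lt_succ_self k) (bdry M)).resolve_right
    hM.measure_bdry_lt_top.ne

theorem volume_eq_zero (hM : IsHypersurface M) {N : RN (k + 2) → RN (k + 2)}
    (hN : IsUnitNormal M N) : volume M = 0 := by
  rw [← EuclideanSpace.euclideanHausdorffMeasure_eq_volume]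
  exact (Measure.euclideanHausdorffMeasure_zero_or_top (Nat.lt_succ_self (k + 1)) M).resolve_right
    (hM.isFlatAlong hN).area_lt_top.ne

theorem measure_bdry_inter_ne_zero {p : RN (k + 2)} (hp : p ∈ bdry M)
    {W : Set (RN (k + 2))} (hW : W ∈ 𝓝 p) : μHE[k] (bdry M ∩ W) ≠ 0 := by
  obtain ⟨Ψ, K, s, h, -⟩ := exists_isBdryChart hp hW
  exact h.measure_bdry_inter_ne_zero hW

/-- The `ε`-neighbourhood of `∂M` has volume `O(ε²)`, because `∂M` has codimension two. -/
theorem exists_volume_thickening_le (hM : IsHypersurface M) :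
    ∃ C : ℝ, 0 ≤ C ∧ ∃ ε₀ > 0, ∀ ε > 0, ε < ε₀ →
      volume (Metric.thickening ε (bdry M)) ≤ ENNReal.ofReal (C * ε ^ 2) := by
  refine hM.isCompact_bdry.induction_on (p := fun S => ∃ C : ℝ, 0 ≤ C ∧ ∃ ε₀ > 0, ∀ ε > 0, ε < ε₀ →
      volume (Metric.thickening ε S) ≤ ENNReal.ofReal (C * ε ^ 2)) ?_ ?_ ?_ ?_
  · exact ⟨0, le_rfl, 1, one_pos, fun ε _ _ => by simp⟩
  · rintro S T hST ⟨C, hC, ε₀, hε₀, h⟩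
    exact ⟨C, hC, ε₀, hε₀, fun ε h1 h2 =>
      (measure_mono (Metric.thickening_subset_of_subset ε hST)).trans (h ε h1 h2)⟩
  · rintro S T ⟨C, hC, ε₀, hε₀, h⟩ ⟨C', hC', ε₀', hε₀', h'⟩
    refine ⟨C + C', add_nonneg hC hC', min ε₀ ε₀', lt_min hε₀ hε₀', fun ε h1 h2 => ?_⟩
    rw [Metric.thickening_union, add_mul, ENNReal.ofReal_add (by positivity) (by positivity)]
    exact (measure_union_le _ _).trans
      (add_le_add (h ε h1 (h2.trans_le (min_le_left _ _))) (h' ε h1 (h2.trans_le (min_le_right _ _))))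
  · intro p hp
    obtain ⟨Ψ, K, s, h, hs⟩ := exists_isBdryChart hp (Metric.ball_mem_nhds p one_pos)
    obtain ⟨r, hr, hrs⟩ := Metric.isOpen_iff.1 h.isOpen p h.mem
    obtain ⟨C, hC, hvol⟩ := h.exists_volume_le
    refine ⟨bdry M ∩ Metric.ball p (r / 2), inter_mem_nhdsWithin _
      (Metric.ball_mem_nhds p (half_pos hr)), C * (K + 1) ^ 2, by positivity, r / 2, half_pos hr,
      fun ε h1 h2 => ?_⟩
    have hsub : Metric.thickening ε (bdry M ∩ Metric.ball p (r / 2)) ⊆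
        {x ∈ s ∩ Metric.ball p 1 | |Ψ x 0| ≤ (K + 1) * ε ∧ |Ψ x 1| ≤ (K + 1) * ε} := by
      intro x hx
      obtain ⟨q, ⟨hqM, hqp⟩, hxq⟩ := Metric.mem_thickening_iff.1 hx
      have hqs : q ∈ s := hrs (Metric.ball_subset_ball (by linarith) hqp)
      have hxs : x ∈ s := by
        refine hrs (Metric.mem_ball.2 ?_)
        have := dist_triangle x q p
        rw [Metric.mem_ball] at hqp
        linarith
      obtain ⟨hq0, hq1⟩ := (h.mem_bdry_iff q hqs).1 hqM
      have hd : dist (Ψ x) (Ψ q) ≤ (K + 1) * ε := by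
        refine (h.lip x hxs q hqs).trans ?_
        have := K.coe_nonneg
        gcongr
        linarith
      have hcoord : ∀ i, |Ψ x i - Ψ q i| ≤ (K + 1) * ε := fun i => by
        refine le_trans ?_ hd
        rw [dist_eq_norm]
        exact PiLp.norm_apply_le (Ψ x - Ψ q) i
      refine ⟨⟨hxs, hs hxs⟩, ?_, ?_⟩
      · simpa [hq0] using hcoord 0
      · simpa [hq1] using hcoord 1
    refine (measure_mono hsub).trans ((hvol _ (by positivity)).trans (le_of_eq ?_))
    congr 1
    ring

end IsHypersurface

/-! ### Variations along sheared lines -/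

/-- `X` is the initial velocity of a variation that preserves `∂Ω`, is supported in `K`, and changes
the volume of every bounded set at a constant rate. By the last condition, a variation that preserves
the volumes of the phases to first order preserves them exactly. -/
def IsFlowField (Ω : Set (RN (k + 2))) (X : RN (k + 2) → RN (k + 2)) (K : Set (RN (k + 2))) : Prop :=
  ∃ δ ξ, IsVariation δ ξ ∧ velocity ξ = X ∧ ∀ t ∈ Ioo (-δ) δ, ξ t '' frontier Ω = frontier Ω ∧
    (∀ x ∉ K, ξ t x = x) ∧ ∀ S, MeasurableSet S → Bornology.IsBounded S →
      (volume (ξ t '' S)).toReal = (volume S).toReal + t * ∫ x in S, divergence X x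

/-- The shear `x ↦ x + g(x) m`. -/
def shear (g : RN (k + 2) → ℝ) (m x : RN (k + 2)) : RN (k + 2) := x + g x • m

/-- On the open set `U`, the set `∂Ω` is invariant under the shifts along `e`, conjugated with the
volume preserving shear `x ↦ x - g(x) m`. -/
structure IsShearChart (Ω U : Set (RN (k + 2))) (m : RN (k + 2)) (g : RN (k + 2) → ℝ)
    (e : RN (k + 2)) : Prop where
  isOpen : IsOpen U
  contDiff : ContDiff ℝ 2 g
  invariant : ∀ x (s : ℝ), g (x + s • m) = g x
  frontier_iff : ∀ x ∈ U, ∀ s : ℝ, x + s • e + (g (x + s • e) - g x) • m ∈ U →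
    (x + s • e + (g (x + s • e) - g x) • m ∈ frontier Ω ↔ x ∈ frontier Ω)

section Shear

variable {g : RN (k + 2) → ℝ} {m : RN (k + 2)}

theorem shear_neg_shear (hinv : ∀ x (s : ℝ), g (x + s • m) = g x) (x : RN (k + 2)) :
    shear (-g) m (shear g m x) = x := by
  simp [shear, hinv]

theorem shear_shear_neg (hinv : ∀ x (s : ℝ), g (x + s • m) = g x) (x : RN (k + 2)) :
    shear g m (shear (-g) m x) = x := by
  have := hinv x (-g x)
  rw [neg_smul] at this
  simp [shear, this]

theorem fderiv_apply_eq_zero_of_invariant (hg : ContDiff ℝ 2 g)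
    (hinv : ∀ x (s : ℝ), g (x + s • m) = g x) (x : RN (k + 2)) : fderiv ℝ g x m = 0 := by
  have h1 : HasDerivAt (fun s : ℝ => g (x + s • m)) (fderiv ℝ g x m) 0 := by
    have h2 : HasDerivAt (fun s : ℝ => x + s • m) m 0 := by
      simpa using ((hasDerivAt_id (0 : ℝ)).smul_const m).const_add x
    have h3 : HasFDerivAt g (fderiv ℝ g x) (x + (0 : ℝ) • m) := by
      simpa using (hg.differentiable (by simp) x).hasFDerivAt
    exact h3.comp_hasDerivAt 0 h2
  simp only [hinv] at h1
  exact h1.unique (hasDerivAt_const 0 (g x))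

theorem hasFDerivAt_shear (hg : ContDiff ℝ 2 g) (x : RN (k + 2)) :
    HasFDerivAt (shear g m) (ContinuousLinearMap.id ℝ (RN (k + 2)) +
      (fderiv ℝ g x).smulRight m) x :=
  (hasFDerivAt_id x).add ((hg.differentiable (by simp) x).hasFDerivAt.smul_const m)

theorem contDiff_shear (hg : ContDiff ℝ 2 g) : ContDiff ℝ 2 (shear g m) :=
  contDiff_id.add (hg.smul contDiff_const)

theorem det_id_add_smulRight (f : RN (k + 2) →L[ℝ] ℝ) (v : RN (k + 2)) :
    (ContinuousLinearMap.id ℝ (RN (k + 2)) + f.smulRight v).det = 1 + f v := by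
  rw [ContinuousLinearMap.det, ← ContinuousLinearMap.coe_coe f, ← LinearMap.transvection.det]
  congr 1

/-- The perturbation `y ↦ y + t φ(y) e` of the identity is, for small `t`, a diffeomorphism with
Jacobian determinant `1 + t ∂_e φ`. -/
theorem exists_diffeo_id_add {φ : RN (k + 2) → ℝ} (hφ : ContDiff ℝ 2 φ) (hφc : HasCompactSupport φ)
    (e : RN (k + 2)) : ∃ δ > 0, ∀ t ∈ Ioo (-δ) δ, (∀ y, 0 < 1 + t * fderiv ℝ φ y e) ∧
      ∃ η : RN (k + 2) → RN (k + 2), ContDiff ℝ 2 η ∧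
        Function.LeftInverse η (fun y => y + (t * φ y) • e) ∧
        Function.RightInverse η (fun y => y + (t * φ y) • e) := by
  have hφe : ContDiff ℝ 2 fun y => φ y • e := hφ.smul contDiff_const
  obtain ⟨C, hC⟩ := hφe.lipschitzWith_of_hasCompactSupport
    (hφc.smul_right (f' := fun _ => e)) (by simp)
  replace hC : LipschitzWith C fun y => φ y • e := hC
  refine ⟨((C : ℝ) + 1)⁻¹, by positivity, fun t ht => ?_⟩
  have htC : |t| * C < 1 := by
    have h1 : |t| < 1 / ((C : ℝ) + 1) := by rw [one_div]; exact abs_lt.2 ht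
    rw [lt_div_iff₀ (by positivity)] at h1
    nlinarith [abs_nonneg t]
  have hdφ : ∀ y, |fderiv ℝ φ y e| ≤ C := by
    intro y
    by_cases he : e = 0
    · simp [he]
    have h1 := norm_fderiv_le_of_lipschitz ℝ hC (x₀ := y)
    have h2 := ((hφ.differentiable (by simp) y).hasFDerivAt.smul_const e).fderiv
    rw [h2] at h1
    have h3 := ((fderiv ℝ φ y).smulRight e).le_of_opNorm_le h1 e
    rw [ContinuousLinearMap.smulRight_apply, norm_smul] at h3
    exact le_of_mul_le_mul_right h3 (norm_pos_iff.2 he)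
  have hpos : ∀ y, 0 < 1 + t * fderiv ℝ φ y e := by
    intro y
    have h1 : |t * fderiv ℝ φ y e| ≤ |t| * C := by
      rw [abs_mul]; exact mul_le_mul_of_nonneg_left (hdφ y) (abs_nonneg t)
    have h2 := neg_abs_le (t * fderiv ℝ φ y e)
    linarith
  refine ⟨hpos, ?_⟩
  have hap : ApproximatesLinearOn (fun y => y + (t * φ y) • e)
      ((ContinuousLinearEquiv.refl ℝ (RN (k + 2)) : RN (k + 2) →L[ℝ] RN (k + 2))) univ
      (‖t‖₊ * C) := by
    intro x _ y _
    have := hC.dist_le_mul x y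
    rw [dist_eq_norm, dist_eq_norm] at this
    have e1 : x + (t * φ x) • e - (y + (t * φ y) • e) -
        ((ContinuousLinearEquiv.refl ℝ (RN (k + 2)) : RN (k + 2) →L[ℝ] RN (k + 2))) (x - y) =
        t • (φ x • e - φ y • e) := by
      simp only [ContinuousLinearEquiv.coe_refl, ContinuousLinearMap.coe_id', id]
      module
    rw [e1, norm_smul]
    push_cast
    rw [mul_assoc]
    exact mul_le_mul_of_nonneg_left this (norm_nonneg t)
  have hc : Subsingleton (RN (k + 2)) ∨ ‖t‖₊ * C <
      ‖((ContinuousLinearEquiv.refl ℝ (RN (k + 2))).symm : RN (k + 2) →L[ℝ] RN (k + 2))‖₊⁻¹ := by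
    right
    rw [ContinuousLinearEquiv.refl_symm, ContinuousLinearEquiv.coe_refl,
      ContinuousLinearMap.nnnorm_id, inv_one]
    exact_mod_cast htC
  let H := hap.toHomeomorph _ hc
  have hH : ∀ y, H y = y + (t * φ y) • e := fun y => rfl
  have hderiv : ∀ y, HasFDerivAt H (ContinuousLinearMap.id ℝ (RN (k + 2)) +
      (t • fderiv ℝ φ y).smulRight e) y := fun y =>
    (hasFDerivAt_id y).add
      (((hφ.differentiable (by simp) y).hasFDerivAt.const_smul t).smul_const e)
  have hdet : ∀ y, (ContinuousLinearMap.id ℝ (RN (k + 2)) +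
      (t • fderiv ℝ φ y).smulRight e).det ≠ 0 := fun y => by
    rw [det_id_add_smulRight]
    exact (hpos y).ne'
  refine ⟨H.symm, H.contDiff_symm (f₀' := fun y =>
    ContinuousLinearMap.toContinuousLinearEquivOfDetNeZero _ (hdet y)) (fun y => ?_) ?_,
    H.symm_apply_apply, H.apply_symm_apply⟩
  · simpa using hderiv y
  · exact contDiff_id.add ((contDiff_const.mul hφ).smul contDiff_const)

end Shear

theorem IsVariation.measurableSet_image {δ : ℝ} {ξ : ℝ → RN (k + 2) → RN (k + 2)}
    (h : IsVariation δ ξ) {t : ℝ} (ht : t ∈ Ioo (-δ) δ) {S : Set (RN (k + 2))}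
    (hS : MeasurableSet S) : MeasurableSet (ξ t '' S) :=
  ((h.contDiff ht).continuous.measurableEmbedding (h.injective ht)).measurableSet_image' hS

theorem IsVariation.isBounded_image {δ : ℝ} {ξ : ℝ → RN (k + 2) → RN (k + 2)}
    (h : IsVariation δ ξ) {t : ℝ} (ht : t ∈ Ioo (-δ) δ) {S : Set (RN (k + 2))}
    (hS : Bornology.IsBounded S) : Bornology.IsBounded (ξ t '' S) :=
  (hS.isCompact_closure.image (h.contDiff ht).continuous).isBounded.subset
    (image_mono subset_closure)

/-- A bijection that is the identity outside `K` maps `K` to itself. -/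
theorem IsVariation.mem_of_mem {δ : ℝ} {ξ : ℝ → RN (k + 2) → RN (k + 2)}
    (h : IsVariation δ ξ) {t : ℝ} (ht : t ∈ Ioo (-δ) δ) {K : Set (RN (k + 2))}
    (hK : ∀ x ∉ K, ξ t x = x) {x : RN (k + 2)} (hx : x ∈ K) : ξ t x ∈ K := by
  by_contra hc
  exact hc ((h.injective ht (hK _ hc)).symm ▸ hx)

/-- In a shear chart, the multiples of the field generated by the shifts are flow fields. -/
theorem IsShearChart.isFlowField {Ω U : Set (RN (k + 2))} {m e : RN (k + 2)} {g : RN (k + 2) → ℝ}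
    (h : IsShearChart Ω U m g e) {β : RN (k + 2) → ℝ} (hβ : ContDiff ℝ 2 β)
    (hβc : HasCompactSupport β) (hβU : tsupport β ⊆ U) :
    IsFlowField Ω (fun x => β x • (e + fderiv ℝ g x e • m)) (tsupport β) := by
  have hg := h.contDiff
  have hng : ContDiff ℝ 2 (-g) := hg.neg
  have hinv := h.invariant
  set φ : RN (k + 2) → ℝ := fun y => β (shear g m y) with hφdef
  have hφ : ContDiff ℝ 2 φ := hβ.comp (contDiff_shear hg)
  let Hs : RN (k + 2) ≃ₜ RN (k + 2) :=
    { toFun := shear g m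
      invFun := shear (-g) m
      left_inv := shear_neg_shear hinv
      right_inv := shear_shear_neg hinv
      continuous_toFun := (contDiff_shear hg).continuous
      continuous_invFun := (contDiff_shear hng).continuous }
  have hφc : HasCompactSupport φ := hβc.comp_homeomorph Hs
  obtain ⟨δ, hδ, hdiff⟩ := exists_diffeo_id_add hφ hφc e
  have hφβ : ∀ x, φ (shear (-g) m x) = β x := fun x => by rw [hφdef]; simp [shear_shear_neg hinv]
  -- `ξ t` is the map `y ↦ y + t φ(y) e`, conjugated with the shear.
  set ξ : ℝ → RN (k + 2) → RN (k + 2) :=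
    fun t x => shear g m (shear (-g) m x + (t * β x) • e) with hξ
  have hξ' : ∀ t x, ξ t x = x + (t * β x) • e + (g (x + (t * β x) • e) - g x) • m := by
    intro t x
    have := hinv (x + (t * β x) • e) (-g x)
    have e1 : x + (t * β x) • e + -g x • m = x + -g x • m + (t * β x) • e := by abel
    rw [e1] at this
    simp only [hξ, shear, Pi.neg_apply, this]
    module
  have hid : ∀ t, ∀ x ∉ tsupport β, ξ t x = x := by
    intro t x hx
    rw [hξ', image_eq_zero_of_notMem_tsupport hx]
    simp
  have hsmooth : ContDiff ℝ 2 (fun q : ℝ × RN (k + 2) => ξ q.1 q.2) := by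
    refine (contDiff_shear hg).comp (((contDiff_shear hng).comp contDiff_snd).add ?_)
    exact (contDiff_fst.mul (hβ.comp contDiff_snd)).smul contDiff_const
  have hvar : IsVariation δ ξ := by
    refine ⟨hδ, hsmooth.contDiffOn, fun t ht => ?_, ?_, ⟨tsupport β, hβc, fun t _ => hid t⟩⟩
    · obtain ⟨-, η, hη, hl, hr⟩ := hdiff t ht
      refine ⟨fun x => shear g m (η (shear (-g) m x)),
        (contDiff_shear hg).comp (hη.comp (contDiff_shear hng)), fun x => ?_, fun x => ?_⟩
      · have := hl (shear (-g) m x)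
        simp only [hφβ] at this
        simp only [hξ, shear_neg_shear hinv, this, shear_shear_neg hinv]
      · have := hr (shear (-g) m x)
        simp only [hξ, shear_neg_shear hinv]
        simp only [hφdef] at this
        rw [this, shear_shear_neg hinv]
    · funext x
      simp [hξ']
  have hvel : velocity ξ = fun x => β x • (e + fderiv ℝ g x e • m) := by
    funext x
    refine HasDerivAt.deriv ?_
    have h1 : HasDerivAt (fun t : ℝ => x + (t * β x) • e) (β x • e) 0 := by
      simpa using (((hasDerivAt_id (0 : ℝ)).mul_const (β x)).smul_const e).const_add x
    have h2 : HasFDerivAt g (fderiv ℝ g x) (x + ((0 : ℝ) * β x) • e) := by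
      simpa using (hg.differentiable (by simp) x).hasFDerivAt
    have h3 := h1.add (((h2.comp_hasDerivAt 0 h1).sub_const (g x)).smul_const m)
    refine (h3.congr_deriv ?_).congr_of_eventuallyEq (Eventually.of_forall fun t => hξ' t x)
    simp only [map_smul, smul_eq_mul]
    module
  refine ⟨δ, ξ, hvar, hvel, fun t ht => ⟨?_, hid t, fun S hS hSb => ?_⟩⟩
  · have hiff : ∀ x, ξ t x ∈ frontier Ω ↔ x ∈ frontier Ω := by
      intro x
      by_cases hx : x ∈ tsupport β
      · have h1 := hβU (hvar.mem_of_mem ht (hid t) hx)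
        rw [hξ'] at h1 ⊢
        exact h.frontier_iff x (hβU hx) _ h1
      · rw [hid t x hx]
    refine Subset.antisymm ?_ fun y hy => ?_
    · rintro _ ⟨x, hx, rfl⟩
      exact (hiff x).2 hx
    · obtain ⟨x, rfl⟩ := (hvar.bijective ht).2 y
      exact ⟨x, (hiff x).1 hy, rfl⟩
  · -- the Jacobian determinant is affine in `t`
    set q : RN (k + 2) → ℝ := fun x => fderiv ℝ φ (shear (-g) m x) e with hq
    have hqc : Continuous q :=
      (((hφ.continuous_fderiv (by simp)).comp (contDiff_shear hng).continuous).clm_apply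
        continuous_const)
    have hqi : IntegrableOn q S := (hqc.continuousOn.integrableOn_compact
      hSb.isCompact_closure).mono_set subset_closure
    have key : ∀ t ∈ Ioo (-δ) δ, (volume (ξ t '' S)).toReal = (volume S).toReal + t * ∫ x in S, q x := by
      intro t ht
      have hpos := (hdiff t ht).1
      have hder : ∀ x, HasFDerivAt (ξ t)
          (((ContinuousLinearMap.id ℝ (RN (k + 2)) +
            (fderiv ℝ g (shear (-g) m x + (t * φ (shear (-g) m x)) • e)).smulRight m).comp
            (ContinuousLinearMap.id ℝ (RN (k + 2)) +
              (t • fderiv ℝ φ (shear (-g) m x)).smulRight e)).comp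
            (ContinuousLinearMap.id ℝ (RN (k + 2)) + (fderiv ℝ (-g) x).smulRight m)) x := by
        intro x
        have h1 : HasFDerivAt (fun y => y + (t * φ y) • e) (ContinuousLinearMap.id ℝ (RN (k + 2)) +
            (t • fderiv ℝ φ (shear (-g) m x)).smulRight e) (shear (-g) m x) :=
          (hasFDerivAt_id _).add
            (((hφ.differentiable (by simp) _).hasFDerivAt.const_smul t).smul_const e)
        have h2 := ((hasFDerivAt_shear (m := m) hg _).comp _ h1).comp x (hasFDerivAt_shear hng x)
        refine h2.congr_of_eventuallyEq (Eventually.of_forall fun y => ?_)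
        simp only [hξ, Function.comp_apply, hφβ]
      have hdet : ∀ x, (fderiv ℝ (ξ t) x).det = 1 + t * q x := by
        intro x
        rw [(hder x).fderiv, ContinuousLinearMap.det, ContinuousLinearMap.toLinearMap_comp,
          ContinuousLinearMap.toLinearMap_comp, LinearMap.det_comp, LinearMap.det_comp]
        have e1 := det_id_add_smulRight (fderiv ℝ g (shear (-g) m x + (t * φ (shear (-g) m x)) • e)) m
        have e2 := det_id_add_smulRight (t • fderiv ℝ φ (shear (-g) m x)) e
        have e3 := det_id_add_smulRight (fderiv ℝ (-g) x) m
        -- The two shears have determinant `1`, as `g` is constant along `m`.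
        rw [fderiv_apply_eq_zero_of_invariant hg hinv] at e1
        rw [fderiv_apply_eq_zero_of_invariant hng (fun x s => by simp [hinv])] at e3
        rw [ContinuousLinearMap.det] at e1 e2 e3
        rw [e1, e2, e3]
        simp [hq]
      rw [← lintegral_abs_det_fderiv_eq_addHaar_image volume hS
        (fun x _ => ((hvar.contDiff ht).differentiable (by simp) x).hasFDerivAt.hasFDerivWithinAt)
        (hvar.injective ht).injOn]
      simp only [hdet]
      have habs : Continuous fun x => |1 + t * q x| :=
        (continuous_const.add (continuous_const.mul hqc)).abs
      rw [← integral_eq_lintegral_of_nonneg_ae (Eventually.of_forall fun x => abs_nonneg _)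
        habs.aestronglyMeasurable]
      have e1 : ∀ x, |1 + t * q x| = 1 + t * q x := fun x => abs_of_pos (hpos _)
      simp only [e1]
      rw [integral_add, integral_const_mul]
      · simp [Measure.real]
      · exact integrableOn_const hSb.measure_lt_top.ne
      · exact hqi.const_mul t
    -- The rate is identified by comparison with the general first variation formula.
    have hd1 := hvar.hasDerivAt_volume hS hSb
    have hd2 : HasDerivAt (fun t => (volume (ξ t '' S)).toReal) (∫ x in S, q x) 0 := by
      have : HasDerivAt (fun t : ℝ => (volume S).toReal + t * ∫ x in S, q x) (∫ x in S, q x) 0 := by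
        simpa using ((hasDerivAt_id (0 : ℝ)).mul_const (∫ x in S, q x)).const_add (volume S).toReal
      refine this.congr_of_eventuallyEq ?_
      filter_upwards [isOpen_Ioo.mem_nhds hvar.zero_mem] with t ht using key t ht
    rw [key t ht, ← hvel, hd1.unique hd2]

theorem divergence_const_smul {X : RN (k + 2) → RN (k + 2)} (hX : ContDiff ℝ 1 X) (c : ℝ)
    (x : RN (k + 2)) : divergence (c • X) x = c * divergence X x := by
  rw [divergence, fderiv_const_smul (hX.differentiable (by simp) x)]
  simp [divergence]

theorem IsFlowField.contDiff {Ω K : Set (RN (k + 2))} {X : RN (k + 2) → RN (k + 2)}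
    (h : IsFlowField Ω X K) : ContDiff ℝ 1 X := by
  obtain ⟨δ, ξ, hv, rfl, -⟩ := h
  exact hv.contDiff_velocity

/-- Multiples of flow fields are flow fields: rescale the time. -/
theorem IsFlowField.const_smul {Ω K : Set (RN (k + 2))} {X : RN (k + 2) → RN (k + 2)}
    (h : IsFlowField Ω X K) (c : ℝ) : IsFlowField Ω (c • X) K := by
  have hX := h.contDiff
  obtain ⟨δ, ξ, hv, hvel, hrest⟩ := h
  have hpos : 0 < δ / (|c| + 1) := div_pos hv.pos (by positivity)
  have hmem : ∀ t ∈ Ioo (-(δ / (|c| + 1))) (δ / (|c| + 1)), c * t ∈ Ioo (-δ) δ := by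
    intro t ht
    rw [mem_Ioo, ← abs_lt] at ht ⊢
    rw [abs_mul]
    rw [lt_div_iff₀ (by positivity)] at ht
    nlinarith [abs_nonneg t, abs_nonneg c]
  refine ⟨δ / (|c| + 1), fun t => ξ (c * t), ⟨hpos, ?_, fun t ht => hv.diffeo _ (hmem t ht), ?_, ?_⟩,
    ?_, fun t ht => ?_⟩
  · have h1 : ContDiff ℝ 2 fun q : ℝ × RN (k + 2) => (c * q.1, q.2) :=
      (contDiff_const.mul contDiff_fst).prodMk contDiff_snd
    exact hv.contDiffOn.comp h1.contDiffOn fun q hq => ⟨hmem _ hq.1, mem_univ _⟩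
  · simpa using hv.zero
  · obtain ⟨L, hL, h⟩ := hv.compact
    exact ⟨L, hL, fun t ht => h _ (hmem t ht)⟩
  · funext x
    refine HasDerivAt.deriv ?_
    have h1 : HasDerivAt (fun t : ℝ => c * t) c 0 := by
      simpa using (hasDerivAt_id (0 : ℝ)).const_mul c
    have h2 : HasDerivAt (fun t => ξ t x) (velocity ξ x) (c * 0) := by
      rw [mul_zero]; exact hv.hasDerivAt x
    rw [hvel] at h2
    exact h2.scomp 0 h1
  · obtain ⟨h1, h2, h3⟩ := hrest _ (hmem t ht)
    refine ⟨h1, h2, fun S hS hSb => ?_⟩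
    rw [h3 S hS hSb]
    simp only [divergence_const_smul hX]
    rw [integral_const_mul]
    ring

theorem divergence_eq_zero_of_eventuallyEq {X : RN (k + 2) → RN (k + 2)} {x : RN (k + 2)}
    (h : X =ᶠ[𝓝 x] fun _ => 0) : divergence X x = 0 := by
  rw [divergence, h.fderiv_eq]
  simp

theorem divergence_add {X Y : RN (k + 2) → RN (k + 2)} (hX : ContDiff ℝ 1 X) (hY : ContDiff ℝ 1 Y)
    (x : RN (k + 2)) : divergence (X + Y) x = divergence X x + divergence Y x := by
  rw [divergence, fderiv_add (hX.differentiable (by simp) x) (hY.differentiable (by simp) x)]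
  simp [divergence]

theorem continuous_divergence {X : RN (k + 2) → RN (k + 2)} (hX : ContDiff ℝ 1 X) :
    Continuous (divergence X) := by
  have h1 : divergence X = fun x => ∑ i, ⟪EuclideanSpace.basisFun (Fin (k + 2)) ℝ i,
      fderiv ℝ X x (EuclideanSpace.basisFun (Fin (k + 2)) ℝ i)⟫ := by
    funext x
    exact LinearMap.trace_eq_sum_inner _ _
  rw [h1]
  exact continuous_finsetSum _ fun i _ => continuous_const.inner
    ((hX.continuous_fderiv (by simp)).clm_apply continuous_const)

theorem integrableOn_divergence {X : RN (k + 2) → RN (k + 2)} (hX : ContDiff ℝ 1 X)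
    {S : Set (RN (k + 2))} (hS : Bornology.IsBounded S) : IntegrableOn (divergence X) S :=
  ((continuous_divergence hX).continuousOn.integrableOn_compact
    hS.isCompact_closure).mono_set subset_closure

theorem IsFlowField.eq_zero {Ω K : Set (RN (k + 2))} {X : RN (k + 2) → RN (k + 2)}
    (h : IsFlowField Ω X K) {x : RN (k + 2)} (hx : x ∉ K) : X x = 0 := by
  obtain ⟨δ, ξ, hv, rfl, hrest⟩ := h
  have h1 : HasDerivAt (fun t => ξ t x) 0 0 := by
    refine (hasDerivAt_const (0 : ℝ) x).congr_of_eventuallyEq ?_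
    filter_upwards [isOpen_Ioo.mem_nhds hv.zero_mem] with t ht using (hrest t ht).2.1 x hx
  exact (hv.hasDerivAt x).unique h1

/-- Flow fields with disjoint supports can be added. -/
theorem IsFlowField.add {Ω K₁ K₂ : Set (RN (k + 2))} {X₁ X₂ : RN (k + 2) → RN (k + 2)}
    (h₁ : IsFlowField Ω X₁ K₁) (h₂ : IsFlowField Ω X₂ K₂) (hK₁ : IsClosed K₁)
    (hK : Disjoint K₁ K₂) : IsFlowField Ω (X₁ + X₂) (K₁ ∪ K₂) := by
  have hX₁ := h₁.contDiff
  have hX₂ := h₂.contDiff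
  have hz₁ := fun x => h₁.eq_zero (x := x)
  have hz₂ := fun x => h₂.eq_zero (x := x)
  obtain ⟨δ₁, ξ₁, hv₁, hvel₁, hrest₁⟩ := h₁
  obtain ⟨δ₂, ξ₂, hv₂, hvel₂, hrest₂⟩ := h₂
  have hm₁ : ∀ t ∈ Ioo (-(min δ₁ δ₂)) (min δ₁ δ₂), t ∈ Ioo (-δ₁) δ₁ := fun t ht =>
    ⟨by linarith [ht.1, min_le_left δ₁ δ₂], ht.2.trans_le (min_le_left _ _)⟩
  have hm₂ : ∀ t ∈ Ioo (-(min δ₁ δ₂)) (min δ₁ δ₂), t ∈ Ioo (-δ₂) δ₂ := fun t ht =>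
    ⟨by linarith [ht.1, min_le_right δ₁ δ₂], ht.2.trans_le (min_le_right _ _)⟩
  have hpos : 0 < min δ₁ δ₂ := lt_min hv₁.pos hv₂.pos
  have hout : ∀ t ∈ Ioo (-(min δ₁ δ₂)) (min δ₁ δ₂), ∀ x ∉ K₂, ξ₁ t (ξ₂ t x) = ξ₁ t x :=
    fun t ht x hx => by rw [(hrest₂ t (hm₂ t ht)).2.1 x hx]
  have hin : ∀ t ∈ Ioo (-(min δ₁ δ₂)) (min δ₁ δ₂), ∀ x ∈ K₂, ξ₁ t (ξ₂ t x) = ξ₂ t x := by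
    intro t ht x hx
    refine (hrest₁ t (hm₁ t ht)).2.1 _ fun h => ?_
    exact hK.le_bot ⟨h, hv₂.mem_of_mem (hm₂ t ht) (hrest₂ t (hm₂ t ht)).2.1 hx⟩
  refine ⟨min δ₁ δ₂, fun t x => ξ₁ t (ξ₂ t x), ⟨hpos, ?_, fun t ht => ?_, ?_, ?_⟩, ?_, fun t ht => ?_⟩
  · have h1 : ContDiffOn ℝ 2 (fun q : ℝ × RN (k + 2) => (q.1, ξ₂ q.1 q.2))
        (Ioo (-(min δ₁ δ₂)) (min δ₁ δ₂) ×ˢ univ) :=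
      contDiff_fst.contDiffOn.prodMk (hv₂.contDiffOn.mono
        (prod_mono_left fun t ht => hm₂ t ht))
    exact hv₁.contDiffOn.comp h1 fun q hq => ⟨hm₁ _ hq.1, mem_univ _⟩
  · obtain ⟨η₁, hη₁, hl₁, hr₁⟩ := hv₁.diffeo t (hm₁ t ht)
    obtain ⟨η₂, hη₂, hl₂, hr₂⟩ := hv₂.diffeo t (hm₂ t ht)
    exact ⟨η₂ ∘ η₁, hη₂.comp hη₁, hl₁.comp hl₂, hr₁.comp hr₂⟩
  · simp [hv₁.zero, hv₂.zero, Function.id_def]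
  · obtain ⟨L₁, hL₁, h1⟩ := hv₁.compact
    obtain ⟨L₂, hL₂, h2⟩ := hv₂.compact
    refine ⟨L₁ ∪ L₂, hL₁.union hL₂, fun t ht x hx => ?_⟩
    rw [mem_union, not_or] at hx
    rw [h2 t (hm₂ t ht) x hx.2, h1 t (hm₁ t ht) x hx.1]
  · funext x
    refine HasDerivAt.deriv ?_
    by_cases hx : x ∈ K₂
    · have hx₁ : X₁ x = 0 := hz₁ x fun h => hK.le_bot ⟨h, hx⟩
      rw [Pi.add_apply, hx₁, zero_add, ← hvel₂]
      refine (hv₂.hasDerivAt x).congr_of_eventuallyEq ?_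
      filter_upwards [Ioo_mem_nhds (neg_lt_zero.2 hpos) hpos] with t ht using hin t ht x hx
    · rw [Pi.add_apply, hz₂ x hx, add_zero, ← hvel₁]
      refine (hv₁.hasDerivAt x).congr_of_eventuallyEq ?_
      filter_upwards [Ioo_mem_nhds (neg_lt_zero.2 hpos) hpos] with t ht using hout t ht x hx
  · obtain ⟨f1, o1, v1⟩ := hrest₁ t (hm₁ t ht)
    obtain ⟨f2, o2, v2⟩ := hrest₂ t (hm₂ t ht)
    refine ⟨?_, fun x hx => ?_, fun S hS hSb => ?_⟩
    · rw [← image_image (ξ₁ t) (ξ₂ t), f2, f1]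
    · rw [mem_union, not_or] at hx
      simp only [o2 x hx.2, o1 x hx.1]
    · have hdz : ∀ x ∉ K₁, divergence X₁ x = 0 := fun x hx =>
        divergence_eq_zero_of_eventuallyEq
          (Filter.mem_of_superset (hK₁.isOpen_compl.mem_nhds hx) fun y hy => hz₁ y hy)
      have hmS := hv₂.measurableSet_image (hm₂ t ht) hS
      have hset : ξ₂ t '' S ∩ K₁ = S ∩ K₁ := by
        ext x
        constructor
        · rintro ⟨⟨y, hy, rfl⟩, hx⟩
          have hy2 : y ∉ K₂ := fun h => hK.le_bot ⟨hx, hv₂.mem_of_mem (hm₂ t ht) o2 h⟩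
          rw [o2 y hy2] at hx ⊢
          exact ⟨hy, hx⟩
        · rintro ⟨hx, hx1⟩
          exact ⟨⟨x, hx, o2 x fun h => hK.le_bot ⟨hx1, h⟩⟩, hx1⟩
      -- The second flow does not move points into or out of `K₁`, where the divergence of `X₁`
      -- lives.
      have hint : ∫ x in ξ₂ t '' S, divergence X₁ x = ∫ x in S, divergence X₁ x := by
        rw [setIntegral_eq_of_subset_of_forall_sdiff_eq_zero hmS
            (inter_subset_left : ξ₂ t '' S ∩ K₁ ⊆ _) fun x hx => hdz x fun h => hx.2 ⟨hx.1, h⟩,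
          setIntegral_eq_of_subset_of_forall_sdiff_eq_zero hS
            (inter_subset_left : S ∩ K₁ ⊆ _) fun x hx => hdz x fun h => hx.2 ⟨hx.1, h⟩, hset]
      rw [← image_image (ξ₁ t) (ξ₂ t), v1 _ hmS (hv₂.isBounded_image (hm₂ t ht) hSb), v2 S hS hSb, hint]
      simp only [divergence_add hX₁ hX₂]
      rw [integral_add (integrableOn_divergence hX₁ hSb) (integrableOn_divergence hX₂ hSb)]
      ring

/-! ### Mollification -/

/-- A compactly supported `C¹` function is a limit, in the `C¹` norm, of smooth functions supported in
a given neighbourhood of its support. -/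
theorem exists_contDiff_approx {β : RN (k + 2) → ℝ} (hβ : ContDiff ℝ 1 β) (hβc : HasCompactSupport β)
    {U : Set (RN (k + 2))} (hU : IsOpen U) (hβU : tsupport β ⊆ U) {ε : ℝ} (hε : 0 < ε) :
    ∃ γ : RN (k + 2) → ℝ, ContDiff ℝ 2 γ ∧ HasCompactSupport γ ∧ tsupport γ ⊆ U ∧
      ∀ x, |γ x - β x| ≤ ε ∧ ‖fderiv ℝ γ x - fderiv ℝ β x‖ ≤ ε := by
  obtain ⟨r₀, hr₀, hthick⟩ := hβc.exists_cthickening_subset_open hU hβU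
  have hu1 : UniformContinuous β := hβc.uniformContinuous_of_continuous hβ.continuous
  have hu2 : UniformContinuous (fderiv ℝ β) :=
    (hβc.fderiv ℝ).uniformContinuous_of_continuous (hβ.continuous_fderiv (by simp))
  obtain ⟨r₁, hr₁, h1⟩ := Metric.uniformContinuous_iff.1 hu1 ε hε
  obtain ⟨r₂, hr₂, h2⟩ := Metric.uniformContinuous_iff.1 hu2 ε hε
  set r := min r₀ (min r₁ r₂)
  have hr : 0 < r := lt_min hr₀ (lt_min hr₁ hr₂)
  let ρ : ContDiffBump (0 : RN (k + 2)) := ⟨r / 2, r, by linarith, by linarith⟩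
  set γ := (ρ.normed volume ⋆[ContinuousLinearMap.lsmul ℝ ℝ, volume] β) with hγ
  have hρc : HasCompactSupport (ρ.normed volume) := ρ.hasCompactSupport_normed
  have hd : ∀ x, HasFDerivAt γ ((ρ.normed volume ⋆[ContinuousLinearMap.lsmul ℝ ℝ, volume]
      fderiv ℝ β) x) x := by
    intro x
    have h := hβc.hasFDerivAt_convolution_right (ContinuousLinearMap.lsmul ℝ ℝ)
      (ρ.integrable_normed.locallyIntegrable (μ := volume)) hβ x
    have e : (ContinuousLinearMap.lsmul ℝ ℝ : ℝ →L[ℝ] ℝ →L[ℝ] ℝ).precompR (RN (k + 2)) =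
        ContinuousLinearMap.lsmul ℝ ℝ := by
      ext a A
      simp
    rwa [e] at h
  have hsupp : tsupport γ ⊆ Metric.cthickening r₀ (tsupport β) := by
    refine closure_minimal ?_ Metric.isClosed_cthickening
    refine (support_convolution_subset _).trans ?_
    rintro _ ⟨a, ha, b, hb, rfl⟩
    rw [ρ.support_normed_eq, mem_ball_zero_iff] at ha
    refine Metric.mem_cthickening_of_dist_le _ b _ _ (subset_tsupport _ hb) ?_
    rw [dist_eq_norm, add_sub_cancel_right]
    exact (ha.trans_le (min_le_left _ _)).le
  refine ⟨γ, ?_, ?_, hsupp.trans hthick, fun x => ⟨?_, ?_⟩⟩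
  · exact hρc.contDiff_convolution_left (n := 2) _ ρ.contDiff_normed
      hβ.continuous.locallyIntegrable
  · exact HasCompactSupport.of_support_subset_isCompact (hβc.isCompact.cthickening)
      ((subset_tsupport _).trans hsupp)
  · rw [← Real.dist_eq]
    refine ρ.dist_normed_convolution_le hβ.continuous.aestronglyMeasurable fun y hy => (h1 ?_).le
    exact lt_of_lt_of_le (Metric.mem_ball.1 hy) ((min_le_right _ _).trans (min_le_left _ _))
  · rw [(hd x).fderiv, ← dist_eq_norm]
    refine ρ.dist_normed_convolution_le (hβ.continuous_fderiv (by simp)).aestronglyMeasurable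
      fun y hy => (h2 ?_).le
    exact lt_of_lt_of_le (Metric.mem_ball.1 hy) ((min_le_right _ _).trans (min_le_right _ _))

/-- Mollification does not increase the Lipschitz constant. -/
theorem lipschitzWith_normed_convolution (ρ : ContDiffBump (0 : RN (k + 2))) {f : RN (k + 2) → ℝ}
    {L : ℝ≥0} (hf : LipschitzWith L f) :
    LipschitzWith L (ρ.normed volume ⋆[ContinuousLinearMap.lsmul ℝ ℝ, volume] f) := by
  have hex : ∀ x, Integrable (fun t => ρ.normed volume t • f (x - t)) := fun x =>
    (ρ.hasCompactSupport_normed.convolutionExists_left (ContinuousLinearMap.lsmul ℝ ℝ)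
      ρ.continuous_normed hf.continuous.locallyIntegrable x : _)
  refine LipschitzWith.of_dist_le_mul fun x y => ?_
  rw [Real.dist_eq, convolution_def, convolution_def]
  simp only [ContinuousLinearMap.lsmul_apply]
  rw [← integral_sub (hex x) (hex y), ← Real.norm_eq_abs]
  calc _ ≤ ∫ t, ρ.normed volume t * (L * dist x y) := by
        refine norm_integral_le_of_norm_le (ρ.integrable_normed.mul_const _)
          (Eventually.of_forall fun t => ?_)
        rw [← smul_sub, norm_smul, Real.norm_of_nonneg (ρ.nonneg_normed t)]
        refine mul_le_mul_of_nonneg_left ?_ (ρ.nonneg_normed t)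
        have := hf.dist_le_mul (x - t) (y - t)
        rwa [dist_sub_right, dist_eq_norm] at this
    _ = L * dist x y := by rw [integral_mul_const, ρ.integral_normed, one_mul]

/-- Smooth cutoff functions that vanish near `S`, are equal to `1` away from `S`, and have a
derivative of order `1 / ε`. -/
theorem exists_cutoff (S : Set (RN (k + 2))) {ε : ℝ} (hε : 0 < ε) :
    ∃ θ : RN (k + 2) → ℝ, ContDiff ℝ 2 θ ∧ (∀ x, |θ x| ≤ 1) ∧ (∀ x, ‖fderiv ℝ θ x‖ ≤ 4 / ε) ∧
      (∀ x ∈ Metric.thickening (ε / 8) S, θ x = 0) ∧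
      ∀ x ∉ Metric.thickening ε S, θ =ᶠ[𝓝 x] fun _ => 1 := by
  rcases S.eq_empty_or_nonempty with rfl | hS
  · exact ⟨fun _ => 1, contDiff_const, fun x => by simp, fun x => by simpa using by positivity,
      fun x hx => by simp at hx, fun x _ => EventuallyEq.rfl⟩
  -- A truncated affine function of the distance to `S`, with value `0` up to the distance `ε / 4`
  -- and `1` from the distance `ε / 2` on, mollified at the scale `ε / 8`.
  set f : RN (k + 2) → ℝ := fun x => max 0 (min 1 (4 / ε * Metric.infDist x S - 1)) with hf
  have hfL : LipschitzWith ⟨4 / ε, by positivity⟩ f := by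
    have h1 : LipschitzWith ⟨4 / ε, by positivity⟩ fun x => 4 / ε * Metric.infDist x S - 1 := by
      refine LipschitzWith.of_dist_le_mul fun x y => ?_
      have := (Metric.lipschitz_infDist_pt S).dist_le_mul x y
      rw [Real.dist_eq] at this ⊢
      have e : 4 / ε * Metric.infDist x S - 1 - (4 / ε * Metric.infDist y S - 1) =
        4 / ε * (Metric.infDist x S - Metric.infDist y S) := by ring
      rw [e, abs_mul, abs_of_pos (show 0 < 4 / ε by positivity)]
      refine mul_le_mul_of_nonneg_left ?_ (by positivity)
      simpa using this
    exact (h1.const_min 1).const_max 0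
  have hf01 : ∀ x, 0 ≤ f x ∧ f x ≤ 1 := fun x =>
    ⟨le_max_left _ _, max_le zero_le_one (min_le_left _ _)⟩
  let ρ : ContDiffBump (0 : RN (k + 2)) := ⟨ε / 16, ε / 8, by linarith, by linarith⟩
  set θ := (ρ.normed volume ⋆[ContinuousLinearMap.lsmul ℝ ℝ, volume] f) with hθ
  have h1 : ∀ x ∉ Metric.thickening (ε * 3 / 4) S, θ x = 1 := by
    intro x hx
    have hball : ∀ y ∈ Metric.ball x ρ.rOut, f y = 1 := by
      intro y hy
      have hxd : ε * 3 / 4 ≤ Metric.infDist x S := by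
        by_contra! h
        exact hx ((Metric.mem_thickening_iff_infDist_lt hS).2 h)
      have h2 := Metric.infDist_le_infDist_add_dist (s := S) (x := x) (y := y)
      have h3 : dist y x < ε / 8 := hy
      rw [dist_comm] at h3
      have h4 : 1 ≤ 4 / ε * Metric.infDist y S - 1 := by
        have : ε / 2 ≤ Metric.infDist y S := by linarith
        have h5 : 4 / ε * (ε / 2) ≤ 4 / ε * Metric.infDist y S :=
          mul_le_mul_of_nonneg_left this (by positivity)
        have h6 : 4 / ε * (ε / 2) = 2 := by field_simp; norm_num
        linarith
      simp only [hf]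
      rw [min_eq_left h4, max_eq_right zero_le_one]
    have hx1 := hball x (Metric.mem_ball_self ρ.rOut_pos)
    rw [hθ, ρ.normed_convolution_eq_right fun y hy => by rw [hball y hy, hx1], hx1]
  refine ⟨θ, ?_, fun x => ?_, fun x => ?_, fun x hx => ?_, fun x hx => ?_⟩
  · exact ρ.hasCompactSupport_normed.contDiff_convolution_left (n := 2) _ ρ.contDiff_normed
      hfL.continuous.locallyIntegrable
  · have := ρ.dist_normed_convolution_le (μ := volume) (x₀ := x) (ε := 1) (g := fun y => f y - f x + f x)
      (by simpa using hfL.continuous.aestronglyMeasurable) fun y _ => by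
        rw [Real.dist_eq, abs_le]; constructor <;> linarith [hf01 x, hf01 y]
    have h2 : |θ x - 1 / 2| ≤ 1 / 2 := by
      rw [← Real.dist_eq]
      refine dist_convolution_le (by norm_num) ρ.support_normed_eq.subset ρ.nonneg_normed
        ρ.integral_normed hfL.continuous.aestronglyMeasurable fun y _ => ?_
      rw [Real.dist_eq, abs_le]
      constructor <;> linarith [hf01 y]
    rw [abs_le] at h2 ⊢
    constructor <;> linarith
  · exact norm_fderiv_le_of_lipschitz ℝ (lipschitzWith_normed_convolution ρ hfL)
  · have hball : ∀ y ∈ Metric.ball x ρ.rOut, f y = 0 := by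
      intro y hy
      have hxd := (Metric.mem_thickening_iff_infDist_lt hS).1 hx
      have h2 := Metric.infDist_le_infDist_add_dist (s := S) (x := y) (y := x)
      have h3 : dist y x < ε / 8 := hy
      have h4 : 4 / ε * Metric.infDist y S - 1 ≤ 0 := by
        have : Metric.infDist y S ≤ ε / 4 := by linarith
        have h5 : 4 / ε * Metric.infDist y S ≤ 4 / ε * (ε / 4) :=
          mul_le_mul_of_nonneg_left this (by positivity)
        have h6 : 4 / ε * (ε / 4) = 1 := by field_simp
        linarith
      simp only [hf]
      exact max_eq_left ((min_le_right _ _).trans h4)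
    have hx1 := hball x (Metric.mem_ball_self ρ.rOut_pos)
    rw [hθ, ρ.normed_convolution_eq_right fun y hy => by rw [hball y hy, hx1], hx1]
  · have hcl : (Metric.cthickening (ε * 3 / 4) S)ᶜ ∈ 𝓝 x :=
      Metric.isClosed_cthickening.isOpen_compl.mem_nhds fun h =>
        hx (Metric.cthickening_subset_thickening' hε (by linarith) S h)
    filter_upwards [hcl] with y hy using
      h1 y fun h => hy (Metric.thickening_subset_cthickening _ _ h)

/-! ### Linearity of the first variation and of the flux -/

section Linearity

variable {M : Set (RN (k + 2))} {N X Y : RN (k + 2) → RN (k + 2)}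

theorem tanTrace_add (A B : RN (k + 2) →L[ℝ] RN (k + 2)) (ν : RN (k + 2)) :
    tanTrace (A + B) ν = tanTrace A ν + tanTrace B ν := by
  simp [tanTrace, inner_add_left]
  ring

theorem tanTrace_smul (c : ℝ) (A : RN (k + 2) →L[ℝ] RN (k + 2)) (ν : RN (k + 2)) :
    tanTrace (c • A) ν = c * tanTrace A ν := by
  simp [tanTrace, inner_smul_left]
  ring

theorem tanTrace_smulRight (f : RN (k + 2) →L[ℝ] ℝ) (v ν : RN (k + 2)) :
    tanTrace (f.smulRight v) ν = f (v - ⟪v, ν⟫ • ν) := by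
  have : LinearMap.trace ℝ _ ((f.smulRight v : RN (k + 2) →L[ℝ] RN (k + 2)) :
      RN (k + 2) →ₗ[ℝ] RN (k + 2)) = f v := by
    exact LinearMap.trace_smulRight _ _
  rw [tanTrace, this]
  simp [inner_smul_left]
  ring

theorem IsFlatAlong.continuousOn_tanTrace (hM : IsFlatAlong M N) (hX : ContDiff ℝ 1 X) :
    ContinuousOn (fun x => tanTrace (fderiv ℝ X x) (N x)) M := by
  have h1 := (continuous_divergence hX).continuousOn (s := M)
  have h2 : ContinuousOn (fun x => fderiv ℝ X x (N x)) M :=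
    (hX.continuous_fderiv (by simp)).continuousOn.clm_apply hM.continuousOn
  exact h1.sub (h2.inner hM.continuousOn)

theorem IsFlatAlong.integrableOn (hM : IsFlatAlong M N) {f : RN (k + 2) → ℝ} (hf : ContinuousOn f M) :
    IntegrableOn f M μHE[k + 1] := by
  obtain ⟨C, hC⟩ := hM.isCompact.exists_bound_of_continuousOn hf
  exact IntegrableOn.of_bound hM.area_lt_top (hf.aestronglyMeasurable hM.measurableSet) C
    ((ae_restrict_iff' hM.measurableSet).2 (Eventually.of_forall hC))

theorem IsFlatAlong.integrableOn_tanTrace (hM : IsFlatAlong M N) (hX : ContDiff ℝ 1 X) :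
    IntegrableOn (fun x => tanTrace (fderiv ℝ X x) (N x)) M μHE[k + 1] :=
  hM.integrableOn (hM.continuousOn_tanTrace hX)

theorem IsFlatAlong.firstVar_add (hM : IsFlatAlong M N) (hX : ContDiff ℝ 1 X) (hY : ContDiff ℝ 1 Y) :
    firstVar M N (X + Y) = firstVar M N X + firstVar M N Y := by
  rw [firstVar, firstVar, firstVar,
    ← integral_add (hM.integrableOn_tanTrace hX) (hM.integrableOn_tanTrace hY)]
  refine integral_congr_ae (Eventually.of_forall fun x => ?_)
  simp only []
  rw [fderiv_add (hX.differentiable (by simp) x) (hY.differentiable (by simp) x), tanTrace_add]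

theorem firstVar_const_smul (hX : ContDiff ℝ 1 X) (c : ℝ) :
    firstVar M N (c • X) = c * firstVar M N X := by
  rw [firstVar, firstVar, ← integral_const_mul]
  refine integral_congr_ae (Eventually.of_forall fun x => ?_)
  simp only []
  rw [fderiv_const_smul (hX.differentiable (by simp) x), tanTrace_smul]

theorem integral_divergence_add {S : Set (RN (k + 2))} (hS : Bornology.IsBounded S)
    (hX : ContDiff ℝ 1 X) (hY : ContDiff ℝ 1 Y) :
    ∫ x in S, divergence (X + Y) x = (∫ x in S, divergence X x) + ∫ x in S, divergence Y x := by
  simp only [divergence_add hX hY]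
  exact integral_add (integrableOn_divergence hX hS) (integrableOn_divergence hY hS)

theorem integral_divergence_const_smul (S : Set (RN (k + 2))) (hX : ContDiff ℝ 1 X) (c : ℝ) :
    ∫ x in S, divergence (c • X) x = c * ∫ x in S, divergence X x := by
  simp only [divergence_const_smul hX]
  exact integral_const_mul _ _

theorem hasFDerivAt_mulField {β : RN (k + 2) → ℝ} (hβ : ContDiff ℝ 1 β) (hX : ContDiff ℝ 1 X)
    (x : RN (k + 2)) : HasFDerivAt (fun x => β x • X x)
      (β x • fderiv ℝ X x + (fderiv ℝ β x).smulRight (X x)) x :=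
  (hβ.differentiable (by simp) x).hasFDerivAt.smul (hX.differentiable (by simp) x).hasFDerivAt

theorem divergence_mulField {β : RN (k + 2) → ℝ} (hβ : ContDiff ℝ 1 β) (hX : ContDiff ℝ 1 X)
    (x : RN (k + 2)) :
    divergence (fun x => β x • X x) x = β x * divergence X x + fderiv ℝ β x (X x) := by
  rw [divergence, (hasFDerivAt_mulField hβ hX x).fderiv, divergence]
  have : LinearMap.trace ℝ _ (((fderiv ℝ β x).smulRight (X x) : RN (k + 2) →L[ℝ] RN (k + 2)) :
      RN (k + 2) →ₗ[ℝ] RN (k + 2)) = fderiv ℝ β x (X x) := LinearMap.trace_smulRight _ _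
  rw [← this]
  simp

theorem tanTrace_mulField {β : RN (k + 2) → ℝ} (hβ : ContDiff ℝ 1 β) (hX : ContDiff ℝ 1 X)
    (x ν : RN (k + 2)) : tanTrace (fderiv ℝ (fun x => β x • X x) x) ν =
      β x * tanTrace (fderiv ℝ X x) ν + fderiv ℝ β x (X x - ⟪X x, ν⟫ • ν) := by
  rw [(hasFDerivAt_mulField hβ hX x).fderiv, tanTrace_add, tanTrace_smul, tanTrace_smulRight]

theorem norm_tangential_le {ν : RN (k + 2)} (hν : ‖ν‖ = 1) (v : RN (k + 2)) :
    ‖v - ⟪v, ν⟫ • ν‖ ≤ ‖v‖ := by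
  have := norm_hypProj_le hν v
  rwa [hypProj, real_inner_comm] at this

/-- The first variation and the flux in the direction `β X` depend continuously on `β` in the `C¹`
norm. -/
theorem IsFlatAlong.exists_bound (hM : IsFlatAlong M N) {S : Set (RN (k + 2))}
    (hSb : Bornology.IsBounded S) (hX : ContDiff ℝ 1 X) :
    ∃ C : ℝ, 0 ≤ C ∧ ∀ (γ : RN (k + 2) → ℝ) (ε : ℝ), ContDiff ℝ 1 γ → 0 ≤ ε →
      (∀ x, |γ x| ≤ ε ∧ ‖fderiv ℝ γ x‖ ≤ ε) → |firstVar M N (fun x => γ x • X x)| ≤ C * ε ∧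
        |∫ x in S, divergence (fun x => γ x • X x) x| ≤ C * ε := by
  obtain ⟨C₁, hC₁⟩ := hM.isCompact.exists_bound_of_continuousOn (hM.continuousOn_tanTrace hX)
  obtain ⟨C₂, hC₂⟩ := hM.isCompact.exists_bound_of_continuousOn hX.continuous.continuousOn
  obtain ⟨C₃, hC₃⟩ := hSb.isCompact_closure.exists_bound_of_continuousOn
    (continuous_divergence hX).continuousOn
  obtain ⟨C₄, hC₄⟩ := hSb.isCompact_closure.exists_bound_of_continuousOn hX.continuous.continuousOn
  refine ⟨(|C₁| + |C₂|) * (μHE[k + 1]).real M + (|C₃| + |C₄|) * volume.real S, by positivity,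
    fun γ ε hγ hε h => ⟨?_, ?_⟩⟩
  · have h1 : ‖∫ x in M, tanTrace (fderiv ℝ (fun x => γ x • X x) x) (N x) ∂μHE[k + 1]‖ ≤
        ((|C₁| + |C₂|) * ε) * (μHE[k + 1]).real M := by
      refine norm_setIntegral_le_of_norm_le_const hM.area_lt_top fun x hx => ?_
      rw [tanTrace_mulField hγ hX]
      have a1 := hC₁ x hx
      have a2 := (norm_tangential_le (hM.norm_eq x hx) (X x)).trans (hC₂ x hx)
      calc _ ≤ ‖γ x * tanTrace (fderiv ℝ X x) (N x)‖ + ‖fderiv ℝ γ x (X x - ⟪X x, N x⟫ • N x)‖ :=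
            norm_add_le _ _
        _ ≤ ε * |C₁| + ε * |C₂| := by
            refine add_le_add ?_ ?_
            · rw [norm_mul]
              exact mul_le_mul (h x).1 (a1.trans (le_abs_self _)) (norm_nonneg _) hε
            · exact (ContinuousLinearMap.le_of_opNorm_le _ (h x).2 _).trans
                (mul_le_mul_of_nonneg_left (a2.trans (le_abs_self _)) hε)
        _ = _ := by ring
    rw [firstVar, ← Real.norm_eq_abs]
    have : 0 ≤ (|C₃| + |C₄|) * volume.real S * ε := by positivity
    linarith
  · have h1 : ‖∫ x in S, divergence (fun x => γ x • X x) x‖ ≤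
        ((|C₃| + |C₄|) * ε) * volume.real S := by
      refine norm_setIntegral_le_of_norm_le_const hSb.measure_lt_top fun x hx => ?_
      rw [divergence_mulField hγ hX]
      have a1 := hC₃ x (subset_closure hx)
      have a2 := hC₄ x (subset_closure hx)
      calc _ ≤ ‖γ x * divergence X x‖ + ‖fderiv ℝ γ x (X x)‖ := norm_add_le _ _
        _ ≤ ε * |C₃| + ε * |C₄| := by
            refine add_le_add ?_ ?_
            · rw [norm_mul]
              exact mul_le_mul (h x).1 (a1.trans (le_abs_self _)) (norm_nonneg _) hε
            · exact (ContinuousLinearMap.le_of_opNorm_le _ (h x).2 _).trans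
                (mul_le_mul_of_nonneg_left (a2.trans (le_abs_self _)) hε)
        _ = _ := by ring
    rw [← Real.norm_eq_abs]
    have : 0 ≤ (|C₁| + |C₂|) * (μHE[k + 1]).real M * ε := by positivity
    linarith

end Linearity

/-! ### The Lagrange multiplier -/

/-- A variation that preserves `∂Ω` preserves `Ω`: no trajectory can cross `∂Ω`. -/
theorem IsVariation.mem_iff {δ : ℝ} {ξ : ℝ → RN (k + 2) → RN (k + 2)} (h : IsVariation δ ξ)
    {Ω : Set (RN (k + 2))} (hΩ : IsOpen Ω)
    (hfr : ∀ t ∈ Ioo (-δ) δ, ξ t '' frontier Ω = frontier Ω) {t : ℝ} (ht : t ∈ Ioo (-δ) δ)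
    (x : RN (k + 2)) : ξ t x ∈ Ω ↔ x ∈ Ω := by
  have hxfr : ∀ s ∈ Ioo (-δ) δ, ξ s x ∈ frontier Ω → x ∈ frontier Ω := by
    intro s hs hx
    rw [← hfr s hs] at hx
    obtain ⟨y, hy, hyx⟩ := hx
    exact h.injective hs hyx ▸ hy
  have hx0 : ξ 0 x = x := by rw [h.zero]; rfl
  have hpc : IsPreconnected ((fun s => ξ s x) '' Ioo (-δ) δ) := by
    refine isPreconnected_Ioo.image _ fun s hs => ?_
    have h1 := (h.contDiffAt hs x).continuousAt
    exact (h1.comp (f := fun s : ℝ => (s, x)) (by fun_prop)).continuousWithinAt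
  by_contra hne
  have hne' : ¬ (ξ t x ∈ Ω ↔ ξ 0 x ∈ Ω) := by rwa [hx0]
  have hmt : ξ t x ∈ (fun s => ξ s x) '' Ioo (-δ) δ := ⟨t, ht, rfl⟩
  have hm0 : ξ 0 x ∈ (fun s => ξ s x) '' Ioo (-δ) δ := ⟨0, h.zero_mem, rfl⟩
  obtain ⟨_, ⟨s, hs, rfl⟩, hsfr⟩ : ((fun s => ξ s x) '' Ioo (-δ) δ ∩ frontier Ω).Nonempty := by
    by_contra hemp
    rw [not_nonempty_iff_eq_empty] at hemp
    have hsub : (fun s => ξ s x) '' Ioo (-δ) δ ⊆ Ω ∪ (closure Ω)ᶜ := by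
      intro y hy
      by_contra hc
      rw [mem_union, mem_compl_iff, not_or, not_not] at hc
      have : y ∈ frontier Ω := by rw [hΩ.frontier_eq]; exact ⟨hc.2, hc.1⟩
      exact (hemp ▸ ⟨hy, this⟩ : y ∈ (∅ : Set (RN (k + 2))))
    have hd : Disjoint Ω (closure Ω)ᶜ := disjoint_left.2 fun y hy hy' => hy' (subset_closure hy)
    rcases hpc.subset_or_subset hΩ isClosed_closure.isOpen_compl hd hsub with h1 | h1
    · exact hne' (iff_of_true (h1 hmt) (h1 hm0))
    · exact hne' (iff_of_false (fun h => h1 hmt (subset_closure h)) fun h => h1 hm0 (subset_closure h))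
  have hxf := hxfr s hs hsfr
  have hf : ∀ y ∈ frontier Ω, y ∉ Ω := fun y hy => by
    rw [hΩ.frontier_eq] at hy; exact hy.2
  refine hne (iff_of_false (hf _ ?_) (hf _ hxf))
  rw [← hfr t ht]
  exact mem_image_of_mem _ hxf

theorem IsVariation.image_eq {δ : ℝ} {ξ : ℝ → RN (k + 2) → RN (k + 2)} (h : IsVariation δ ξ)
    {Ω : Set (RN (k + 2))} (hΩ : IsOpen Ω)
    (hfr : ∀ t ∈ Ioo (-δ) δ, ξ t '' frontier Ω = frontier Ω) {t : ℝ} (ht : t ∈ Ioo (-δ) δ) :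
    ξ t '' Ω = Ω := by
  refine Subset.antisymm ?_ fun y hy => ?_
  · rintro _ ⟨x, hx, rfl⟩
    exact (h.mem_iff hΩ hfr ht x).2 hx
  · obtain ⟨x, rfl⟩ := (h.bijective ht).2 y
    exact ⟨x, (h.mem_iff hΩ hfr ht x).1 hy, rfl⟩

/-- The velocity of a variation that preserves the volume of `S` has no flux out of `S`. -/
theorem IsVariation.integral_divergence_eq_zero {δ : ℝ} {ξ : ℝ → RN (k + 2) → RN (k + 2)}
    (h : IsVariation δ ξ) {S : Set (RN (k + 2))} (hS : MeasurableSet S)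
    (hSb : Bornology.IsBounded S) (hvol : ∀ t ∈ Ioo (-δ) δ, volume (ξ t '' S) = volume S) :
    ∫ x in S, divergence (velocity ξ) x = 0 := by
  refine (h.hasDerivAt_volume hS hSb).unique
    ((hasDerivAt_const (0 : ℝ) (volume S).toReal).congr_of_eventuallyEq ?_)
  filter_upwards [isOpen_Ioo.mem_nhds h.zero_mem] with t ht
  rw [hvol t ht]

section

variable {Ω M Ω₁ Ω₂ : Set (RN (k + 2))} {N : RN (k + 2) → RN (k + 2)}

namespace IsPartitioning

theorem isFlatAlong (h : IsPartitioning Ω M N Ω₁ Ω₂) : IsFlatAlong M N :=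
  h.hypersurface.isFlatAlong h.normal

theorem subset₁ (h : IsPartitioning Ω M N Ω₁ Ω₂) : Ω₁ ⊆ Ω := fun x hx =>
  (h.union ▸ Or.inl hx : x ∈ Ω \ M).1

theorem subset₂ (h : IsPartitioning Ω M N Ω₁ Ω₂) : Ω₂ ⊆ Ω := fun x hx =>
  (h.union ▸ Or.inr hx : x ∈ Ω \ M).1

theorem isBounded₁ (h : IsPartitioning Ω M N Ω₁ Ω₂) : Bornology.IsBounded Ω₁ :=
  h.container.isBounded.subset h.subset₁

theorem isBounded₂ (h : IsPartitioning Ω M N Ω₁ Ω₂) : Bornology.IsBounded Ω₂ :=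
  h.container.isBounded.subset h.subset₂

theorem integral_eq_add (h : IsPartitioning Ω M N Ω₁ Ω₂) {f : RN (k + 2) → ℝ}
    (hf : IntegrableOn f Ω) : ∫ x in Ω, f x = (∫ x in Ω₁, f x) + ∫ x in Ω₂, f x := by
  have hM0 : volume M = 0 := h.hypersurface.volume_eq_zero h.normal
  have hae : (Ω \ M : Set (RN (k + 2))) =ᵐ[volume] Ω := sdiff_null_ae_eq_self hM0
  rw [← setIntegral_congr_set hae, ← h.union,
    setIntegral_union h.disjoint h.isOpen₂.measurableSet (hf.mono_set h.subset₁)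
      (hf.mono_set h.subset₂)]

end IsPartitioning

/-- If the flux of a flow field out of `Ω₁` is zero, then its variation is admissible. -/
theorem IsFlowField.firstVar_eq_zero (hM : IsMinimalPartitioning Ω M N Ω₁ Ω₂)
    {X : RN (k + 2) → RN (k + 2)} {K : Set (RN (k + 2))} (h : IsFlowField Ω X K)
    (hQ : ∫ x in Ω₁, divergence X x = 0) : firstVar M N X = 0 := by
  have hX := h.contDiff
  obtain ⟨δ, ξ, hv, hvel, hrest⟩ := h
  have hfr := fun t ht => (hrest t ht).1
  have hΩo := hM.container.isOpen
  have hΩ0 : ∫ x in Ω, divergence X x = 0 := by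
    rw [← hvel]
    exact hv.integral_divergence_eq_zero hΩo.measurableSet hM.container.isBounded fun t ht => by
      rw [hv.image_eq hΩo hfr ht]
  have hQ2 : ∫ x in Ω₂, divergence X x = 0 := by
    have := hM.integral_eq_add (integrableOn_divergence hX hM.container.isBounded)
    linarith
  have hvol : ∀ S, IsOpen S → Bornology.IsBounded S → ∫ x in S, divergence X x = 0 →
      ∀ t ∈ Ioo (-δ) δ, volume (ξ t '' S) = volume S := by
    intro S hS hSb h0 t ht
    have := (hrest t ht).2.2 S hS.measurableSet hSb
    rw [h0, mul_zero, add_zero] at this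
    exact (ENNReal.toReal_eq_toReal_iff' (hv.isBounded_image ht hSb).measure_lt_top.ne
      hSb.measure_lt_top.ne).1 this
  have hadm : IsAdmissible Ω Ω₁ Ω₂ δ ξ := ⟨hv, fun t ht => ⟨hfr t ht,
    hvol _ hM.isOpen₁ hM.isBounded₁ hQ t ht, hvol _ hM.isOpen₂ hM.isBounded₂ hQ2 t ht⟩⟩
  rw [← hvel]
  exact (hv.hasDerivAt_area hM.isFlatAlong).unique (hM.critical δ ξ hadm)

/-- For flow fields `X₁`, `X₂` with disjoint supports, the combination `q₂ X₁ - q₁ X₂`, with `q₁`,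
`q₂` the fluxes out of `Ω₁`, is a flow field of zero flux. -/
theorem IsFlowField.mul_firstVar_eq (hM : IsMinimalPartitioning Ω M N Ω₁ Ω₂)
    {X₁ X₂ : RN (k + 2) → RN (k + 2)} {K₁ K₂ : Set (RN (k + 2))} (h₁ : IsFlowField Ω X₁ K₁)
    (h₂ : IsFlowField Ω X₂ K₂) (hK₁ : IsClosed K₁) (hK : Disjoint K₁ K₂) :
    (∫ x in Ω₁, divergence X₂ x) * firstVar M N X₁ =
      (∫ x in Ω₁, divergence X₁ x) * firstVar M N X₂ := by
  have hX₁ := h₁.contDiff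
  have hX₂ := h₂.contDiff
  set q₁ := ∫ x in Ω₁, divergence X₁ x with hq₁
  set q₂ := ∫ x in Ω₁, divergence X₂ x with hq₂
  have hY₁ : ContDiff ℝ 1 (q₂ • X₁) := hX₁.const_smul q₂
  have hY₂ : ContDiff ℝ 1 (-q₁ • X₂) := hX₂.const_smul (-q₁)
  have h := (h₁.const_smul q₂).add (h₂.const_smul (-q₁)) hK₁ hK
  have h0 := h.firstVar_eq_zero hM (by
    rw [integral_divergence_add hM.isBounded₁ hY₁ hY₂,
      integral_divergence_const_smul _ hX₁, integral_divergence_const_smul _ hX₂, ← hq₁, ← hq₂]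
    ring)
  rw [hM.isFlatAlong.firstVar_add hY₁ hY₂,
    firstVar_const_smul hX₁, firstVar_const_smul hX₂] at h0
  linarith

/-- Inside `Ω`, the constant directions form shear charts. -/
theorem isShearChart_of_subset {U : Set (RN (k + 2))} (hΩ : IsOpen Ω) (hU : IsOpen U) (hUΩ : U ⊆ Ω)
    (e : RN (k + 2)) : IsShearChart Ω U 0 (fun _ => 0) e where
  isOpen := hU
  contDiff := contDiff_const
  invariant _ _ := rfl
  frontier_iff x hx s hs := by
    rw [hΩ.frontier_eq]
    exact iff_of_false (fun h => h.2 (hUΩ hs)) (fun h => h.2 (hUΩ hx))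

theorem isFlowField_smul_const {U : Set (RN (k + 2))} (hΩ : IsOpen Ω) (hU : IsOpen U)
    (hUΩ : U ⊆ Ω) (e : RN (k + 2)) {β : RN (k + 2) → ℝ} (hβ : ContDiff ℝ 2 β)
    (hβc : HasCompactSupport β) (hβU : tsupport β ⊆ U) :
    IsFlowField Ω (fun x => β x • e) (tsupport β) := by
  simpa using (isShearChart_of_subset hΩ hU hUΩ e).isFlowField hβ hβc hβU

/-- Near each interior point of `M` there is a flow field that changes the volume of `Ω₁`: it is a
translation that carries a bump from `Ω₁` into `Ω₂`, at a suitable intermediate time. -/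
theorem IsPartitioning.exists_flowField_ne_zero (h : IsPartitioning Ω M N Ω₁ Ω₂) {p : RN (k + 2)}
    (hp : p ∈ M \ bdry M) {W : Set (RN (k + 2))} (hW : W ∈ 𝓝 p) :
    ∃ X K, IsFlowField Ω X K ∧ IsCompact K ∧ K ⊆ W ∧ ∫ x in Ω₁, divergence X x ≠ 0 := by
  have hΩo := h.container.isOpen
  obtain ⟨r, hr, hrW⟩ := Metric.mem_nhds_iff.1
    (inter_mem hW (hΩo.mem_nhds (h.container.interior_subset hp)))
  have hN1 := (h.normal.2 p hp.1).1
  obtain ⟨t, ⟨htr0, htr1⟩, hta, htb⟩ : ∃ t : ℝ, t ∈ Ioo 0 (r / 2) ∧ p - t • N p ∈ Ω₁ ∧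
      p + t • N p ∈ Ω₂ :=
    (Filter.Eventually.and (Ioo_mem_nhdsGT (half_pos hr)) (h.sides p hp)).exists
  set a := p - t • N p
  set b := p + t • N p
  set e := b - a
  have he : e = (2 * t) • N p := by simp only [e, a, b]; module
  obtain ⟨ρ₁, hρ₁, hb1⟩ := Metric.isOpen_iff.1 h.isOpen₁ a hta
  obtain ⟨ρ₂, hρ₂, hb2⟩ := Metric.isOpen_iff.1 h.isOpen₂ b htb
  set ρ := min (r / 2) (min ρ₁ ρ₂)
  have hρ : 0 < ρ := lt_min (half_pos hr) (lt_min hρ₁ hρ₂)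
  let ψ : ContDiffBump (0 : RN (k + 2)) := ⟨ρ / 4, ρ / 2, by linarith, by linarith⟩
  have hψ : ContDiff ℝ 2 ψ := ψ.contDiff
  -- The bump at time `s`, on its way from `a` to `b = a + e`.
  let F : ℝ → RN (k + 2) → ℝ := fun s x => ψ (x - (a + s • e))
  have hF : ∀ s, ContDiff ℝ 2 (F s) := fun s => hψ.comp (contDiff_id.sub contDiff_const)
  have hFt : ∀ s, tsupport (F s) ⊆ Metric.closedBall (a + s • e) (ρ / 2) := by
    intro s
    refine closure_minimal (fun x hx => ?_) Metric.isClosed_closedBall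
    have h1 : x - (a + s • e) ∈ Function.support ψ := hx
    rw [ψ.support_eq, mem_ball_zero_iff] at h1
    rw [Metric.mem_closedBall, dist_eq_norm]
    exact h1.le
  have hFc : ∀ s, HasCompactSupport (F s) := fun s =>
    HasCompactSupport.of_support_subset_isCompact (isCompact_closedBall _ _)
      ((subset_tsupport _).trans (hFt s))
  have hFU : ∀ s ∈ Icc (0 : ℝ) 1, tsupport (F s) ⊆ Metric.ball p r := by
    intro s hs x hx
    have h1 : dist x (a + s • e) ≤ ρ / 2 := hFt s hx
    have h2 : dist (a + s • e) p ≤ t := by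
      rw [dist_eq_norm]
      have : a + s • e - p = ((2 * s - 1) * t) • N p := by
        rw [he]; simp only [a]; module
      rw [this, norm_smul, hN1, mul_one, Real.norm_eq_abs, abs_mul, abs_of_pos htr0]
      have : |2 * s - 1| ≤ 1 := abs_le.2 ⟨by linarith [hs.1], by linarith [hs.2]⟩
      nlinarith
    have h3 : ρ ≤ r / 2 := min_le_left _ _
    have := dist_triangle x (a + s • e) p
    rw [Metric.mem_ball]
    linarith
  -- The part of the bump in `Ω₁` is positive at `s = 0` and zero at `s = 1`, so its derivative,
  -- which is minus the flux of `F s e` out of `Ω₁`, is nonzero at some time in between.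
  let T : ℝ → ℝ := fun s => ∫ x in Ω₁, F s x
  have hT : ∀ s, HasDerivAt T (-∫ x in Ω₁, fderiv ℝ (F s) x e) s := by
    intro s
    have hfd : ∀ s x, fderiv ℝ (F s) x = fderiv ℝ ψ (x - (a + s • e)) := by
      intro s x
      have h1 : HasFDerivAt (fun x : RN (k + 2) => x - (a + s • e))
        (ContinuousLinearMap.id ℝ (RN (k + 2))) x := (hasFDerivAt_id x).sub_const _
      have h2 := ((hψ.differentiable (by simp) (x - (a + s • e))).hasFDerivAt).comp x h1
      exact h2.fderiv
    have h1 := hasDerivAt_setIntegral_of_continuousOn (μ := volume) (δ := 1) (S := Ω₁)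
      (F := fun t x => F (s + t) x) (F' := fun t x => -fderiv ℝ (F (s + t)) x e)
      h.isBounded₁.isCompact_closure subset_closure h.isOpen₁.measurableSet
      h.isBounded₁.measure_lt_top one_pos (fun t _ => (hF _).continuous.continuousOn)
      (fun t _ x _ => by
        rw [hfd]
        have h2 : HasDerivAt (fun t : ℝ => x - (a + (s + t) • e)) (-e) t := by
          simpa using ((((hasDerivAt_id t).const_add s).smul_const e).const_add a).const_sub x
        have h3 := ((hψ.differentiable (by simp) (x - (a + (s + t) • e))).hasFDerivAt).comp_hasDerivAt
          t h2
        rw [map_neg] at h3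
        exact h3)
      (by
        simp only [hfd]
        have h3 : Continuous (fderiv ℝ ψ) := hψ.continuous_fderiv (by simp)
        have h4 : Continuous fun q : ℝ × RN (k + 2) => q.2 - (a + (s + q.1) • e) := by fun_prop
        exact ((h3.comp h4).clm_apply continuous_const).neg.continuousOn)
    rw [← integral_neg]
    have h2 : HasDerivAt (fun t => T (s + t)) (∫ x in Ω₁, -fderiv ℝ (F s) x e) (s - s) := by
      simpa [T] using h1
    have h3 := h2.comp_sub_const s s
    simpa using h3
  obtain ⟨s, hs, hTs⟩ := exists_hasDerivAt_eq_slope T _ zero_lt_one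
    (fun s _ => (hT s).continuousAt.continuousWithinAt) (fun s _ => hT s)
  have hT1 : T 1 = 0 := by
    refine setIntegral_eq_zero_of_forall_eq_zero fun x hx => image_eq_zero_of_notMem_tsupport fun hxs => ?_
    have h1 : dist x b ≤ ρ / 2 := by
      have := hFt 1 hxs
      simpa [e] using this
    have h2 : x ∈ Ω₂ := hb2 (by
      rw [Metric.mem_ball]
      have : ρ ≤ ρ₂ := (min_le_right _ _).trans (min_le_right _ _)
      linarith)
    exact h.disjoint.le_bot ⟨hx, h2⟩
  have hT0 : 0 < T 0 := by
    have hc : Continuous (F 0) := (hF 0).continuous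
    have hnn : ∀ x, 0 ≤ F 0 x := fun x => ψ.nonneg
    have hint : IntegrableOn (F 0) Ω₁ := (hc.integrable_of_hasCompactSupport (hFc 0)).integrableOn
    refine (setIntegral_pos_iff_support_of_nonneg_ae (Eventually.of_forall hnn) hint).2 ?_
    refine lt_of_lt_of_le (Metric.measure_ball_pos volume a (show 0 < ρ / 2 by linarith))
      (measure_mono fun x hx => ⟨?_, hb1 ?_⟩)
    · have : x - (a + (0 : ℝ) • e) ∈ Function.support ψ := by
        rw [ψ.support_eq, zero_smul, add_zero, mem_ball_zero_iff, ← dist_eq_norm]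
        exact hx
      exact this
    · rw [Metric.mem_ball] at hx ⊢
      have : ρ ≤ ρ₁ := (min_le_right _ _).trans (min_le_left _ _)
      linarith
  have hsI : s ∈ Icc (0 : ℝ) 1 := Ioo_subset_Icc_self hs
  refine ⟨fun x => F s x • e, tsupport (F s),
    isFlowField_smul_const hΩo Metric.isOpen_ball (hrW.trans inter_subset_right) e (hF s) (hFc s)
      (hFU s hsI), hFc s, (hFU s hsI).trans (hrW.trans inter_subset_left), ?_⟩
  have hdiv : ∀ x, divergence (fun x => F s x • e) x = fderiv ℝ (F s) x e := by
    intro x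
    rw [divergence_mulField (X := fun _ => e) ((hF s).of_le (by norm_num)) contDiff_const]
    simp [divergence]
  simp only [hdiv]
  rw [hT1] at hTs
  intro h0
  rw [h0] at hTs
  norm_num at hTs
  exact hT0.ne' hTs

/-- A hypersurface with boundary has interior points near the boundary. -/
theorem exists_two_interior_points {M : Set (RN (k + 2))} (hb : (bdry M).Nonempty) :
    ∃ p ∈ M \ bdry M, ∃ q ∈ M \ bdry M, p ≠ q := by
  obtain ⟨p₀, hp₀⟩ := hb
  obtain ⟨Ψ, K, s, h, -⟩ := exists_isBdryChart hp₀ univ_mem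
  obtain ⟨r, hr, hcube⟩ := h.exists_cube_subset univ_mem
  have hex : ∀ c, 0 < c → c ≤ r → ∃ x ∈ M \ bdry M, Ψ x 1 = c := by
    intro c hc hcr
    obtain ⟨x, ⟨-, hxs⟩, hx⟩ := hcube (EuclideanSpace.single 1 c) fun i => by
      by_cases hi : i = 1 <;> simp [hi, abs_of_pos hc, hcr, hr.le]
    have h0 : Ψ x 0 = 0 := by rw [hx]; simp
    have h1 : Ψ x 1 = c := by rw [hx]; simp
    exact ⟨x, ⟨(h.mem_iff x hxs).2 ⟨h0, h1 ▸ hc.le⟩, fun hxb =>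
      hc.ne' (h1 ▸ ((h.mem_bdry_iff x hxs).1 hxb).2)⟩, h1⟩
  obtain ⟨p, hp, hp1⟩ := hex r hr le_rfl
  obtain ⟨q, hq, hq1⟩ := hex (r / 2) (half_pos hr) (by linarith)
  refine ⟨p, hp, q, hq, fun hpq => ?_⟩
  rw [hpq, hq1] at hp1
  linarith

/-- A minimal partitioning has a Lagrange multiplier: on flow fields of small support, the first
variation of area is proportional to the first variation of the volume of `Ω₁`. -/
theorem IsMinimalPartitioning.exists_multiplier (hM : IsMinimalPartitioning Ω M N Ω₁ Ω₂)
    (hb : (bdry M).Nonempty) : ∃ l : ℝ, ∀ p, ∃ U ∈ 𝓝 p, ∀ X K, IsFlowField Ω X K → IsClosed K →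
      K ⊆ U → firstVar M N X = l * ∫ x in Ω₁, divergence X x := by
  obtain ⟨p, hp, q, hq, hpq⟩ := exists_two_interior_points hb
  obtain ⟨V, W, hV, hW, hpV, hqW, hVW⟩ := t2_separation hpq
  obtain ⟨X₁, K₁, h₁, hK₁, hK₁V, hQ₁⟩ := hM.exists_flowField_ne_zero hp (hV.mem_nhds hpV)
  obtain ⟨X₂, K₂, h₂, hK₂, hK₂W, hQ₂⟩ := hM.exists_flowField_ne_zero hq (hW.mem_nhds hqW)
  have hK : Disjoint K₁ K₂ := hVW.mono hK₁V hK₂W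
  have h12 := h₁.mul_firstVar_eq hM h₂ hK₁.isClosed hK
  refine ⟨firstVar M N X₁ / ∫ x in Ω₁, divergence X₁ x, fun z => ?_⟩
  -- Compare flow fields that are supported away from `K₁` with `X₁`, and those supported away from
  -- `K₂` with `X₂`; the two resulting multipliers agree.
  by_cases hz : z ∈ K₁
  · have hz2 : z ∉ K₂ := fun h => hK.le_bot ⟨hz, h⟩
    refine ⟨K₂ᶜ, hK₂.isClosed.isOpen_compl.mem_nhds hz2, fun X K hX hKc hKs => ?_⟩
    have h3 := hX.mul_firstVar_eq hM h₂ hKc (disjoint_left.2 fun x hx => hKs hx)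
    have h4 : firstVar M N X₁ / (∫ x in Ω₁, divergence X₁ x) =
        firstVar M N X₂ / ∫ x in Ω₁, divergence X₂ x := by
      rw [div_eq_div_iff hQ₁ hQ₂]; linarith
    rw [h4, div_mul_eq_mul_div, eq_div_iff hQ₂]
    linarith
  · refine ⟨K₁ᶜ, hK₁.isClosed.isOpen_compl.mem_nhds hz, fun X K hX hKc hKs => ?_⟩
    have h3 := hX.mul_firstVar_eq hM h₁ hKc (disjoint_left.2 fun x hx => hKs hx)
    rw [div_mul_eq_mul_div, eq_div_iff hQ₁]
    linarith

/-- `l` is a Lagrange multiplier on the fields `β e`, for `e` the direction of a shear chart and `β`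
a function of class `C¹` with small support. -/
theorem IsShearChart.firstVar_eq (hM : IsPartitioning Ω M N Ω₁ Ω₂) {l : ℝ}
    {U U' : Set (RN (k + 2))} (hU' : IsOpen U') (hl : ∀ X K, IsFlowField Ω X K → IsClosed K →
      K ⊆ U' → firstVar M N X = l * ∫ x in Ω₁, divergence X x)
    {m e : RN (k + 2)} {g : RN (k + 2) → ℝ} (h : IsShearChart Ω U m g e)
    {β : RN (k + 2) → ℝ} (hβ : ContDiff ℝ 1 β) (hβc : HasCompactSupport β)
    (hβU : tsupport β ⊆ U ∩ U') :
    firstVar M N (fun x => β x • (e + fderiv ℝ g x e • m)) =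
      l * ∫ x in Ω₁, divergence (fun x => β x • (e + fderiv ℝ g x e • m)) x := by
  set V : RN (k + 2) → RN (k + 2) := fun x => e + fderiv ℝ g x e • m
  have hV : ContDiff ℝ 1 V := contDiff_const.add
    (((h.contDiff.fderiv_right (m := 1) (by norm_num)).clm_apply contDiff_const).smul contDiff_const)
  obtain ⟨C, hC, hbound⟩ := hM.isFlatAlong.exists_bound hM.isBounded₁ hV
  -- Flow fields need multiples of class `C²`: approximate `β` by such functions in the `C¹` norm.
  have key : ∀ ε > 0, |firstVar M N (fun x => β x • V x) -
      l * ∫ x in Ω₁, divergence (fun x => β x • V x) x| ≤ (C + |l| * C) * ε := by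
    intro ε hε
    obtain ⟨γ, hγ, hγc, hγU, hγβ⟩ := exists_contDiff_approx hβ hβc (h.isOpen.inter hU') hβU hε
    have h1 := hl _ _ (h.isFlowField hγ hγc (hγU.trans inter_subset_left)) (isClosed_tsupport γ)
      (hγU.trans inter_subset_right)
    have hγ1 : ContDiff ℝ 1 γ := hγ.of_le (by norm_num)
    have hd : ContDiff ℝ 1 (β - γ) := hβ.sub hγ1
    have hsum : (fun x => β x • V x) = (fun x => γ x • V x) + fun x => (β - γ) x • V x := by
      funext x
      simp only [Pi.add_apply, Pi.sub_apply]
      module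
    obtain ⟨b1, b2⟩ := hbound (β - γ) ε hd hε.le fun x => ⟨by
      rw [Pi.sub_apply, abs_sub_comm]; exact (hγβ x).1, by
      rw [fderiv_sub (hβ.differentiable (by simp) x) (hγ1.differentiable (by simp) x), norm_sub_rev]
      exact (hγβ x).2⟩
    have hγV : ContDiff ℝ 1 fun x => γ x • V x := hγ1.smul hV
    have hdV : ContDiff ℝ 1 fun x => (β - γ) x • V x := hd.smul hV
    rw [hsum, hM.isFlatAlong.firstVar_add hγV hdV,
      integral_divergence_add hM.isBounded₁ hγV hdV, h1]
    set A := firstVar M N fun x => (β - γ) x • V x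
    set B := ∫ x in Ω₁, divergence (fun x => (β - γ) x • V x) x
    have e1 : ∀ q : ℝ, l * q + A - l * (q + B) = A - l * B := fun q => by ring
    rw [e1]
    calc |A - l * B| ≤ |A| + |l * B| := abs_sub _ _
      _ ≤ C * ε + |l| * (C * ε) := by
          rw [abs_mul]
          exact add_le_add b1 (mul_le_mul_of_nonneg_left b2 (abs_nonneg l))
      _ = _ := by ring
  have h0 : |firstVar M N (fun x => β x • V x) -
      l * ∫ x in Ω₁, divergence (fun x => β x • V x) x| ≤ 0 := by
    refine le_of_forall_pos_le_add fun ε hε => ?_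
    have hpos : 0 < C + |l| * C + 1 := by positivity
    have := key (ε / (C + |l| * C + 1)) (div_pos hε hpos)
    refine this.trans ?_
    rw [zero_add, mul_div_assoc', div_le_iff₀ hpos]
    nlinarith
  exact sub_eq_zero.1 (abs_eq_zero.1 (le_antisymm h0 (abs_nonneg _)))

end

/-! ### The boundary of the container -/

theorem hasDerivAt_clm_comp_apply {E : Type*} [NormedAddCommGroup E] [NormedSpace ℝ E]
    {A : E → E →L[ℝ] ℝ} {A' : E →L[ℝ] E →L[ℝ] ℝ} {c v : ℝ → E} {c' v' : E} {s : ℝ}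
    (hA : HasFDerivAt A A' (c s)) (hc : HasDerivAt c c' s) (hv : HasDerivAt v v' s) :
    HasDerivAt (fun t => A (c t) (v t)) (A' c' (v s) + A (c s) v') s :=
  (hA.comp_hasDerivAt s hc).clm_apply hv

section Frontier

variable {Ω : Set (RN (k + 2))} {p : RN (k + 2)} {ρ : RN (k + 2) → ℝ}

theorem IsDefiningFunction.eventually_mem_frontier_iff (h : IsDefiningFunction Ω p ρ) :
    ∀ᶠ x in 𝓝 p, (x ∈ frontier Ω ↔ ρ x = 0) := by
  obtain ⟨hρ, hρp, hd, hev⟩ := h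
  have hd' : ∀ᶠ x in 𝓝 p, fderiv ℝ ρ x ≠ 0 :=
    (hρ.fderiv_right (m := 1) (by norm_num)).continuousAt.eventually_ne hd
  filter_upwards [hev.eventually_nhds, hd', hρ.eventually (by simp)] with x hx hdx hρx
  constructor
  · rintro ⟨hcl, hint⟩
    rcases lt_trichotomy (ρ x) 0 with h1 | h1 | h1
    · refine absurd (mem_interior_iff_mem_nhds.2 ?_) hint
      filter_upwards [hx, hρx.continuousAt.eventually (gt_mem_nhds h1)] with y hy hy1 using hy.2 hy1
    · exact h1
    · have : Ωᶜ ∈ 𝓝 x := by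
        filter_upwards [hx, hρx.continuousAt.eventually (lt_mem_nhds h1)] with y hy hy1 hyΩ
        exact lt_asymm hy1 (hy.1 hyΩ)
      obtain ⟨y, hy1, hy2⟩ := mem_closure_iff_nhds.1 hcl _ this
      exact absurd hy2 hy1
  · intro h0
    refine ⟨?_, fun hint => ?_⟩
    · by_contra hcl
      refine hdx (IsLocalMin.fderiv_eq_zero ?_)
      filter_upwards [hx, isClosed_closure.isOpen_compl.mem_nhds hcl] with y hy hy1
      rw [h0]
      by_contra! hlt
      exact hy1 (subset_closure (hy.2 hlt))
    · have := hx.self_of_nhds.1 (interior_subset hint)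
      rw [h0] at this
      exact lt_irrefl _ this

theorem IsDefiningFunction.eventually (h : IsDefiningFunction Ω p ρ) :
    ∀ᶠ x in 𝓝 p, x ∈ frontier Ω → IsDefiningFunction Ω x ρ := by
  have hd' : ∀ᶠ x in 𝓝 p, fderiv ℝ ρ x ≠ 0 :=
    (h.1.fderiv_right (m := 1) (by norm_num)).continuousAt.eventually_ne h.2.2.1
  filter_upwards [h.2.2.2.eventually_nhds, hd', h.1.eventually (by simp),
    h.eventually_mem_frontier_iff] with x hx hdx hρx hfr hxf
  exact ⟨hρx, hfr.1 hxf, hdx, hx⟩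

theorem HasC2BoundaryAt.isDefiningFunction (h : HasC2BoundaryAt Ω p) :
    IsDefiningFunction Ω p (definingFunction Ω p) := by
  rw [definingFunction, dif_pos h]
  exact h.choose_spec

/-- In the open set `U`, the set `∂Ω` is the graph of the function `g` over the hyperplane through `p`
orthogonal to the unit vector `m`; the function `g` is extended to be constant along `m`. -/
structure IsGraphChart (Ω : Set (RN (k + 2))) (p : RN (k + 2)) (U : Set (RN (k + 2)))
    (m : RN (k + 2)) (g : RN (k + 2) → ℝ) : Prop where
  isOpen : IsOpen U
  mem : p ∈ U
  norm_eq : ‖m‖ = 1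
  contDiff : ContDiff ℝ 2 g
  invariant : ∀ x (s : ℝ), g (x + s • m) = g x
  frontier_iff : ∀ x ∈ U, (x ∈ frontier Ω ↔ ⟪m, x - p⟫ = g x)

/-- The boundary is locally a graph, by the inverse function theorem. -/
theorem IsDefiningFunction.exists_isGraphChart (h : IsDefiningFunction Ω p ρ) :
    ∃ U m g, IsGraphChart Ω p U m g := by
  obtain ⟨hρ, hρp, hdρ, -⟩ := id h
  set v := (InnerProductSpace.toDual ℝ (RN (k + 2))).symm (fderiv ℝ ρ p)
  have hv : ∀ w, fderiv ℝ ρ p w = ⟪v, w⟫ := fun w => InnerProductSpace.toDual_symm_apply.symm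
  have hv0 : v ≠ 0 := by simpa [v] using hdρ
  set a := ‖v‖
  have ha : a ≠ 0 := norm_ne_zero_iff.2 hv0
  set m := a⁻¹ • v
  have hm : ‖m‖ = 1 := by
    rw [norm_smul, norm_inv, norm_norm]; exact inv_mul_cancel₀ ha
  have hmm : ⟪m, m⟫ = (1 : ℝ) := by rw [real_inner_self_eq_norm_sq, hm]; norm_num
  have hdm : ∀ w, fderiv ℝ ρ p w = a * ⟪m, w⟫ := by
    intro w
    rw [hv, inner_smul_left, ← mul_assoc]
    simp [ha]
  let pr : RN (k + 2) → RN (k + 2) := fun x => x - ⟪m, x - p⟫ • m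
  have hpr : ContDiff ℝ 2 pr := contDiff_id.sub
    ((ContDiff.inner ℝ contDiff_const (contDiff_id.sub contDiff_const)).smul contDiff_const)
  have hprp : pr p = p := by simp [pr]
  have hprm : ∀ x (s : ℝ), pr (x + s • m) = pr x := by
    intro x s
    have : ⟪m, x + s • m - p⟫ = ⟪m, x - p⟫ + s := by
      rw [show x + s • m - p = (x - p) + s • m by abel, inner_add_right, inner_smul_right, hmm, mul_one]
    simp only [pr, this]
    module
  have hmpr : ∀ x, ⟪m, pr x - p⟫ = 0 := by
    intro x
    have : pr x - p = (x - p) - ⟪m, x - p⟫ • m := by simp only [pr]; abel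
    rw [this, inner_sub_right, inner_smul_right, hmm]
    ring
  -- straighten `ρ` along `m`
  let F : RN (k + 2) → RN (k + 2) := fun x => x + (ρ x / a - ⟪m, x - p⟫) • m
  have hF : ContDiffAt ℝ 2 F p := contDiffAt_id.add ((((hρ.div_const a)).sub
    (ContDiff.inner ℝ contDiff_const (contDiff_id.sub contDiff_const)).contDiffAt).smul
      contDiffAt_const)
  have hF' : HasFDerivAt F ((ContinuousLinearEquiv.refl ℝ (RN (k + 2)) :
      RN (k + 2) →L[ℝ] RN (k + 2))) p := by
    have h1 : HasFDerivAt (fun x => ρ x / a - ⟪m, x - p⟫) (0 : RN (k + 2) →L[ℝ] ℝ) p := by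
      have h2 := (hρ.differentiableAt (by simp)).hasFDerivAt.mul_const a⁻¹
      have h3 := (innerSL ℝ m).hasFDerivAt.comp p ((hasFDerivAt_id p).sub_const p)
      refine (h2.sub h3).congr_fderiv ?_
      ext w
      simp [hdm, ha]
    refine ((hasFDerivAt_id p).add (h1.smul_const m)).congr_fderiv ?_
    ext w : 1
    simp
  have hFp : F p = p := by simp [F, hρp]
  set H := hF.toOpenPartialHomeomorph F hF' (by simp)
  have hH : ∀ x, H x = F x := fun x => rfl
  have hps : p ∈ H.source := hF.mem_toOpenPartialHomeomorph_source hF' (by simp)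
  have hpt : p ∈ H.target := by
    have := hF.image_mem_toOpenPartialHomeomorph_target hF' (by simp)
    rwa [hFp] at this
  have hsymm : ContDiffAt ℝ 2 H.symm p := by
    have := hF.to_localInverse hF' (by simp)
    rw [hFp] at this
    exact this
  let ψ : RN (k + 2) → ℝ := fun y => ⟪m, H.symm y - p⟫
  have hψ : ContDiffAt ℝ 2 ψ p :=
    ContDiffAt.inner ℝ contDiffAt_const (hsymm.sub contDiffAt_const)
  obtain ⟨r, hr, hrsub⟩ := Metric.mem_nhds_iff.1
    (inter_mem (hψ.eventually (by simp)) (H.open_target.mem_nhds hpt))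
  let χ : ContDiffBump p := ⟨r / 4, r / 2, by linarith, by linarith⟩
  have hχψ : ContDiff ℝ 2 fun y => χ y * ψ y := by
    rw [contDiff_iff_contDiffAt]
    intro y
    by_cases hy : y ∈ Metric.ball p r
    · exact χ.contDiff.contDiffAt.mul (hrsub hy).1
    · have hy' : y ∉ tsupport χ := by
        rw [χ.tsupport_eq, Metric.mem_closedBall]
        rw [Metric.mem_ball] at hy
        change ¬ dist y p ≤ r / 2
        linarith
      refine (contDiffAt_const (c := (0 : ℝ))).congr_of_eventuallyEq ?_
      filter_upwards [notMem_tsupport_iff_eventuallyEq.1 hy'] with z hz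
      rw [hz]
      simp
  have hU : ∀ᶠ x in 𝓝 p, (x ∈ frontier Ω ↔ ρ x = 0) ∧ x ∈ H.source ∧
      pr x ∈ Metric.ball p (r / 4) := by
    refine h.eventually_mem_frontier_iff.and (Filter.Eventually.and (H.open_source.mem_nhds hps) ?_)
    have : Tendsto pr (𝓝 p) (𝓝 p) := by
      have := hpr.continuous.tendsto p
      rwa [hprp] at this
    exact this.eventually (Metric.ball_mem_nhds p (by linarith))
  obtain ⟨U, hU1, hU2, hU3⟩ := mem_nhds_iff.1 hU
  refine ⟨U, m, fun x => χ (pr x) * ψ (pr x), hU2, hU3, hm, hχψ.comp hpr,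
    fun x s => by simp only [hprm], fun x hx => ?_⟩
  obtain ⟨h1, h2, h3⟩ := hU1 hx
  have hχ1 : χ (pr x) = 1 := χ.one_of_mem_closedBall (Metric.ball_subset_closedBall h3)
  have hprt : pr x ∈ H.target := (hrsub (Metric.ball_subset_ball (by linarith) h3)).2
  rw [h1, hχ1, one_mul]
  constructor
  · intro h0
    have h4 : H x = pr x := by
      rw [hH]
      simp only [F, pr, h0]
      module
    have h5 : H.symm (pr x) = x := by rw [← h4, H.left_inv h2]
    simp only [ψ, h5]
  · intro h0
    have h4 : F (H.symm (pr x)) = pr x := by rw [← hH, H.right_inv hprt]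
    set y := H.symm (pr x)
    have hy1 : ⟪m, F y - p⟫ = ρ y / a := by
      have : F y - p = (y - p) + (ρ y / a - ⟪m, y - p⟫) • m := by simp only [F]; abel
      rw [this, inner_add_right, inner_smul_right, hmm]
      ring
    rw [h4, hmpr] at hy1
    have hy2 : y = x := by
      have h5 : y = pr x + ⟪m, y - p⟫ • m := by
        rw [← h4]
        simp only [F, ← hy1]
        module
      have h6 : ⟪m, y - p⟫ = ⟪m, x - p⟫ := h0.symm
      rw [h5, h6]
      simp [pr]
    rw [hy2] at hy1
    simpa [ha] using hy1.symm

namespace IsGraphChart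

variable {U : Set (RN (k + 2))} {m : RN (k + 2)} {g : RN (k + 2) → ℝ}

theorem inner_self (h : IsGraphChart Ω p U m g) : ⟪m, m⟫ = (1 : ℝ) := by
  rw [real_inner_self_eq_norm_sq, h.norm_eq]; norm_num

theorem isShearChart (h : IsGraphChart Ω p U m g) {e : RN (k + 2)} (he : ⟪m, e⟫ = 0) :
    IsShearChart Ω U m g e where
  isOpen := h.isOpen
  contDiff := h.contDiff
  invariant := h.invariant
  frontier_iff x hx s hs := by
    rw [h.frontier_iff x hx, h.frontier_iff _ hs, h.invariant]
    have : x + s • e + (g (x + s • e) - g x) • m - p = (x - p) + s • e + (g (x + s • e) - g x) • m := by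
      abel
    rw [this, inner_add_right, inner_add_right, inner_smul_right, inner_smul_right, he, h.inner_self]
    constructor <;> intro h1 <;> linarith

theorem fderiv_apply_eq_zero (h : IsGraphChart Ω p U m g) (x : RN (k + 2)) : fderiv ℝ g x m = 0 :=
  fderiv_apply_eq_zero_of_invariant h.contDiff h.invariant x

/-- With `e = w - ⟪m, w⟫ m`, the vector `w` is the sum of the direction `e + (∂_e g) m`, tangent to the
graph, and of a multiple of `m`. -/
theorem decomp (h : IsGraphChart Ω p U m g) (q w : RN (k + 2)) :
    w = (w - ⟪m, w⟫ • m) + fderiv ℝ g q (w - ⟪m, w⟫ • m) • m + (⟪m, w⟫ - fderiv ℝ g q w) • m := by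
  rw [map_sub, map_smul, h.fderiv_apply_eq_zero, smul_zero, sub_zero]
  module

theorem inner_proj (h : IsGraphChart Ω p U m g) (w : RN (k + 2)) : ⟪m, w - ⟪m, w⟫ • m⟫ = 0 := by
  rw [inner_sub_right, inner_smul_right, h.inner_self]
  ring

/-- The curve in `∂Ω` over the line `q + s e`. -/
theorem hasDerivAt_curve (h : IsGraphChart Ω p U m g) (q e : RN (k + 2)) (s : ℝ) :
    HasDerivAt (fun s : ℝ => q + s • e + (g (q + s • e) - g q) • m)
      (e + fderiv ℝ g (q + s • e) e • m) s := by
  have h1 : HasDerivAt (fun t : ℝ => q + t • e) e s := by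
    simpa using ((hasDerivAt_id s).smul_const e).const_add q
  have h2 := ((h.contDiff.differentiable (by simp) (q + s • e)).hasFDerivAt).comp_hasDerivAt s h1
  exact h1.add ((h2.sub_const (g q)).smul_const m)

theorem eventually_curve_mem (h : IsGraphChart Ω p U m g) {q e : RN (k + 2)} (hq : q ∈ U)
    (hqf : q ∈ frontier Ω) (he : ⟪m, e⟫ = 0) :
    ∀ᶠ s : ℝ in 𝓝 0, q + s • e + (g (q + s • e) - g q) • m ∈ frontier Ω := by
  have hc := (h.hasDerivAt_curve q e 0).continuousAt
  have h0 : U ∈ 𝓝 (q + (0 : ℝ) • e + (g (q + (0 : ℝ) • e) - g q) • m) := by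
    simpa using h.isOpen.mem_nhds hq
  filter_upwards [hc.preimage_mem_nhds h0] with s hs
  exact ((h.isShearChart he).frontier_iff q hq s hs).2 hqf

/-- At each point of `∂Ω` in the chart, the differential of a defining function is a multiple of that
of the function `x ↦ ⟪m, x - p⟫ - g x`. -/
theorem fderiv_eq (h : IsGraphChart Ω p U m g) {q : RN (k + 2)} (hq : q ∈ U)
    (hqf : q ∈ frontier Ω) (hρ : IsDefiningFunction Ω q ρ) :
    fderiv ℝ ρ q = fderiv ℝ ρ q m • (innerSL ℝ m - fderiv ℝ g q) := by
  have hV : ∀ e, ⟪m, e⟫ = 0 → fderiv ℝ ρ q (e + fderiv ℝ g q e • m) = 0 := by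
    intro e he
    have hc := h.hasDerivAt_curve q e 0
    simp only [zero_smul, add_zero] at hc
    have hc0 : q + (0 : ℝ) • e + (g (q + (0 : ℝ) • e) - g q) • m = q := by simp
    have h1 : HasFDerivAt ρ (fderiv ℝ ρ q) (q + (0 : ℝ) • e + (g (q + (0 : ℝ) • e) - g q) • m) := by
      rw [hc0]; exact (hρ.1.differentiableAt (by simp)).hasFDerivAt
    have h2 := h1.comp_hasDerivAt (0 : ℝ) hc
    refine h2.unique ((hasDerivAt_const (0 : ℝ) (0 : ℝ)).congr_of_eventuallyEq ?_)
    have h3 := hc.continuousAt.tendsto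
    rw [hc0] at h3
    filter_upwards [h3.eventually hρ.eventually_mem_frontier_iff, h.eventually_curve_mem hq hqf he]
      with s hs1 hs2 using hs1.1 hs2
  ext1 w
  conv_lhs => rw [h.decomp q w, map_add, hV _ (h.inner_proj w), map_smul, zero_add]
  simp
  ring

theorem fderiv_apply_ne_zero (h : IsGraphChart Ω p U m g) {q : RN (k + 2)} (hq : q ∈ U)
    (hqf : q ∈ frontier Ω) (hρ : IsDefiningFunction Ω q ρ) : fderiv ℝ ρ q m ≠ 0 := by
  intro h0
  have := h.fderiv_eq hq hqf hρ
  rw [h0] at this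
  refine hρ.2.2.1 (this.trans ?_)
  ext w
  simp

/-- A tangent vector of `∂Ω` is determined by its projection to the hyperplane. -/
theorem eq_of_mem_ker (h : IsGraphChart Ω p U m g) {q : RN (k + 2)} (hq : q ∈ U)
    (hqf : q ∈ frontier Ω) (hρ : IsDefiningFunction Ω q ρ) {w : RN (k + 2)}
    (hw : fderiv ℝ ρ q w = 0) : w = (w - ⟪m, w⟫ • m) + fderiv ℝ g q (w - ⟪m, w⟫ • m) • m := by
  rw [h.fderiv_eq hq hqf hρ] at hw
  have h1 : ⟪m, w⟫ - fderiv ℝ g q w = 0 := by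
    simpa [h.fderiv_apply_ne_zero hq hqf hρ] using hw
  have := h.decomp q w
  rwa [h1, zero_smul, add_zero] at this

/-- On tangent vectors, the second fundamental form of `∂Ω` is that of the graph of `g`: it
involves the defining function `ρ` only through a factor. -/
theorem levelForm_eq (h : IsGraphChart Ω p U m g) {q : RN (k + 2)} (hq : q ∈ U)
    (hqf : q ∈ frontier Ω) (hρ : IsDefiningFunction Ω q ρ) {w : RN (k + 2)}
    (hw : fderiv ℝ ρ q w = 0) :
    levelForm ρ q w w = -(fderiv ℝ ρ q m * fderiv ℝ (fderiv ℝ g) q (w - ⟪m, w⟫ • m)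
      (w - ⟪m, w⟫ • m)) / ‖fderiv ℝ ρ q‖ := by
  set e := w - ⟪m, w⟫ • m with he
  have hwe : w = e + fderiv ℝ g q e • m := h.eq_of_mem_ker hq hqf hρ hw
  have hem : ⟪m, e⟫ = 0 := h.inner_proj w
  rw [levelForm]
  congr 1
  -- differentiate twice the identity `ρ (c s) = 0` along the curve `c` of `∂Ω` over `q + s e`
  set c : ℝ → RN (k + 2) := fun s => q + s • e + (g (q + s • e) - g q) • m
  have hc : ∀ s, HasDerivAt c (e + fderiv ℝ g (q + s • e) e • m) s := h.hasDerivAt_curve q e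
  have hc0 : c 0 = q := by simp [c]
  have hct : Tendsto c (𝓝 0) (𝓝 q) := by
    have := (hc 0).continuousAt.tendsto
    rwa [hc0] at this
  have hzero : ∀ᶠ s in 𝓝 0, ρ (c s) = 0 := by
    filter_upwards [hct.eventually hρ.eventually_mem_frontier_iff, h.eventually_curve_mem hq hqf hem]
      with s hs1 hs2 using hs1.1 hs2
  have hfirst : ∀ᶠ s in 𝓝 0, fderiv ℝ ρ (c s) (e + fderiv ℝ g (q + s • e) e • m) = 0 := by
    filter_upwards [hzero.eventually_nhds, hct.eventually (hρ.1.eventually (by simp))] with s hs hs2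
    have h1 := (hs2.differentiableAt (by simp)).hasFDerivAt.comp_hasDerivAt s (hc s)
    exact h1.unique ((hasDerivAt_const s (0 : ℝ)).congr_of_eventuallyEq hs)
  have hline : HasDerivAt (fun s : ℝ => q + s • e) e 0 := by
    simpa using ((hasDerivAt_id (0 : ℝ)).smul_const e).const_add q
  have hg1 : ContDiff ℝ 1 (fderiv ℝ g) := h.contDiff.fderiv_right (by norm_num)
  have hg2 : HasDerivAt (fun s : ℝ => fderiv ℝ g (q + s • e) e) (fderiv ℝ (fderiv ℝ g) q e e) 0 := by
    have h1 := hasDerivAt_clm_comp_apply (c := fun s : ℝ => q + s • e) (v := fun _ => e) (s := 0)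
      (by simpa using (hg1.differentiable (by simp) q).hasFDerivAt) hline (hasDerivAt_const 0 e)
    simpa using h1
  have hsecond := hasDerivAt_clm_comp_apply (c := c)
    (v := fun s => e + fderiv ℝ g (q + s • e) e • m) (s := 0)
    (by
      rw [hc0]
      exact ((hρ.1.fderiv_right (m := 1) (by norm_num)).differentiableAt (by simp)).hasFDerivAt)
    (hc 0) ((hg2.smul_const m).const_add e)
  simp only [zero_smul, add_zero, hc0] at hsecond
  have h0 := hsecond.unique ((hasDerivAt_const (0 : ℝ) (0 : ℝ)).congr_of_eventuallyEq hfirst)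
  rw [← hwe, map_smul, smul_eq_mul] at h0
  linarith

end IsGraphChart

/-- The tangent space of `∂Ω` and its second fundamental form do not depend on the choice of the
defining function. -/
theorem IsDefiningFunction.unique {ρ' : RN (k + 2) → ℝ} (hp : p ∈ frontier Ω)
    (h : IsDefiningFunction Ω p ρ) (h' : IsDefiningFunction Ω p ρ') {w : RN (k + 2)}
    (hw : fderiv ℝ ρ p w = 0) : fderiv ℝ ρ' p w = 0 ∧ levelForm ρ p w w = levelForm ρ' p w w := by
  obtain ⟨U, m, g, hg⟩ := h.exists_isGraphChart
  have e1 := hg.fderiv_eq hg.mem hp h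
  have e2 := hg.fderiv_eq hg.mem hp h'
  have n1 := hg.fderiv_apply_ne_zero hg.mem hp h
  have n2 := hg.fderiv_apply_ne_zero hg.mem hp h'
  set L := innerSL ℝ m - fderiv ℝ g p
  have hLw : L w = 0 := by
    rw [e1] at hw
    simpa [n1] using hw
  have hw' : fderiv ℝ ρ' p w = 0 := by rw [e2]; simp [hLw]
  refine ⟨hw', ?_⟩
  rw [hg.levelForm_eq hg.mem hp h hw, hg.levelForm_eq hg.mem hp h' hw', e1, e2, norm_smul, norm_smul]
  have hLm : L m = 1 := by
    simp only [L, _root_.sub_apply, hg.fderiv_apply_eq_zero, innerSL_apply_apply,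
      hg.inner_self, sub_zero]
  have hL0 : ‖L‖ ≠ 0 := by
    rw [norm_ne_zero_iff]
    intro h0
    rw [h0] at hLm
    simp at hLm
  set μ := fderiv ℝ ρ p m
  set μ' := fderiv ℝ ρ' p m
  -- both functions are negative on the same side of `∂Ω`
  have hsign : ∀ {σ σ' : RN (k + 2) → ℝ}, IsDefiningFunction Ω p σ → IsDefiningFunction Ω p σ' →
      0 < fderiv ℝ σ p m → 0 ≤ fderiv ℝ σ' p m := by
    intro σ σ' hσ hσ' h1
    by_contra! h2
    have hline : HasDerivAt (fun s : ℝ => p + s • m) m 0 := by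
      simpa using ((hasDerivAt_id (0 : ℝ)).smul_const m).const_add p
    have hp0 : p + (0 : ℝ) • m = p := by simp
    have hder : ∀ {τ}, IsDefiningFunction Ω p τ →
        HasDerivAt (fun s : ℝ => τ (p + s • m)) (fderiv ℝ τ p m) 0 := by
      intro τ hτ
      have h3 : HasFDerivAt τ (fderiv ℝ τ p) (p + (0 : ℝ) • m) := by
        rw [hp0]; exact (hτ.1.differentiableAt (by simp)).hasFDerivAt
      exact h3.comp_hasDerivAt (0 : ℝ) hline
    have hev : ∀ {τ}, IsDefiningFunction Ω p τ → ∀ᶠ s : ℝ in 𝓝[>] 0,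
        (p + s • m ∈ Ω ↔ τ (p + s • m) < 0) := by
      intro τ hτ
      have h3 : Tendsto (fun s : ℝ => p + s • m) (𝓝[>] 0) (𝓝 p) := by
        have := hline.continuousAt.tendsto
        rw [hp0] at this
        exact this.mono_left nhdsWithin_le_nhds
      exact h3.eventually hτ.2.2.2
    have hpos : ∀ᶠ s : ℝ in 𝓝[>] 0, 0 < σ (p + s • m) := by
      have h3 := (hasDerivAt_iff_tendsto_slope.1 (hder hσ)).mono_left
        (nhdsWithin_mono 0 fun s (hs : 0 < s) => hs.ne')
      filter_upwards [h3.eventually (lt_mem_nhds h1), self_mem_nhdsWithin] with s hs hs0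
      rw [slope_def_field, hp0, hσ.2.1, sub_zero, sub_zero] at hs
      exact (div_pos_iff_of_pos_right hs0).1 hs
    have hneg : ∀ᶠ s : ℝ in 𝓝[>] 0, σ' (p + s • m) < 0 := by
      have h3 := (hasDerivAt_iff_tendsto_slope.1 (hder hσ')).mono_left
        (nhdsWithin_mono 0 fun s (hs : 0 < s) => hs.ne')
      filter_upwards [h3.eventually (gt_mem_nhds h2), self_mem_nhdsWithin] with s hs hs0
      rw [slope_def_field, hp0, hσ'.2.1, sub_zero, sub_zero] at hs
      rw [mem_Ioi] at hs0
      rw [div_neg_iff] at hs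
      rcases hs with hs | hs
      · exact absurd hs.2 (not_lt.2 hs0.le)
      · exact hs.1
    obtain ⟨s, h3, h4, h5, h6⟩ := (hpos.and (hneg.and ((hev hσ).and (hev hσ')))).exists
    exact lt_asymm h3 (h5.1 (h6.2 h4))
  have hs1 := hsign h h'
  have hs2 := hsign h' h
  rcases lt_or_gt_of_ne n1 with h1 | h1
  · have h2 : μ' < 0 := by
      rcases lt_or_gt_of_ne n2 with h2 | h2
      · exact h2
      · exact absurd (hs2 h2) (not_le.2 h1)
    rw [Real.norm_eq_abs, Real.norm_eq_abs, abs_of_neg h1, abs_of_neg h2]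
    have := h1.ne
    have := h2.ne
    simp only [_root_.smul_apply, hLm, smul_eq_mul, mul_one]
    field_simp
  · have h2 : 0 < μ' := lt_of_le_of_ne (hs1 h1) n2.symm
    rw [Real.norm_eq_abs, Real.norm_eq_abs, abs_of_pos h1, abs_of_pos h2]
    have := h1.ne'
    have := h2.ne'
    simp only [_root_.smul_apply, hLm, smul_eq_mul, mul_one]
    field_simp

/-- The normal curvature `II(N, N)` of `∂Ω` is continuous along `∂M`, if `N` is tangent to `∂Ω`. -/
theorem IsContainer.continuousOn_IIbd {M : Set (RN (k + 2))} {N : RN (k + 2) → RN (k + 2)}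
    (h : IsContainer Ω M) (hN : ContinuousOn N (bdry M)) (hT : ∀ q ∈ bdry M, N q ∈ tangentBd Ω q) :
    ContinuousOn (fun q => IIbd Ω q (N q) (N q)) (bdry M) := by
  intro p hp
  have hρ := (h.smooth p hp).isDefiningFunction
  set ρ := definingFunction Ω p
  have hc : ContinuousWithinAt (fun q => levelForm ρ q (N q) (N q)) (bdry M) p := by
    have h1 : ContDiffAt ℝ 1 (fderiv ℝ ρ) p := hρ.1.fderiv_right (by norm_num)
    have h2 : ContDiffAt ℝ 0 (fderiv ℝ (fderiv ℝ ρ)) p := h1.fderiv_right (by norm_num)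
    exact ((h2.continuousAt.continuousWithinAt.clm_apply (hN p hp)).clm_apply (hN p hp)).div
      h1.continuousAt.continuousWithinAt.norm (norm_ne_zero_iff.2 hρ.2.2.1)
  refine hc.congr_of_eventuallyEq_of_mem ?_ hp
  filter_upwards [mem_nhdsWithin_of_mem_nhds hρ.eventually, self_mem_nhdsWithin] with q hq hqb
  have hqf := h.bdry_subset hqb
  exact ((h.smooth q hqb).isDefiningFunction.unique hqf (hq hqf) (hT q hqb)).2

end Frontier

/-! ### Fields that vanish near `M` -/

/-- The maps of a variation preserve the orientation, since `ξ 0` does and the Jacobian never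
vanishes. -/
theorem IsVariation.det_pos {δ : ℝ} {ξ : ℝ → RN (k + 2) → RN (k + 2)} (h : IsVariation δ ξ) {t : ℝ}
    (ht : t ∈ Ioo (-δ) δ) (x : RN (k + 2)) : 0 < (fderiv ℝ (ξ t) x).det := by
  have hne : ∀ s ∈ Ioo (-δ) δ, (fderiv ℝ (ξ s) x).det ≠ 0 := by
    intro s hs
    rw [ContinuousLinearMap.det, ← isUnit_iff_ne_zero, ← LinearMap.isUnit_iff_isUnit_det,
      LinearMap.isUnit_iff_ker_eq_bot, LinearMap.ker_eq_bot]
    exact h.injective_fderiv hs x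
  have hc : ContinuousOn (fun s => (fderiv ℝ (ξ s) x).det) (Ioo (-δ) δ) := fun s hs =>
    (((contDiff_clm_det (r := 1)).continuous.continuousAt).comp
      (h.hasDerivAt_fderiv hs x).continuousAt).continuousWithinAt
  by_contra! hle
  have h0 : (fderiv ℝ (ξ 0) x).det = 1 := by rw [h.fderiv_zero, clm_det_id]
  obtain ⟨s, hs, hs0⟩ := isPreconnected_Ioo.intermediate_value ht h.zero_mem hc
    (show (0 : ℝ) ∈ Icc _ _ from ⟨hle, h0 ▸ zero_le_one⟩)
  exact hne s hs hs0

theorem IsVariation.hasDerivAt_time {δ : ℝ} {ξ : ℝ → RN (k + 2) → RN (k + 2)}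
    (h : IsVariation δ ξ) {t : ℝ} (ht : t ∈ Ioo (-δ) δ) (x : RN (k + 2)) :
    HasDerivAt (fun s => ξ s x)
      (fderiv ℝ (fun q : ℝ × RN (k + 2) => ξ q.1 q.2) (t, x) (1, 0)) t := by
  have h1 := ((h.contDiffAt ht x).differentiableAt (by simp)).hasFDerivAt
  have h2 : HasDerivAt (fun s : ℝ => (s, x)) ((1 : ℝ), (0 : RN (k + 2))) t :=
    (hasDerivAt_id t).prodMk (hasDerivAt_const t x)
  exact h1.comp_hasDerivAt t h2

theorem IsVariation.continuousOn_time {δ : ℝ} {ξ : ℝ → RN (k + 2) → RN (k + 2)}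
    (h : IsVariation δ ξ) (K : Set (RN (k + 2))) :
    ContinuousOn (fun q : ℝ × RN (k + 2) =>
      fderiv ℝ (fun q : ℝ × RN (k + 2) => ξ q.1 q.2) q (1, 0)) (Ioo (-δ) δ ×ˢ K) := by
  intro q hq
  have h1 : ContDiffAt ℝ 1 (fderiv ℝ fun q : ℝ × RN (k + 2) => ξ q.1 q.2) q :=
    (h.contDiffAt hq.1 q.2).fderiv_right (by norm_num)
  exact (h1.continuousAt.clm_apply continuousAt_const).continuousWithinAt

section

variable {Ω M Ω₁ Ω₂ : Set (RN (k + 2))} {N : RN (k + 2) → RN (k + 2)}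

/-- If `X` generates a variation that preserves `∂Ω`, and `f` vanishes near `M`, then the flux of `f X`
out of `Ω₁` vanishes: differentiate the integral of `f 1_{Ω₁}`, which is of class `C¹` in `Ω`, over the
images of `Ω`. -/
theorem IsPartitioning.integral_divergence_mul_eq_zero (hM : IsPartitioning Ω M N Ω₁ Ω₂) {δ : ℝ}
    {ξ : ℝ → RN (k + 2) → RN (k + 2)} (h : IsVariation δ ξ)
    (hfr : ∀ t ∈ Ioo (-δ) δ, ξ t '' frontier Ω = frontier Ω) {f : RN (k + 2) → ℝ}
    (hf : ContDiff ℝ 1 f) (hfM : ∀ x ∈ M, f =ᶠ[𝓝 x] fun _ => 0) :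
    ∫ x in Ω₁, divergence (fun x => f x • velocity ξ x) x = 0 := by
  have hΩo := hM.container.isOpen
  have hΩb := hM.container.isBounded
  set G : RN (k + 2) → ℝ := Ω₁.indicator f with hG
  set G' : RN (k + 2) → RN (k + 2) →L[ℝ] ℝ := Ω₁.indicator (fderiv ℝ f) with hG'
  -- Near points of `Ω₂` and of `M` the function `G` vanishes identically.
  have hGd : ∀ x ∈ Ω, HasFDerivAt G (G' x) x := by
    intro x hx
    by_cases hx1 : x ∈ Ω₁
    · have e1 : G' x = fderiv ℝ f x := indicator_of_mem hx1 _
      rw [e1]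
      refine (hf.differentiable (by simp) x).hasFDerivAt.congr_of_eventuallyEq ?_
      filter_upwards [hM.isOpen₁.mem_nhds hx1] with y hy using indicator_of_mem hy _
    · have e1 : G' x = 0 := indicator_of_notMem hx1 _
      rw [e1]
      refine (hasFDerivAt_const (0 : ℝ) x).congr_of_eventuallyEq ?_
      by_cases hxM : x ∈ M
      · filter_upwards [hfM x hxM] with y hy
        simp [hG, indicator, hy]
      · have hx2 : x ∈ Ω₂ := by
          have : x ∈ Ω₁ ∪ Ω₂ := hM.union ▸ ⟨hx, hxM⟩
          exact this.resolve_left hx1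
        filter_upwards [hM.isOpen₂.mem_nhds hx2] with y hy
        exact indicator_of_notMem (fun hy1 => hM.disjoint.le_bot ⟨hy1, hy⟩) _
  have hGm : Measurable G := hf.continuous.measurable.indicator hM.isOpen₁.measurableSet
  set dt : ℝ → RN (k + 2) → RN (k + 2) := fun t x =>
    fderiv ℝ (fun q : ℝ × RN (k + 2) => ξ q.1 q.2) (t, x) (1, 0) with hdt
  have hdt0 : ∀ x, dt 0 x = velocity ξ x := fun x =>
    (h.hasDerivAt_time h.zero_mem x).unique (h.hasDerivAt x)
  set Δ : (RN (k + 2) →L[ℝ] RN (k + 2)) → ℝ := fun A => A.det with hΔ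
  have hΔs : ContDiff ℝ 1 Δ := contDiff_clm_det
  -- The integral of `G` over `ξ t '' Ω = Ω`, pulled back to `Ω`.
  let F : ℝ → RN (k + 2) → ℝ := fun t x => Δ (fderiv ℝ (ξ t) x) * G (ξ t x)
  let F' : ℝ → RN (k + 2) → ℝ := fun t x =>
    fderiv ℝ Δ (fderiv ℝ (ξ t) x) (mixedDeriv ξ (t, x)) * G (ξ t x) +
      Δ (fderiv ℝ (ξ t) x) * G' (ξ t x) (dt t x)
  have hδ2 : 0 < δ / 2 := half_pos h.pos
  have hsub : Metric.ball (0 : ℝ) (δ / 2) ⊆ Icc (-(δ / 2)) (δ / 2) := by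
    rw [Real.ball_eq_Ioo]
    intro t ht
    exact ⟨by linarith [ht.1], by linarith [ht.2]⟩
  have hsub2 : Icc (-(δ / 2)) (δ / 2) ⊆ Ioo (-δ) δ := fun t ht =>
    ⟨by linarith [ht.1], by linarith [ht.2]⟩
  -- bounds on a compact set of times and points
  have hKc : IsCompact (Icc (-(δ / 2)) (δ / 2) ×ˢ closure Ω) :=
    isCompact_Icc.prod hΩb.isCompact_closure
  have hDc : ContinuousOn (fun q : ℝ × RN (k + 2) => fderiv ℝ (ξ q.1) q.2)
      (Icc (-(δ / 2)) (δ / 2) ×ˢ closure Ω) :=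
    (h.continuousOn_fderiv (closure Ω)).mono (prod_mono hsub2 Subset.rfl)
  have hmc : ContinuousOn (mixedDeriv ξ) (Icc (-(δ / 2)) (δ / 2) ×ˢ closure Ω) :=
    (h.continuousOn_mixedDeriv (closure Ω)).mono (prod_mono hsub2 Subset.rfl)
  obtain ⟨C₁, hC₁⟩ := hKc.exists_bound_of_continuousOn
    (((hΔs.continuous_fderiv (by simp)).comp_continuousOn hDc).clm_apply hmc)
  obtain ⟨C₂, hC₂⟩ := hKc.exists_bound_of_continuousOn (hΔs.continuous.comp_continuousOn hDc)
  obtain ⟨C₃, hC₃⟩ := hKc.exists_bound_of_continuousOn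
    ((h.continuousOn_time (closure Ω)).mono (prod_mono hsub2 Subset.rfl))
  obtain ⟨C₄, hC₄⟩ := hΩb.isCompact_closure.exists_bound_of_continuousOn
    hf.continuous.continuousOn
  obtain ⟨C₅, hC₅⟩ := hΩb.isCompact_closure.exists_bound_of_continuousOn
    (hf.continuous_fderiv (by simp)).continuousOn
  have hG4 : ∀ x ∈ Ω, ‖G x‖ ≤ |C₄| := fun x hx => by
    refine (norm_indicator_le_norm_self _ _).trans ((hC₄ x (subset_closure hx)).trans (le_abs_self _))
  have hG5 : ∀ x ∈ Ω, ‖G' x‖ ≤ |C₅| := fun x hx => by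
    refine (norm_indicator_le_norm_self _ _).trans ((hC₅ x (subset_closure hx)).trans (le_abs_self _))
  have hfin : IsFiniteMeasure (volume.restrict Ω) := ⟨by simpa using hΩb.measure_lt_top⟩
  have hFm : ∀ t ∈ Ioo (-δ) δ, AEStronglyMeasurable (F t) (volume.restrict Ω) := by
    intro t ht
    have c1 : Continuous fun x => Δ (fderiv ℝ (ξ t) x) :=
      hΔs.continuous.comp ((h.contDiff ht).continuous_fderiv (by simp))
    exact (c1.measurable.mul (hGm.comp (h.contDiff ht).continuous.measurable)).aestronglyMeasurable
  have hF'0 : ∀ x ∈ Ω, F' 0 x = Ω₁.indicator (divergence fun x => f x • velocity ξ x) x := by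
    intro x _
    have e0 : ξ 0 x = x := by rw [h.zero]; rfl
    simp only [F', e0, h.fderiv_zero, hdt0]
    have e1 : mixedDeriv ξ (0, x) = fderiv ℝ (velocity ξ) x := (h.fderiv_velocity x).symm
    rw [e1, fderiv_clm_det_id, show Δ (ContinuousLinearMap.id ℝ (RN (k + 2))) = 1 from clm_det_id]
    by_cases hx1 : x ∈ Ω₁
    · rw [indicator_of_mem hx1, hG, hG', indicator_of_mem hx1, indicator_of_mem hx1,
        divergence_mulField hf h.contDiff_velocity, divergence]
      ring
    · rw [indicator_of_notMem hx1, hG, hG', indicator_of_notMem hx1, indicator_of_notMem hx1]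
      simp
  have hdivc : Continuous (divergence fun x => f x • velocity ξ x) :=
    continuous_divergence (hf.smul h.contDiff_velocity)
  have hmain := hasDerivAt_integral_of_dominated_loc_of_deriv_le (μ := volume.restrict Ω)
    (F := F) (F' := F') (x₀ := (0 : ℝ)) (s := Metric.ball 0 (δ / 2))
    (bound := fun _ => |C₁| * |C₄| + |C₂| * (|C₅| * |C₃|)) (Metric.ball_mem_nhds _ hδ2)
    (by
      filter_upwards [isOpen_Ioo.mem_nhds h.zero_mem] with t ht using hFm t ht)
    (by
      refine Integrable.of_bound (hFm 0 h.zero_mem) (|C₂| * |C₄|)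
        ((ae_restrict_iff' hΩo.measurableSet).2 (Eventually.of_forall fun x hx => ?_))
      have hq : ((0 : ℝ), x) ∈ Icc (-(δ / 2)) (δ / 2) ×ˢ closure Ω :=
        ⟨⟨by linarith, by linarith⟩, subset_closure hx⟩
      rw [norm_mul]
      exact mul_le_mul ((hC₂ _ hq).trans (le_abs_self _))
        (hG4 _ ((h.mem_iff hΩo hfr h.zero_mem x).2 hx)) (norm_nonneg _) (abs_nonneg _))
    (by
      have : AEStronglyMeasurable (Ω₁.indicator (divergence fun x => f x • velocity ξ x))
          (volume.restrict Ω) :=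
        (hdivc.measurable.indicator hM.isOpen₁.measurableSet).aestronglyMeasurable
      refine this.congr ((ae_restrict_iff' hΩo.measurableSet).2
        (Eventually.of_forall fun x hx => (hF'0 x hx).symm)))
    ((ae_restrict_iff' hΩo.measurableSet).2 (Eventually.of_forall fun x hx t ht => by
      have hq : (t, x) ∈ Icc (-(δ / 2)) (δ / 2) ×ˢ closure Ω := ⟨hsub ht, subset_closure hx⟩
      have hξΩ := (h.mem_iff hΩo hfr (hsub2 (hsub ht)) x).2 hx
      refine (norm_add_le _ _).trans (add_le_add ?_ ?_)
      · rw [norm_mul]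
        exact mul_le_mul ((hC₁ _ hq).trans (le_abs_self _)) (hG4 _ hξΩ) (norm_nonneg _) (abs_nonneg _)
      · rw [norm_mul]
        refine mul_le_mul ((hC₂ _ hq).trans (le_abs_self _)) ?_ (norm_nonneg _) (abs_nonneg _)
        refine (ContinuousLinearMap.le_of_opNorm_le _ (hG5 _ hξΩ) _).trans ?_
        exact mul_le_mul_of_nonneg_left ((hC₃ _ hq).trans (le_abs_self _)) (abs_nonneg _)))
    (integrable_const _)
    ((ae_restrict_iff' hΩo.measurableSet).2 (Eventually.of_forall fun x hx t ht => by
      have ht' := hsub2 (hsub ht)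
      have hξΩ := (h.mem_iff hΩo hfr ht' x).2 hx
      have d1 : HasDerivAt (fun t => Δ (fderiv ℝ (ξ t) x))
          (fderiv ℝ Δ (fderiv ℝ (ξ t) x) (mixedDeriv ξ (t, x))) t :=
        (hΔs.differentiable (by simp) _).hasFDerivAt.comp_hasDerivAt t (h.hasDerivAt_fderiv ht' x)
      have d2 := HasFDerivAt.comp_hasDerivAt (l := G) (f := fun t => ξ t x) t (hGd _ hξΩ)
        (h.hasDerivAt_time ht' x)
      exact d1.mul d2))
  have hconst : ∀ t ∈ Ioo (-δ) δ, ∫ x in Ω, F t x = ∫ x in Ω, G x := by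
    intro t ht
    have h1 := integral_image_eq_integral_abs_det_fderiv_smul volume hΩo.measurableSet
      (fun x _ => ((h.contDiff ht).differentiable (by simp) x).hasFDerivAt.hasFDerivWithinAt)
      (h.injective ht).injOn G
    rw [h.image_eq hΩo hfr ht] at h1
    rw [h1]
    refine integral_congr_ae (Eventually.of_forall fun x => ?_)
    simp only [F, smul_eq_mul, hΔ, abs_of_pos (h.det_pos ht x)]
  have h0 : ∫ x in Ω, F' 0 x = 0 := by
    refine hmain.2.unique ((hasDerivAt_const (0 : ℝ) (∫ x in Ω, G x)).congr_of_eventuallyEq ?_)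
    filter_upwards [isOpen_Ioo.mem_nhds h.zero_mem] with t ht using hconst t ht
  rw [setIntegral_congr_fun hΩo.measurableSet hF'0,
    setIntegral_indicator hM.isOpen₁.measurableSet, inter_eq_right.2 hM.subset₁] at h0
  exact h0

end

/-! ### From local to global -/

/-- An additive property of `C¹` functions that holds for functions of small support near `K`, and for
functions supported away from `K`, holds for all functions. -/
theorem IsCompact.induction_contDiff {K : Set (RN (k + 2))} (hK : IsCompact K)
    {P : (RN (k + 2) → ℝ) → Prop}
    (hloc : ∀ p ∈ K, ∃ U ∈ 𝓝 p, ∀ β, ContDiff ℝ 1 β → tsupport β ⊆ U → P β)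
    (hadd : ∀ β γ, ContDiff ℝ 1 β → ContDiff ℝ 1 γ → P β → P γ → P (β + γ))
    (hzero : ∀ β, ContDiff ℝ 1 β → Disjoint (tsupport β) K → P β)
    {β : RN (k + 2) → ℝ} (hβ : ContDiff ℝ 1 β) : P β := by
  choose! U hU hP using hloc
  have hex : ∀ p ∈ K, ∃ b : ContDiffBump p, tsupport b ⊆ U p := by
    intro p hp
    obtain ⟨r, hr, hrU⟩ := Metric.mem_nhds_iff.1 (hU p hp)
    refine ⟨⟨r / 4, r / 2, by linarith, by linarith⟩, ?_⟩
    rw [ContDiffBump.tsupport_eq]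
    exact (Metric.closedBall_subset_ball (by simp only []; linarith)).trans hrU
  choose! b hb using hex
  obtain ⟨t, htK, ht⟩ := hK.elim_nhds_subcover (fun p => Metric.ball p (b p).rIn)
    fun p _ => Metric.ball_mem_nhds p (b p).rIn_pos
  have key : ∀ s : Finset (RN (k + 2)), (∀ p ∈ s, p ∈ K) → ∀ β, ContDiff ℝ 1 β →
      tsupport β ∩ K ⊆ ⋃ p ∈ s, Metric.ball p (b p).rIn → P β := by
    classical
    intro s
    induction s using Finset.induction_on with
    | empty =>
      intro _ β hβ hs
      exact hzero β hβ (disjoint_iff_inter_eq_empty.2 (by simpa using hs))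
    | insert a s ha ih =>
      intro hs β hβ hsub
      have haK := hs a (Finset.mem_insert_self _ _)
      have hb1 : ContDiff ℝ 1 fun x => b a x * β x := (b a).contDiff.mul hβ
      have hb2 : ContDiff ℝ 1 fun x => (1 - b a x) * β x :=
        (contDiff_const.sub (b a).contDiff).mul hβ
      -- Split off the part of `β` near `a`; the rest is supported, on `K`, in the union of the
      -- other balls.
      have e : β = (fun x => b a x * β x) + fun x => (1 - b a x) * β x := by
        funext x
        simp only [Pi.add_apply]
        ring
      rw [e]
      refine hadd _ _ hb1 hb2 (hP a haK _ hb1 ?_) (ih (fun p hp => hs p (Finset.mem_insert_of_mem hp))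
        _ hb2 ?_)
      · exact (tsupport_mul_subset_left).trans (hb a haK)
      · rintro x ⟨hx, hxK⟩
        have hx1 : x ∉ Metric.ball a (b a).rIn := by
          intro hxb
          refine notMem_tsupport_iff_eventuallyEq.2 ?_ hx
          filter_upwards [Metric.isOpen_ball.mem_nhds hxb] with y hy
          rw [(b a).one_of_mem_closedBall (Metric.ball_subset_closedBall hy)]
          simp
        have hx2 := hsub ⟨tsupport_mul_subset_right hx, hxK⟩
        rw [Finset.set_biUnion_insert] at hx2
        exact hx2.resolve_left hx1
  exact key t htK β hβ fun x hx => ht hx.2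

/-- A cutoff function, equal to `0` near `S` and to `1` at distance `ε` from `S`. -/
structure IsCutoff (S : Set (RN (k + 2))) (ε : ℝ) (θ : RN (k + 2) → ℝ) : Prop where
  contDiff : ContDiff ℝ 1 θ
  abs_le : ∀ x, |θ x| ≤ 1
  norm_fderiv_le : ∀ x, ‖fderiv ℝ θ x‖ ≤ 4 / ε
  eq_zero : ∀ x ∈ Metric.thickening (ε / 8) S, θ x = 0
  eventuallyEq_one : ∀ x ∉ Metric.thickening ε S, θ =ᶠ[𝓝 x] fun _ => 1

theorem exists_isCutoff (S : Set (RN (k + 2))) {ε : ℝ} (hε : 0 < ε) : ∃ θ, IsCutoff S ε θ := by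
  obtain ⟨θ, h1, h2, h3, h4, h5⟩ := exists_cutoff S hε
  exact ⟨θ, h1.of_le (by norm_num), h2, h3, h4, h5⟩

namespace IsCutoff

variable {S : Set (RN (k + 2))} {ε : ℝ} {θ : RN (k + 2) → ℝ}

theorem eventuallyEq_zero (h : IsCutoff S ε θ) {x : RN (k + 2)}
    (hx : x ∈ Metric.thickening (ε / 8) S) : θ =ᶠ[𝓝 x] fun _ => 0 := by
  filter_upwards [Metric.isOpen_thickening.mem_nhds hx] with y hy using h.eq_zero y hy

end IsCutoff

/-- A smooth function that is `1` near the compact set `K`, with support in the bounded open set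
`U`. -/
theorem exists_contDiff_eq_one {K U : Set (RN (k + 2))} (hK : IsCompact K) (hU : IsOpen U)
    (hKU : K ⊆ U) (hUb : Bornology.IsBounded U) : ∃ κ : RN (k + 2) → ℝ, ContDiff ℝ 1 κ ∧
      HasCompactSupport κ ∧ tsupport κ ⊆ U ∧ ∀ x ∈ K, κ =ᶠ[𝓝 x] fun _ => 1 := by
  obtain ⟨r, hr, hrU⟩ := hK.exists_thickening_subset_open hU hKU
  obtain ⟨θ, hθ⟩ := exists_isCutoff K hr
  have hts : tsupport (fun x => 1 - θ x) ⊆ U := by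
    refine fun x hx => hrU ?_
    by_contra hxr
    refine notMem_tsupport_iff_eventuallyEq.2 ?_ hx
    filter_upwards [hθ.eventuallyEq_one x hxr] with y hy
    simp [hy]
  refine ⟨fun x => 1 - θ x, contDiff_const.sub hθ.contDiff, ?_, hts, fun x hx => ?_⟩
  · exact (Metric.isCompact_of_isClosed_isBounded (isClosed_tsupport _) (hUb.subset hts))
  · filter_upwards [hθ.eventuallyEq_zero (Metric.self_subset_thickening (by linarith) K hx)] with y hy
    simp [hy]

/-! ### Removing neighbourhoods of the boundary -/

section

variable {M : Set (RN (k + 2))} {N : RN (k + 2) → RN (k + 2)}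

/-- The flux of a field is not affected by cutting off near `∂M`: the divergence changes by at most
a multiple of `1 / ε`, on a set of volume `O(ε²)`. -/
theorem IsHypersurface.exists_flux_cutoff_le (hM : IsHypersurface M) {X : RN (k + 2) → RN (k + 2)}
    (hX : ContDiff ℝ 1 X) {S : Set (RN (k + 2))} (hS : MeasurableSet S)
    (hSb : Bornology.IsBounded S) : ∃ C : ℝ, ∃ ε₀ > 0, ∀ ε > 0, ε < ε₀ → ∀ θ, IsCutoff (bdry M) ε θ →
      |(∫ x in S, divergence (fun x => θ x • X x) x) - ∫ x in S, divergence X x| ≤ C * ε := by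
  obtain ⟨C₀, hC₀, ε₁, hε₁, hvol⟩ := hM.exists_volume_thickening_le
  obtain ⟨C₃, hC₃⟩ := hSb.isCompact_closure.exists_bound_of_continuousOn
    (continuous_divergence hX).continuousOn
  obtain ⟨C₄, hC₄⟩ := hSb.isCompact_closure.exists_bound_of_continuousOn hX.continuous.continuousOn
  refine ⟨(2 * |C₃| + 4 * |C₄|) * C₀, min ε₁ 1, lt_min hε₁ one_pos, fun ε hε hε1 θ hθ => ?_⟩
  have hεl : ε < 1 := hε1.trans_le (min_le_right _ _)
  set T := Metric.thickening ε (bdry M)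
  have hθX : ContDiff ℝ 1 fun x => θ x • X x := hθ.contDiff.smul hX
  rw [← integral_sub (integrableOn_divergence hθX hSb) (integrableOn_divergence hX hSb)]
  have hoff : ∀ x ∈ S \ (S ∩ T), divergence (fun x => θ x • X x) x - divergence X x = 0 := by
    rintro x ⟨hx, hxT⟩
    have h1 : (fun x => θ x • X x) =ᶠ[𝓝 x] X := by
      filter_upwards [hθ.eventuallyEq_one x fun h => hxT ⟨hx, h⟩] with y hy
      rw [hy, one_smul]
    rw [divergence, divergence, h1.fderiv_eq, sub_self]
  rw [setIntegral_eq_of_subset_of_forall_sdiff_eq_zero hS inter_subset_left hoff, ← Real.norm_eq_abs]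
  have hTv : volume (S ∩ T) ≤ ENNReal.ofReal (C₀ * ε ^ 2) :=
    (measure_mono inter_subset_right).trans (hvol ε hε (hε1.trans_le (min_le_left _ _)))
  have hb : ∀ x ∈ S ∩ T, ‖divergence (fun x => θ x • X x) x - divergence X x‖ ≤
      2 * |C₃| + 4 / ε * |C₄| := by
    rintro x ⟨hx, -⟩
    have a1 := (hC₃ x (subset_closure hx)).trans (le_abs_self _)
    have a2 := (hC₄ x (subset_closure hx)).trans (le_abs_self _)
    rw [divergence_mulField hθ.contDiff hX]
    calc _ ≤ ‖θ x * divergence X x‖ + ‖fderiv ℝ θ x (X x)‖ + ‖divergence X x‖ := by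
          refine (norm_sub_le _ _).trans (add_le_add_left (norm_add_le _ _) _)
      _ ≤ 1 * |C₃| + 4 / ε * |C₄| + |C₃| := by
          refine add_le_add (add_le_add ?_ ?_) a1
          · rw [norm_mul]
            exact mul_le_mul (hθ.abs_le x) a1 (norm_nonneg _) zero_le_one
          · refine (ContinuousLinearMap.le_of_opNorm_le _ (hθ.norm_fderiv_le x) _).trans ?_
            exact mul_le_mul_of_nonneg_left a2 (by positivity)
      _ = _ := by ring
  refine (norm_setIntegral_le_of_norm_le_const (hTv.trans_lt ENNReal.ofReal_lt_top) hb).trans ?_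
  have hTr : volume.real (S ∩ T) ≤ C₀ * ε ^ 2 :=
    ENNReal.toReal_le_of_le_ofReal (by positivity) hTv
  calc (2 * |C₃| + 4 / ε * |C₄|) * volume.real (S ∩ T)
      ≤ (2 * |C₃| + 4 / ε * |C₄|) * (C₀ * ε ^ 2) := mul_le_mul_of_nonneg_left hTr (by positivity)
    _ = (2 * |C₃| * ε + 4 * |C₄|) * (C₀ * ε) := by field_simp
    _ ≤ (2 * |C₃| * 1 + 4 * |C₄|) * (C₀ * ε) := by gcongr
    _ = _ := by ring

/-- The first variation of area is not affected by cutting off near `∂M` a field that vanishes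
on `∂M`. -/
theorem IsFlatAlong.exists_firstVar_cutoff_le (hM : IsFlatAlong M N) (hb : IsCompact (bdry M))
    {Z : RN (k + 2) → RN (k + 2)} (hZ : ContDiff ℝ 1 Z) (hZ0 : ∀ x ∈ bdry M, Z x = 0) :
    ∃ C : ℝ, ∀ ε > 0, ε < 1 → ∀ θ, IsCutoff (bdry M) ε θ →
      |firstVar M N (fun x => θ x • Z x) - firstVar M N Z| ≤
        C * (μHE[k + 1] : Measure (RN (k + 2))).real (M ∩ Metric.thickening ε (bdry M)) := by
  obtain ⟨C₁, hC₁⟩ := hM.isCompact.exists_bound_of_continuousOn (hM.continuousOn_tanTrace hZ)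
  obtain ⟨R, hR⟩ := hb.isBounded.subset_closedBall (0 : RN (k + 2))
  obtain ⟨C₂, hC₂⟩ := (isCompact_closedBall (0 : RN (k + 2)) (R + 1)).exists_bound_of_continuousOn
    (hZ.continuous_fderiv (by simp)).continuousOn
  have hlip : ∀ x ∈ Metric.closedBall (0 : RN (k + 2)) (R + 1),
      ∀ y ∈ Metric.closedBall (0 : RN (k + 2)) (R + 1), ‖Z x - Z y‖ ≤ |C₂| * ‖x - y‖ :=
    fun x hx y hy => (convex_closedBall _ _).norm_image_sub_le_of_norm_fderiv_le
      (fun z _ => hZ.differentiable (by simp) z) (fun z hz => (hC₂ z hz).trans (le_abs_self _)) hy hx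
  refine ⟨2 * |C₁| + 4 * |C₂|, fun ε hε hε1 θ hθ => ?_⟩
  set T := Metric.thickening ε (bdry M)
  have hθZ : ContDiff ℝ 1 fun x => θ x • Z x := hθ.contDiff.smul hZ
  rw [firstVar, firstVar, ← integral_sub (hM.integrableOn_tanTrace hθZ) (hM.integrableOn_tanTrace hZ)]
  have hoff : ∀ x ∈ M \ (M ∩ T), tanTrace (fderiv ℝ (fun x => θ x • Z x) x) (N x) -
      tanTrace (fderiv ℝ Z x) (N x) = 0 := by
    rintro x ⟨hx, hxT⟩
    have h1 : (fun x => θ x • Z x) =ᶠ[𝓝 x] Z := by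
      filter_upwards [hθ.eventuallyEq_one x fun h => hxT ⟨hx, h⟩] with y hy
      rw [hy, one_smul]
    rw [h1.fderiv_eq, sub_self]
  rw [setIntegral_eq_of_subset_of_forall_sdiff_eq_zero hM.measurableSet inter_subset_left hoff,
    ← Real.norm_eq_abs]
  refine norm_setIntegral_le_of_norm_le_const
    ((measure_mono inter_subset_left).trans_lt hM.area_lt_top) ?_
  rintro x ⟨hx, hxT⟩
  have a1 := (hC₁ x hx).trans (le_abs_self _)
  -- As `Z` vanishes on `∂M`, it is of order `ε` where the derivative of `θ` is of order `1 / ε`.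
  have a2 : ‖Z x‖ ≤ |C₂| * ε := by
    obtain ⟨y, hy, hxy⟩ := Metric.mem_thickening_iff.1 hxT
    have hy0 : ‖y‖ ≤ R := by simpa using hR hy
    have hx0 : ‖x‖ ≤ R + 1 := by
      have := norm_sub_norm_le x y
      rw [← dist_eq_norm] at this
      linarith
    have := hlip x (by simpa using hx0) y (by simpa using by linarith)
    rw [hZ0 y hy, sub_zero, ← dist_eq_norm] at this
    exact this.trans (mul_le_mul_of_nonneg_left hxy.le (abs_nonneg _))
  rw [tanTrace_mulField hθ.contDiff hZ]
  calc _ ≤ ‖θ x * tanTrace (fderiv ℝ Z x) (N x)‖ + ‖fderiv ℝ θ x (Z x - ⟪Z x, N x⟫ • N x)‖ +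
        ‖tanTrace (fderiv ℝ Z x) (N x)‖ :=
        (norm_sub_le _ _).trans (add_le_add_left (norm_add_le _ _) _)
    _ ≤ 1 * |C₁| + 4 / ε * (|C₂| * ε) + |C₁| := by
        refine add_le_add (add_le_add ?_ ?_) a1
        · rw [norm_mul]
          exact mul_le_mul (hθ.abs_le x) a1 (norm_nonneg _) zero_le_one
        · refine (ContinuousLinearMap.le_of_opNorm_le _ (hθ.norm_fderiv_le x) _).trans ?_
          exact mul_le_mul_of_nonneg_left ((norm_tangential_le (hM.norm_eq x hx) _).trans a2)
            (by positivity)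
    _ = 2 * |C₁| + 4 * |C₂| := by field_simp; ring

/-- The area of `M` near `∂M` is small, because `∂M` has area zero. -/
theorem IsFlatAlong.tendsto_area_thickening (hM : IsFlatAlong M N) (hH : IsHypersurface M) :
    Tendsto (fun ε => (μHE[k + 1] : Measure (RN (k + 2))).real (M ∩ Metric.thickening ε (bdry M)))
      (𝓝[>] 0) (𝓝 0) := by
  have h1 := tendsto_measure_thickening_of_isClosed
    (μ := (μHE[k + 1] : Measure (RN (k + 2))).restrict M) (s := bdry M)
    ⟨1, one_pos, ((measure_mono (subset_univ _)).trans_lt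
      (by rw [Measure.restrict_apply_univ]; exact hM.area_lt_top)).ne⟩ hH.isCompact_bdry.isClosed
  have h2 : (μHE[k + 1] : Measure (RN (k + 2))).restrict M (bdry M) = 0 :=
    le_zero_iff.1 ((Measure.restrict_apply_le _ _).trans hH.area_bdry_eq_zero.le)
  rw [h2] at h1
  have h3 := (ENNReal.tendsto_toReal ENNReal.zero_ne_top).comp h1
  refine h3.congr fun ε => ?_
  simp only [Function.comp_apply, Measure.real]
  rw [Measure.restrict_apply Metric.isOpen_thickening.measurableSet, inter_comm]

end

/-! ### Fields on which area and volume are balanced -/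

section

variable {Ω M Ω₁ Ω₂ : Set (RN (k + 2))} {N X Y : RN (k + 2) → RN (k + 2)} {l : ℝ}

/-- The field `X` is of class `C¹`, and the first variation of area in the direction `X` is `l` times
the first variation of the volume of `Ω₁`. -/
structure IsBalanced (M : Set (RN (k + 2))) (N : RN (k + 2) → RN (k + 2)) (Ω₁ : Set (RN (k + 2)))
    (l : ℝ) (X : RN (k + 2) → RN (k + 2)) : Prop where
  contDiff : ContDiff ℝ 1 X
  firstVar_eq : firstVar M N X = l * ∫ x in Ω₁, divergence X x

theorem isBalanced_zero : IsBalanced M N Ω₁ l 0 where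
  contDiff := contDiff_const
  firstVar_eq := by
    have h0 : ContDiff ℝ 1 (0 : RN (k + 2) → RN (k + 2)) := contDiff_const
    have h : (0 : RN (k + 2) → RN (k + 2)) = (0 : ℝ) • 0 := by simp
    rw [h, firstVar_const_smul h0, integral_divergence_const_smul _ h0]
    simp

theorem IsBalanced.add (hM : IsPartitioning Ω M N Ω₁ Ω₂) (hX : IsBalanced M N Ω₁ l X)
    (hY : IsBalanced M N Ω₁ l Y) : IsBalanced M N Ω₁ l (X + Y) where
  contDiff := hX.contDiff.add hY.contDiff
  firstVar_eq := by
    rw [hM.isFlatAlong.firstVar_add hX.contDiff hY.contDiff,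
      integral_divergence_add hM.isBounded₁ hX.contDiff hY.contDiff, hX.firstVar_eq, hY.firstVar_eq]
    ring

theorem IsBalanced.sum (hM : IsPartitioning Ω M N Ω₁ Ω₂) {ι : Type*} (s : Finset ι)
    {X : ι → RN (k + 2) → RN (k + 2)} (hX : ∀ i ∈ s, IsBalanced M N Ω₁ l (X i)) :
    IsBalanced M N Ω₁ l (∑ i ∈ s, X i) := by
  classical
  induction s using Finset.induction_on with
  | empty => simpa using isBalanced_zero
  | insert a s ha ih =>
    rw [Finset.sum_insert ha]
    exact (hX a (Finset.mem_insert_self _ _)).add hM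
      (ih fun i hi => hX i (Finset.mem_insert_of_mem hi))

/-- `l` is a Lagrange multiplier: flow fields of small support are balanced. -/
def IsMultiplier (Ω M : Set (RN (k + 2))) (N : RN (k + 2) → RN (k + 2)) (Ω₁ : Set (RN (k + 2)))
    (l : ℝ) : Prop :=
  ∀ p, ∃ U ∈ 𝓝 p, ∀ X K, IsFlowField Ω X K → IsClosed K →
    K ⊆ U → firstVar M N X = l * ∫ x in Ω₁, divergence X x

theorem contDiff_coord {X : RN (k + 2) → RN (k + 2)} (hX : ContDiff ℝ 1 X) (i : Fin (k + 2)) :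
    ContDiff ℝ 1 fun x => X x i :=
  (EuclideanSpace.proj (𝕜 := ℝ) i).contDiff.comp hX

theorem field_eq_sum (X : RN (k + 2) → RN (k + 2)) :
    X = ∑ i, fun x => X x i • EuclideanSpace.basisFun (Fin (k + 2)) ℝ i := by
  funext x
  rw [Finset.sum_apply]
  conv_lhs => rw [← (EuclideanSpace.basisFun (Fin (k + 2)) ℝ).sum_repr (X x)]
  simp

/-- Constant directions form shear charts inside `Ω`, so a partition of unity reduces the claim to
functions of small support. -/
theorem IsMultiplier.isBalanced_smul_const (hl : IsMultiplier Ω M N Ω₁ l)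
    (hM : IsPartitioning Ω M N Ω₁ Ω₂) (e : RN (k + 2)) {β : RN (k + 2) → ℝ} (hβ : ContDiff ℝ 1 β)
    (hβc : HasCompactSupport β) (hβΩ : tsupport β ⊆ Ω) :
    IsBalanced M N Ω₁ l fun x => β x • e := by
  have h := hβc.isCompact.induction_contDiff
    (P := fun γ => IsBalanced M N Ω₁ l fun x => (γ x * β x) • e) ?_ ?_ ?_
    (contDiff_const (c := (1 : ℝ)))
  · simpa using h
  · intro p hp
    obtain ⟨U, hU, hUl⟩ := hl p
    refine ⟨interior U, interior_mem_nhds.2 hU, fun γ hγ hγU => ?_⟩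
    have hγβ : ContDiff ℝ 1 fun x => γ x * β x := hγ.mul hβ
    refine ⟨hγβ.smul contDiff_const, ?_⟩
    have h1 := (isShearChart_of_subset hM.container.isOpen hM.container.isOpen Subset.rfl
      e).firstVar_eq hM (isOpen_interior (s := U))
      (fun X K h1 h2 h3 => hUl X K h1 h2 (h3.trans interior_subset)) hγβ (hβc.mul_left)
      (subset_inter (tsupport_mul_subset_right.trans hβΩ) (tsupport_mul_subset_left.trans hγU))
    simpa using h1
  · intro γ γ' _ _ h1 h2
    have h3 := h1.add hM h2
    have e : ((fun x => (γ x * β x) • e) + fun x => (γ' x * β x) • e) =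
        fun x => ((γ + γ') x * β x) • e := by
      funext x
      simp only [Pi.add_apply]
      module
    rwa [e] at h3
  · intro γ _ hd
    have e : (fun x => (γ x * β x) • e) = 0 := by
      funext x
      by_cases hx : x ∈ tsupport β
      · simp [image_eq_zero_of_notMem_tsupport fun h => hd.le_bot ⟨h, hx⟩]
      · simp [image_eq_zero_of_notMem_tsupport hx]
    rw [e]
    exact isBalanced_zero

/-- Fields with compact support in `Ω` are balanced. -/
theorem IsMultiplier.isBalanced (hl : IsMultiplier Ω M N Ω₁ l)
    (hM : IsPartitioning Ω M N Ω₁ Ω₂) (hX : ContDiff ℝ 1 X)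
    (hXc : HasCompactSupport X) (hXΩ : tsupport X ⊆ Ω) : IsBalanced M N Ω₁ l X := by
  rw [field_eq_sum X]
  refine IsBalanced.sum hM _ fun i _ => ?_
  have hsub : tsupport (fun x => X x i) ⊆ tsupport X :=
    closure_mono fun x hx h0 => hx (by simp [h0])
  exact hl.isBalanced_smul_const hM _ (contDiff_coord hX i)
    (HasCompactSupport.of_support_subset_isCompact hXc ((subset_tsupport _).trans hsub))
    (hsub.trans hXΩ)

/-- A balanced field `Y` such that `h Y` has no flux out of `Ω₁` whenever `h` vanishes near `M`. -/
structure IsTame (M : Set (RN (k + 2))) (N : RN (k + 2) → RN (k + 2)) (Ω₁ : Set (RN (k + 2)))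
    (l : ℝ) (Y : RN (k + 2) → RN (k + 2)) : Prop extends IsBalanced M N Ω₁ l Y where
  flux_eq_zero : ∀ h : RN (k + 2) → ℝ, ContDiff ℝ 1 h → (∀ x ∈ M, h =ᶠ[𝓝 x] fun _ => 0) →
    ∫ x in Ω₁, divergence (fun x => h x • Y x) x = 0

theorem isTame_zero : IsTame M N Ω₁ l 0 where
  toIsBalanced := isBalanced_zero
  flux_eq_zero h _ _ := by
    have : (fun x => h x • (0 : RN (k + 2) → RN (k + 2)) x) = fun _ => 0 := by simp
    rw [this]
    simp [divergence]

theorem IsTame.add (hM : IsPartitioning Ω M N Ω₁ Ω₂) (hX : IsTame M N Ω₁ l X)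
    (hY : IsTame M N Ω₁ l Y) : IsTame M N Ω₁ l (X + Y) where
  toIsBalanced := hX.toIsBalanced.add hM hY.toIsBalanced
  flux_eq_zero h hh h0 := by
    have e : (fun x => h x • (X + Y) x) = (fun x => h x • X x) + fun x => h x • Y x := by
      funext x
      simp
    have hhX : ContDiff ℝ 1 fun x => h x • X x := hh.smul hX.contDiff
    have hhY : ContDiff ℝ 1 fun x => h x • Y x := hh.smul hY.contDiff
    rw [e, integral_divergence_add hM.isBounded₁ hhX hhY, hX.flux_eq_zero h hh h0,
      hY.flux_eq_zero h hh h0, add_zero]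

theorem IsTame.sum (hM : IsPartitioning Ω M N Ω₁ Ω₂) {ι : Type*} (s : Finset ι)
    {X : ι → RN (k + 2) → RN (k + 2)} (hX : ∀ i ∈ s, IsTame M N Ω₁ l (X i)) :
    IsTame M N Ω₁ l (∑ i ∈ s, X i) := by
  classical
  induction s using Finset.induction_on with
  | empty => simpa using isTame_zero
  | insert a s ha ih =>
    rw [Finset.sum_insert ha]
    exact (hX a (Finset.mem_insert_self _ _)).add hM
      (ih fun i hi => hX i (Finset.mem_insert_of_mem hi))

/-- The multiples, with small support, of the fields of a shear chart are tame. -/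
theorem IsMultiplier.exists_isTame_chart (hl : IsMultiplier Ω M N Ω₁ l)
    (hM : IsPartitioning Ω M N Ω₁ Ω₂) {U : Set (RN (k + 2))} {p m : RN (k + 2)}
    {g : RN (k + 2) → ℝ} (hU : U ∈ 𝓝 p) :
    ∃ r > 0, ∀ e : RN (k + 2), IsShearChart Ω U m g e → ∀ β : RN (k + 2) → ℝ, ContDiff ℝ 1 β → tsupport β ⊆ Metric.ball p r →
      IsTame M N Ω₁ l fun x => β x • (e + fderiv ℝ g x e • m) := by
  obtain ⟨U', hU', hUl⟩ := hl p
  obtain ⟨r, hr, hrU⟩ := Metric.mem_nhds_iff.1 (inter_mem hU (interior_mem_nhds.2 hU'))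
  refine ⟨r / 4, by linarith, fun e hch β hβ hβr => ?_⟩
  have hβr' : tsupport β ⊆ Metric.ball p r := hβr.trans (Metric.ball_subset_ball (by linarith))
  have hβc : HasCompactSupport β := HasCompactSupport.of_support_subset_isCompact
    (isCompact_closedBall p (r / 4))
    ((subset_tsupport _).trans (hβr.trans Metric.ball_subset_closedBall))
  have hV : ContDiff ℝ 1 fun x => e + fderiv ℝ g x e • m := contDiff_const.add
    (((hch.contDiff.fderiv_right (m := 1) (by norm_num)).clm_apply contDiff_const).smul
      contDiff_const)
  refine ⟨⟨hβ.smul hV, ?_⟩, fun h hh h0 => ?_⟩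
  · exact hch.firstVar_eq hM (isOpen_interior (s := U'))
      (fun X K h1 h2 h3 => hUl X K h1 h2 (h3.trans interior_subset)) hβ hβc (hβr'.trans hrU)
  · -- the field `b V`, for a bump function `b` equal to `1` on the support of `β`, is a flow field
    let b : ContDiffBump p := ⟨r / 4, r / 2, by linarith, by linarith⟩
    have hbU : tsupport b ⊆ U := by
      rw [b.tsupport_eq]
      exact (Metric.closedBall_subset_ball (by simp only [b]; linarith)).trans
        (hrU.trans inter_subset_left)
    obtain ⟨δ, ξ, hv, hvel, hrest⟩ := hch.isFlowField (b.contDiff (n := 2)) b.hasCompactSupport hbU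
    have h1 := hM.integral_divergence_mul_eq_zero hv (fun t ht => (hrest t ht).1)
      (f := fun x => h x * β x) (hh.mul hβ) fun x hx => by
        filter_upwards [h0 x hx] with y hy
        rw [hy, zero_mul]
    have e1 : (fun x => (h x * β x) • velocity ξ x) =
        fun x => h x • β x • (e + fderiv ℝ g x e • m) := by
      funext x
      simp only [hvel]
      by_cases hx : x ∈ tsupport β
      · rw [b.one_of_mem_closedBall (Metric.ball_subset_closedBall (hβr hx)), one_smul, mul_smul]
      · simp [image_eq_zero_of_notMem_tsupport hx]
    rwa [e1] at h1

/-- Each field that is tangent to `∂Ω` along `∂M` coincides on `∂M` with a tame field. -/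
theorem IsMultiplier.exists_isTame (hl : IsMultiplier Ω M N Ω₁ l)
    (hM : IsPartitioning Ω M N Ω₁ Ω₂) (hX : ContDiff ℝ 1 X)
    (hT : ∀ q ∈ bdry M, X q ∈ tangentBd Ω q) :
    ∃ Y, IsTame M N Ω₁ l Y ∧ ∀ q ∈ bdry M, Y q = X q := by
  have h := hM.hypersurface.isCompact_bdry.induction_contDiff
    (P := fun β => ∃ Y, IsTame M N Ω₁ l Y ∧ ∀ q ∈ bdry M, Y q = β q • X q) ?_ ?_ ?_
    (contDiff_const (c := (1 : ℝ)))
  · simpa using h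
  · intro p hp
    obtain ⟨U, m, g, hg⟩ := (hM.container.smooth p hp).isDefiningFunction.exists_isGraphChart
    obtain ⟨r, hr, htame⟩ := hl.exists_isTame_chart hM (m := m) (g := g) (hg.isOpen.mem_nhds hg.mem)
    refine ⟨Metric.ball p r ∩ U, inter_mem (Metric.ball_mem_nhds p hr) (hg.isOpen.mem_nhds hg.mem),
      fun β hβ hβU => ?_⟩
    let b := EuclideanSpace.basisFun (Fin (k + 2)) ℝ
    -- In a graph chart, the coordinates of `X` are attached to the tangential fields over the
    -- projections `e i` of the basis vectors; a tangential vector is recovered in this way.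
    let e : Fin (k + 2) → RN (k + 2) := fun i => b i - ⟪m, b i⟫ • m
    refine ⟨∑ i, fun x => (β x * X x i) • (e i + fderiv ℝ g x (e i) • m),
      IsTame.sum hM _ fun i _ => ?_, fun q hq => ?_⟩
    · refine htame (e i) (hg.isShearChart (hg.inner_proj _)) _ (hβ.mul (contDiff_coord hX i)) ?_
      exact tsupport_mul_subset_left.trans (hβU.trans inter_subset_left)
    · rw [Finset.sum_apply]
      by_cases hqs : q ∈ tsupport β
      · have hqU : q ∈ U := (hβU hqs).2
        have h1 := hg.eq_of_mem_ker hqU (hM.container.bdry_subset hq)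
          (hM.container.smooth q hq).isDefiningFunction (w := X q) (hT q hq)
        have hXs : X q = ∑ i, X q i • b i := by
          conv_lhs => rw [field_eq_sum X]
          rw [Finset.sum_apply]
        have h2 : X q - ⟪m, X q⟫ • m = ∑ i, X q i • e i := by
          have : ⟪m, X q⟫ = ∑ i, X q i * ⟪m, b i⟫ := by
            conv_lhs => rw [hXs, inner_sum]
            simp only [inner_smul_right]
          rw [this, Finset.sum_smul]
          nth_rewrite 1 [hXs]
          rw [← Finset.sum_sub_distrib]
          refine Finset.sum_congr rfl fun i _ => ?_
          simp only [e]
          module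
        rw [h2, map_sum] at h1
        conv_rhs => rw [h1]
        rw [smul_add, Finset.smul_sum, Finset.sum_smul, Finset.smul_sum,
          ← Finset.sum_add_distrib]
        refine Finset.sum_congr rfl fun i _ => ?_
        rw [map_smul, smul_eq_mul]
        module
      · simp [image_eq_zero_of_notMem_tsupport hqs]
  · rintro β γ - - ⟨Y, hY, hYβ⟩ ⟨Y', hY', hYγ⟩
    refine ⟨Y + Y', hY.add hM hY', fun q hq => ?_⟩
    rw [Pi.add_apply, hYβ q hq, hYγ q hq, Pi.add_apply, add_smul]
  · intro β _ hd
    refine ⟨0, isTame_zero, fun q hq => ?_⟩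
    rw [image_eq_zero_of_notMem_tsupport fun h => hd.le_bot ⟨h, hq⟩]
    simp

/-- The velocity of a variation that preserves `∂Ω` is tangent to `∂Ω`. -/
theorem IsVariation.velocity_mem_tangentBd {δ : ℝ} {ξ : ℝ → RN (k + 2) → RN (k + 2)}
    (h : IsVariation δ ξ) (hfr : ∀ t ∈ Ioo (-δ) δ, ξ t '' frontier Ω = frontier Ω)
    {q : RN (k + 2)} (hq : q ∈ frontier Ω) (hΩ : HasC2BoundaryAt Ω q) :
    velocity ξ q ∈ tangentBd Ω q := by
  have hρ := hΩ.isDefiningFunction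
  change fderiv ℝ (definingFunction Ω q) q (velocity ξ q) = 0
  set ρ := definingFunction Ω q
  have hc := h.hasDerivAt q
  have hξ0 : ξ 0 q = q := by rw [h.zero]; rfl
  have h1 : HasFDerivAt ρ (fderiv ℝ ρ q) (ξ 0 q) := by
    rw [hξ0]; exact (hρ.1.differentiableAt (by simp)).hasFDerivAt
  have h2 := h1.comp_hasDerivAt (0 : ℝ) hc
  refine h2.unique ((hasDerivAt_const (0 : ℝ) (0 : ℝ)).congr_of_eventuallyEq ?_)
  have h3 := hc.continuousAt.tendsto
  rw [hξ0] at h3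
  filter_upwards [h3.eventually hρ.eventually_mem_frontier_iff, isOpen_Ioo.mem_nhds h.zero_mem]
    with s hs1 hs2
  refine hs1.1 ?_
  rw [← hfr s hs2]
  exact mem_image_of_mem _ hq

theorem firstVar_congr (hM : MeasurableSet M) (h : ∀ x ∈ M, X =ᶠ[𝓝 x] Y) :
    firstVar M N X = firstVar M N Y :=
  setIntegral_congr_fun hM fun x hx => by simp only [(h x hx).fderiv_eq]

theorem integral_divergence_sub {S : Set (RN (k + 2))} (hS : Bornology.IsBounded S)
    (hX : ContDiff ℝ 1 X) (hY : ContDiff ℝ 1 Y) :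
    ∫ x in S, divergence (X - Y) x = (∫ x in S, divergence X x) - ∫ x in S, divergence Y x := by
  have hD : ContDiff ℝ 1 (X - Y) := hX.sub hY
  have h := integral_divergence_add hS hD hY
  rw [sub_add_cancel] at h
  linarith

theorem eq_of_abs_sub_le_tendsto {a b : ℝ} {f : ℝ → ℝ} (hf : Tendsto f (𝓝[>] 0) (𝓝 0))
    (h : ∀ᶠ ε in 𝓝[>] 0, |a - b| ≤ f ε) : a = b := by
  have h0 : |a - b| ≤ 0 := ge_of_tendsto hf h
  exact sub_eq_zero.1 (abs_eq_zero.1 (le_antisymm h0 (abs_nonneg _)))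

/-- A partitioning that is minimal in `Ω` is minimal in every container that is tangent to `∂Ω` along
`∂M`. -/
theorem IsMinimalPartitioning.of_tangent (hM : IsMinimalPartitioning Ω M N Ω₁ Ω₂)
    (hb : (bdry M).Nonempty) {Ω' Ω₁' Ω₂' : Set (RN (k + 2))}
    (hM' : IsPartitioning Ω' M N Ω₁' Ω₂') (hT : ∀ p ∈ bdry M, tangentBd Ω' p = tangentBd Ω p)
    (hphase : Ω₁' ∩ Ω = Ω₁ ∩ Ω') : IsMinimalPartitioning Ω' M N Ω₁' Ω₂' where
  toIsPartitioning := hM'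
  critical δ ξ hadm := by
    have hv := hadm.1
    have hfr := fun t ht => (hadm.2 t ht).1
    have hflat := hM.isFlatAlong
    obtain ⟨l, hl⟩ := hM.exists_multiplier hb
    replace hl : IsMultiplier Ω M N Ω₁ l := hl
    set X := velocity ξ with hXdef
    have hX : ContDiff ℝ 1 X := hv.contDiff_velocity
    have hQ' : ∫ x in Ω₁', divergence X x = 0 :=
      hv.integral_divergence_eq_zero hM'.isOpen₁.measurableSet hM'.isBounded₁
        fun t ht => (hadm.2 t ht).2.1
    obtain ⟨Y, hY, hYX⟩ := hl.exists_isTame hM.toIsPartitioning hX fun q hq => by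
      rw [← hT q hq]
      exact hv.velocity_mem_tangentBd hfr (hM'.container.bdry_subset hq) (hM'.container.smooth q hq)
    -- The phases of `Ω` and `Ω'` need not agree near `∂M`, so `X` is split into `Y`, to which the
    -- multiplier `l` of `Ω` applies, and `Z`, which vanishes on `∂M` and can be cut off there.
    set Z := X - Y with hZdef
    have hZ : ContDiff ℝ 1 Z := hX.sub hY.contDiff
    have hZ0 : ∀ x ∈ bdry M, Z x = 0 := fun x hx => by simp [hZdef, hYX x hx]
    have hcut : ∀ ε > 0, ∀ θ, IsCutoff (bdry M) ε θ → firstVar M N (fun x => θ x • Z x) =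
        l * ((∫ x in Ω₁', divergence (fun x => θ x • X x) x) -
          ∫ x in Ω₁, divergence (fun x => θ x • Y x) x) := by
      intro ε hε θ hθ
      have hK : IsCompact (M \ Metric.thickening (ε / 8) (bdry M)) :=
        hflat.isCompact.diff Metric.isOpen_thickening
      have hKs : M \ Metric.thickening (ε / 8) (bdry M) ⊆ Ω ∩ Ω' := fun x hx => by
        have : x ∈ M \ bdry M := ⟨hx.1, fun h => hx.2
          (Metric.self_subset_thickening (by positivity) _ h)⟩
        exact ⟨hM.container.interior_subset this, hM'.container.interior_subset this⟩
      -- The field `θ κ Z` has compact support in `Ω ∩ Ω'`, and `θ (1 - κ)` vanishes near `M`.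
      obtain ⟨κ, hκ, hκc, hκs, hκ1⟩ := exists_contDiff_eq_one hK
        (hM.container.isOpen.inter hM'.container.isOpen) hKs
        (hM.container.isBounded.subset inter_subset_left)
      have hnear : ∀ x ∈ M, θ =ᶠ[𝓝 x] (fun _ => 0) ∨ κ =ᶠ[𝓝 x] fun _ => 1 := fun x hx => by
        by_cases hxT : x ∈ Metric.thickening (ε / 8) (bdry M)
        · exact Or.inl (hθ.eventuallyEq_zero hxT)
        · exact Or.inr (hκ1 x ⟨hx, hxT⟩)
      have hf : ContDiff ℝ 1 fun x => θ x * κ x := hθ.contDiff.mul hκ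
      have hh : ContDiff ℝ 1 fun x => θ x * (1 - κ x) := hθ.contDiff.mul (contDiff_const.sub hκ)
      have hh0 : ∀ x ∈ M, (fun x => θ x * (1 - κ x)) =ᶠ[𝓝 x] fun _ => 0 := fun x hx => by
        rcases hnear x hx with h | h
        · filter_upwards [h] with y hy
          rw [hy, zero_mul]
        · filter_upwards [h] with y hy
          rw [hy, sub_self, mul_zero]
      have hfX : ContDiff ℝ 1 fun x => (θ x * κ x) • X x := hf.smul hX
      have hfY : ContDiff ℝ 1 fun x => (θ x * κ x) • Y x := hf.smul hY.contDiff
      have hfZ : ContDiff ℝ 1 fun x => (θ x * κ x) • Z x := hf.smul hZ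
      have hsup : ∀ W : RN (k + 2) → RN (k + 2),
          tsupport (fun x => (θ x * κ x) • W x) ⊆ tsupport κ := fun W =>
        closure_mono fun x hx h0 => hx (by simp [h0])
      have e1 : firstVar M N (fun x => θ x • Z x) = firstVar M N fun x => (θ x * κ x) • Z x := by
        refine firstVar_congr hflat.measurableSet fun x hx => ?_
        rcases hnear x hx with h | h
        · filter_upwards [h] with y hy
          simp [hy]
        · filter_upwards [h] with y hy
          simp [hy]
      have e2 := (hl.isBalanced hM.toIsPartitioning hfZ
        (HasCompactSupport.of_support_subset_isCompact hκc ((subset_tsupport _).trans (hsup Z)))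
        ((hsup Z).trans (hκs.trans inter_subset_left))).firstVar_eq
      have e3 : (fun x => (θ x * κ x) • Z x) =
          (fun x => (θ x * κ x) • X x) - fun x => (θ x * κ x) • Y x := by
        funext x
        simp only [hZdef, Pi.sub_apply, smul_sub]
      -- `f X` is supported in `Ω ∩ Ω'`, where the first phases coincide
      have e4 : ∫ x in Ω₁, divergence (fun x => (θ x * κ x) • X x) x =
          ∫ x in Ω₁', divergence (fun x => (θ x * κ x) • X x) x := by
        have hz : ∀ x ∉ tsupport κ, divergence (fun x => (θ x * κ x) • X x) x = 0 := fun x hx =>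
          divergence_eq_zero_of_eventuallyEq
            (notMem_tsupport_iff_eventuallyEq.1 fun h => hx (hsup X h))
        rw [setIntegral_eq_of_subset_of_forall_sdiff_eq_zero hM.isOpen₁.measurableSet
            (inter_subset_left : Ω₁ ∩ Ω' ⊆ Ω₁) fun x hx => hz x fun h => hx.2 ⟨hx.1, (hκs h).2⟩,
          setIntegral_eq_of_subset_of_forall_sdiff_eq_zero hM'.isOpen₁.measurableSet
            (inter_subset_left : Ω₁' ∩ Ω ⊆ Ω₁') fun x hx => hz x fun h => hx.2 ⟨hx.1, (hκs h).1⟩,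
          hphase]
      have hsplit : ∀ W : RN (k + 2) → RN (k + 2), (fun x => θ x • W x) =
          (fun x => (θ x * κ x) • W x) + fun x => (θ x * (1 - κ x)) • W x := fun W => by
        funext x
        simp only [Pi.add_apply]
        module
      have e5 : ∫ x in Ω₁', divergence (fun x => θ x • X x) x =
          ∫ x in Ω₁', divergence (fun x => (θ x * κ x) • X x) x := by
        have hhX : ContDiff ℝ 1 fun x => (θ x * (1 - κ x)) • X x := hh.smul hX
        rw [hsplit X, integral_divergence_add hM'.isBounded₁ hfX hhX,
          hM'.integral_divergence_mul_eq_zero hv hfr hh hh0, add_zero]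
      have e6 : ∫ x in Ω₁, divergence (fun x => θ x • Y x) x =
          ∫ x in Ω₁, divergence (fun x => (θ x * κ x) • Y x) x := by
        have hhY : ContDiff ℝ 1 fun x => (θ x * (1 - κ x)) • Y x := hh.smul hY.contDiff
        rw [hsplit Y, integral_divergence_add hM.isBounded₁ hfY hhY, hY.flux_eq_zero _ hh hh0,
          add_zero]
      rw [e1, e2, e3, integral_divergence_sub hM.isBounded₁ hfX hfY, e4, e5, e6]
    obtain ⟨C₁, h1⟩ := hflat.exists_firstVar_cutoff_le hM.hypersurface.isCompact_bdry hZ hZ0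
    obtain ⟨C₂, ε₂, hε₂, h2⟩ := hM.hypersurface.exists_flux_cutoff_le hX
      hM'.isOpen₁.measurableSet hM'.isBounded₁
    obtain ⟨C₃, ε₃, hε₃, h3⟩ := hM.hypersurface.exists_flux_cutoff_le hY.contDiff
      hM.isOpen₁.measurableSet hM.isBounded₁
    -- Let `ε → 0` in `hcut`.
    have hLZ : firstVar M N Z = l * ((∫ x in Ω₁', divergence X x) - ∫ x in Ω₁, divergence Y x) := by
      have ht0 : Tendsto (fun ε : ℝ => ε) (𝓝[>] 0) (𝓝 0) := tendsto_id.mono_left nhdsWithin_le_nhds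
      have ht : Tendsto (fun ε : ℝ => C₁ * (μHE[k + 1] : Measure (RN (k + 2))).real
          (M ∩ Metric.thickening ε (bdry M)) + |l| * (C₂ * ε + C₃ * ε)) (𝓝[>] 0) (𝓝 0) := by
        have := ((hflat.tendsto_area_thickening hM.hypersurface).const_mul C₁).add
          (((ht0.const_mul C₂).add (ht0.const_mul C₃)).const_mul |l|)
        simpa using this
      refine eq_of_abs_sub_le_tendsto ht ?_
      filter_upwards [Ioo_mem_nhdsGT (lt_min one_pos (lt_min hε₂ hε₃))] with ε hε
      obtain ⟨θ, hθ⟩ := exists_isCutoff (bdry M) hε.1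
      have b1 := h1 ε hε.1 (hε.2.trans_le (min_le_left _ _)) θ hθ
      have b2 := h2 ε hε.1 (hε.2.trans_le ((min_le_right _ _).trans (min_le_left _ _))) θ hθ
      have b3 := h3 ε hε.1 (hε.2.trans_le ((min_le_right _ _).trans (min_le_right _ _))) θ hθ
      rw [hcut ε hε.1 θ hθ] at b1
      set a := ∫ x in Ω₁', divergence (fun x => θ x • X x) x
      set b := ∫ x in Ω₁, divergence (fun x => θ x • Y x) x
      set a' := ∫ x in Ω₁', divergence X x
      set b' := ∫ x in Ω₁, divergence Y x
      have e : firstVar M N Z - l * (a' - b') =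
        -(l * (a - b) - firstVar M N Z) + l * ((a - a') - (b - b')) := by ring
      rw [e]
      refine (abs_add_le _ _).trans (add_le_add ?_ ?_)
      · rwa [abs_neg]
      · rw [abs_mul]
        exact mul_le_mul_of_nonneg_left ((abs_sub _ _).trans (add_le_add b2 b3)) (abs_nonneg _)
    have hLX : firstVar M N X = 0 := by
      have hXs : X = Y + Z := by simp [hZdef]
      rw [hXs, hflat.firstVar_add hY.contDiff hZ, hY.firstVar_eq, hLZ, hQ']
      ring
    have hA := hv.hasDerivAt_area hflat
    rw [← hXdef, hLX] at hA
    exact hA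

end

/-! ### Orthogonality of the hypersurface and the container -/

section

variable {M S : Set (RN (k + 2))} {p : RN (k + 2)} {N V Ψ : RN (k + 2) → RN (k + 2)} {K : ℝ≥0}
  {s : Set (RN (k + 2))}

/-- A direction `w` in the kernel of `du` that points into the side `v > 0` is a limit of
directions of secants of `M` from `p`, to which `N p` is orthogonal. -/
theorem IsBdryChart.inner_eq_zero_of_pos (h : IsBdryChart M p Ψ K s) (hN : IsFlatAlong M N)
    {w : RN (k + 2)} (hw : fderiv ℝ (fun y => Ψ y 0) p w = 0)
    (hv : 0 < fderiv ℝ (fun y => Ψ y 1) p w) : ⟪N p, w⟫ = 0 := by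
  set u := fun y => Ψ y 0 with hu
  set v := fun y => Ψ y 1 with hvdef
  have hpM : p ∈ M := (h.mem_iff p h.mem).2 (by simp [h.apply_eq])
  have hline : HasDerivAt (fun t : ℝ => p + t • w) w 0 := by
    simpa using ((hasDerivAt_id (0 : ℝ)).smul_const w).const_add p
  have hp0 : p + (0 : ℝ) • w = p := by simp
  have hu' : HasDerivAt (fun t : ℝ => u (p + t • w)) 0 0 := by
    have h1 : HasFDerivAt u (fderiv ℝ u p) (p + (0 : ℝ) • w) := by
      rw [hp0]; exact ((h.contDiffAt p h.mem).1.differentiableAt (by simp)).hasFDerivAt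
    have h2 := h1.comp_hasDerivAt (0 : ℝ) hline
    rwa [hw] at h2
  have hv' : HasDerivAt (fun t : ℝ => v (p + t • w)) (fderiv ℝ v p w) 0 := by
    have h1 : HasFDerivAt v (fderiv ℝ v p) (p + (0 : ℝ) • w) := by
      rw [hp0]; exact ((h.contDiffAt p h.mem).2.differentiableAt (by simp)).hasFDerivAt
    exact h1.comp_hasDerivAt (0 : ℝ) hline
  have hup : u p = 0 := by simp [hu, h.apply_eq]
  have hvp : v p = 0 := by simp [hvdef, h.apply_eq]
  have hlt : Tendsto (fun t : ℝ => p + t • w) (𝓝 0) (𝓝 p) := by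
    have := hline.continuousAt.tendsto
    rwa [hp0] at this
  have hΨ : Tendsto Ψ (𝓝 p) (𝓝 0) := h.map_nhds.le
  have key : ∀ ε > 0, ε ≤ 1 → |⟪N p, w⟫| ≤ ε * (‖w‖ + 2 * K) := by
    intro ε hε hε1
    obtain ⟨U, hU, hflat⟩ := hN.flat p hpM ε hε
    have hev1 : ∀ᶠ t in 𝓝[>] (0 : ℝ), |u (p + t • w)| ≤ ε * t := by
      have := hu'.isLittleO.def hε
      filter_upwards [nhdsWithin_le_nhds this, self_mem_nhdsWithin] with t ht ht0
      have ht0' : 0 < t := ht0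
      simpa [hup, abs_of_pos ht0'] using ht
    have hev2 : ∀ᶠ t in 𝓝[>] (0 : ℝ), 0 ≤ v (p + t • w) := by
      have := hv'.isLittleO.def hv
      filter_upwards [nhdsWithin_le_nhds this, self_mem_nhdsWithin] with t ht ht0
      have ht0' : 0 < t := ht0
      simp only [hvp, sub_zero, zero_smul, add_zero, smul_eq_mul, Real.norm_eq_abs,
        abs_of_pos ht0'] at ht
      have := (abs_le.1 ht).1
      nlinarith
    have hev3 : ∀ᶠ t in 𝓝[>] (0 : ℝ), p + t • w ∈ s :=
      nhdsWithin_le_nhds (hlt.eventually (h.isOpen.mem_nhds h.mem))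
    have hev4 : ∀ᶠ t in 𝓝[>] (0 : ℝ),
        Ψ (p + t • w) - u (p + t • w) • EuclideanSpace.single 0 1 ∈ Ψ '' (s ∩ U) := by
      have h1 : Ψ '' (s ∩ U) ∈ 𝓝 (0 : RN (k + 2)) := by
        rw [← h.map_nhds]
        exact image_mem_map (inter_mem (h.isOpen.mem_nhds h.mem) hU)
      have h2 : Tendsto (fun t : ℝ => u (p + t • w)) (𝓝 0) (𝓝 0) := by
        have := hu'.continuousAt.tendsto
        rwa [hp0, hup] at this
      have h3 : Tendsto (fun t : ℝ => Ψ (p + t • w) -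
          u (p + t • w) • (EuclideanSpace.single 0 1 : RN (k + 2))) (𝓝 0) (𝓝 0) := by
        simpa using (hΨ.comp hlt).sub (h2.smul_const (EuclideanSpace.single 0 1 : RN (k + 2)))
      exact nhdsWithin_le_nhds (h3.eventually h1)
    -- The point `y` of `M` has the coordinates of `p + t w`, except that its first one is zero;
    -- its distance to `p + t w` is `o(t)`.
    obtain ⟨t, ht1, ht2, ht3, ⟨y, ⟨hys, hyU⟩, hy⟩, ht0⟩ :=
      (hev1.and (hev2.and (hev3.and (hev4.and self_mem_nhdsWithin)))).exists
    replace ht0 : 0 < t := ht0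
    have hyM : y ∈ M := by
      refine (h.mem_iff y hys).2 ⟨?_, ?_⟩
      · rw [hy]; simp [hu]
      · rw [hy]
        simpa [hvdef] using ht2
    have hd : ‖y - (p + t • w)‖ ≤ K * (ε * t) := by
      rw [← dist_eq_norm]
      refine (h.antilip y hys _ ht3).trans (mul_le_mul_of_nonneg_left ?_ K.2)
      rw [hy, dist_eq_norm]
      simpa [norm_smul] using ht1
    have h5 := hflat y ⟨hyM, hyU⟩ p ⟨hpM, mem_of_mem_nhds hU⟩
    have h6 : ‖y - p‖ ≤ t * ‖w‖ + K * (ε * t) := by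
      have e : y - p = t • w + (y - (p + t • w)) := by abel
      rw [e]
      refine (norm_add_le _ _).trans (add_le_add ?_ hd)
      rw [norm_smul, Real.norm_of_nonneg ht0.le]
    have h7 : |⟪N p, y - (p + t • w)⟫| ≤ K * (ε * t) := by
      refine (abs_real_inner_le_norm _ _).trans ?_
      rwa [hN.norm_eq p hpM, one_mul]
    have e : t * ⟪N p, w⟫ = ⟪N p, y - p⟫ - ⟪N p, y - (p + t • w)⟫ := by
      rw [← inner_sub_right, ← real_inner_smul_right]
      congr 1
      abel
    have h8 : t * |⟪N p, w⟫| ≤ t * (ε * (‖w‖ + 2 * K)) := by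
      rw [← abs_of_pos ht0, ← abs_mul, abs_of_pos ht0, e]
      refine (abs_sub _ _).trans ((add_le_add (h5.trans
        (mul_le_mul_of_nonneg_left h6 hε.le)) h7).trans ?_)
      have : ε * (K * (ε * t)) ≤ 1 * (K * (ε * t)) :=
        mul_le_mul_of_nonneg_right hε1 (by positivity)
      nlinarith
    exact le_of_mul_le_mul_left h8 ht0
  have hlim : Tendsto (fun ε : ℝ => ε * (‖w‖ + 2 * K)) (𝓝[>] 0) (𝓝 0) := by
    have : Tendsto (fun ε : ℝ => ε) (𝓝[>] 0) (𝓝 0) := tendsto_id.mono_left nhdsWithin_le_nhds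
    simpa using this.mul_const (‖w‖ + 2 * K)
  have h0 : |⟪N p, w⟫| ≤ 0 := ge_of_tendsto hlim (by
    filter_upwards [Ioc_mem_nhdsGT one_pos] with ε hε using key ε hε.1 hε.2)
  exact abs_eq_zero.1 (le_antisymm h0 (abs_nonneg _))

/-- The normal vector is orthogonal to the kernel of `du` for the equation `u` of `M` in a
chart. -/
theorem IsBdryChart.inner_eq_zero_of_mem_ker (h : IsBdryChart M p Ψ K s) (hN : IsFlatAlong M N)
    {w : RN (k + 2)} (hw : fderiv ℝ (fun y => Ψ y 0) p w = 0) : ⟪N p, w⟫ = 0 := by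
  obtain ⟨T, hT⟩ := exists_linearEquiv_of_linearIndependent h.linearIndependent
  -- Adding a multiple of `w₀`, on which `dv = 1`, moves `w` to the side `v > 0`.
  set w₀ := T.symm (EuclideanSpace.single 1 1) with hw₀
  have h0 : fderiv ℝ (fun y => Ψ y 0) p w₀ = 0 := by
    rw [← (hT w₀).1, hw₀]; simp
  have h1 : fderiv ℝ (fun y => Ψ y 1) p w₀ = 1 := by
    rw [← (hT w₀).2, hw₀]; simp
  set c := |fderiv ℝ (fun y => Ψ y 1) p w| + 1
  have a1 := h.inner_eq_zero_of_pos hN h0 (by rw [h1]; exact one_pos)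
  have a2 := h.inner_eq_zero_of_pos hN (w := w + c • w₀) (by simp [hw, h0]) (by
    rw [map_add, map_smul, h1, smul_eq_mul, mul_one]
    have := neg_abs_le (fderiv ℝ (fun y => Ψ y 1) p w)
    simp only [c]
    linarith)
  rw [inner_add_right, inner_smul_right, a1, mul_zero, add_zero] at a2
  exact a2

/-- In a chart at a boundary point, `dv` does not vanish on the tangent space of `M`. -/
theorem IsBdryChart.exists_inner_eq_zero (h : IsBdryChart M p Ψ K s) (hN : IsFlatAlong M N) :
    ∃ x, ⟪N p, x⟫ = 0 ∧ fderiv ℝ (fun y => Ψ y 1) p x ≠ 0 := by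
  obtain ⟨T, hT⟩ := exists_linearEquiv_of_linearIndependent h.linearIndependent
  refine ⟨T.symm (EuclideanSpace.single 1 1), h.inner_eq_zero_of_mem_ker hN ?_, ?_⟩
  · rw [← (hT _).1]; simp
  · rw [← (hT _).2]; simp

/-- The function `max(0, t)²` serves as a cut-off of class `C¹` with explicit derivative. -/
theorem hasDerivAt_max_sq (t : ℝ) : HasDerivAt (fun t : ℝ => max 0 t ^ 2) (2 * max 0 t) t := by
  rcases lt_trichotomy t 0 with ht | rfl | ht
  · rw [max_eq_left ht.le, mul_zero]
    refine (hasDerivAt_const t (0 : ℝ)).congr_of_eventuallyEq ?_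
    filter_upwards [Iio_mem_nhds ht] with x hx
    rw [max_eq_left (le_of_lt hx)]
    norm_num
  · rw [hasDerivAt_iff_isLittleO]
    have h1 : (fun t : ℝ => t ^ 2) =o[𝓝 0] fun t : ℝ => t := by
      simpa using Asymptotics.isLittleO_pow_pow (𝕜 := ℝ) one_lt_two
    refine (Asymptotics.IsBigO.of_bound 1 (Eventually.of_forall fun x => ?_)).trans_isLittleO
      (h1.congr_right fun x => (sub_zero x).symm)
    have h2 : |max 0 x| ≤ |x| := by
      rw [abs_of_nonneg (le_max_left _ _)]
      exact max_le (abs_nonneg _) (le_abs_self _)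
    have h3 : max 0 x ^ 2 ≤ x ^ 2 := sq_le_sq.2 h2
    simpa [abs_of_nonneg, sq_nonneg] using h3
  · rw [max_eq_right ht.le]
    have h1 : HasDerivAt (fun t : ℝ => t ^ 2) (2 * t) t := by simpa using hasDerivAt_pow 2 t
    refine h1.congr_of_eventuallyEq ?_
    filter_upwards [Ioi_mem_nhds ht] with x hx
    rw [max_eq_right (le_of_lt hx)]

theorem contDiff_max_sq : ContDiff ℝ 1 fun t : ℝ => max 0 t ^ 2 := by
  rw [contDiff_one_iff_deriv]
  refine ⟨fun t => (hasDerivAt_max_sq t).differentiableAt, ?_⟩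
  have : deriv (fun t : ℝ => max 0 t ^ 2) = fun t => 2 * max 0 t :=
    funext fun t => (hasDerivAt_max_sq t).deriv
  rw [this]
  fun_prop

/-- The profile of a cut-off function at the corner `u = v = 0`, at scale `ε`. -/
def cornerProfile (u v : RN (k + 2) → ℝ) (ε : ℝ) (x : RN (k + 2)) : ℝ :=
  max 0 (1 - (u x ^ 2 + v x ^ 2) / ε ^ 2)

theorem cornerProfile_nonneg (u v : RN (k + 2) → ℝ) (ε : ℝ) (x : RN (k + 2)) :
    0 ≤ cornerProfile u v ε x := le_max_left _ _

theorem cornerProfile_le_one (u v : RN (k + 2) → ℝ) (ε : ℝ) (x : RN (k + 2)) :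
    cornerProfile u v ε x ≤ 1 :=
  max_le zero_le_one (by
    have : 0 ≤ (u x ^ 2 + v x ^ 2) / ε ^ 2 := by positivity
    linarith)

theorem cornerProfile_eq_zero {u v : RN (k + 2) → ℝ} {ε : ℝ} (hε : 0 < ε) {x : RN (k + 2)}
    (h : ¬ (|u x| ≤ ε ∧ |v x| ≤ ε)) : cornerProfile u v ε x = 0 := by
  refine max_eq_left ?_
  rw [sub_nonpos, le_div_iff₀ (by positivity), one_mul]
  by_cases hu : |u x| ≤ ε
  · have hv : ε < |v x| := not_le.1 fun h' => h ⟨hu, h'⟩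
    nlinarith [sq_abs (v x), sq_nonneg (u x)]
  · nlinarith [sq_abs (u x), sq_nonneg (v x), not_le.1 hu]

variable {u v b : RN (k + 2) → ℝ}

theorem contDiff_cornerCutoff (hu : ∀ x ∈ s, ContDiffAt ℝ 1 u x)
    (hv : ∀ x ∈ s, ContDiffAt ℝ 1 v x) (hb : ContDiff ℝ 1 b) (hbs : tsupport b ⊆ s) (ε : ℝ) :
    ContDiff ℝ 1 fun x => b x * cornerProfile u v ε x ^ 2 := by
  rw [contDiff_iff_contDiffAt]
  intro x
  by_cases hx : x ∈ tsupport b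
  · have h1 : ContDiffAt ℝ 1 (fun x => 1 - (u x ^ 2 + v x ^ 2) / ε ^ 2) x :=
      contDiffAt_const.sub ((((hu x (hbs hx)).pow 2).add ((hv x (hbs hx)).pow 2)).div_const _)
    exact hb.contDiffAt.mul (contDiff_max_sq.contDiffAt.comp x h1)
  · refine (contDiffAt_const (c := (0 : ℝ))).congr_of_eventuallyEq ?_
    filter_upwards [notMem_tsupport_iff_eventuallyEq.1 hx] with y hy
    rw [hy]
    simp

theorem fderiv_cornerCutoff (hu : ∀ x ∈ s, ContDiffAt ℝ 1 u x)
    (hv : ∀ x ∈ s, ContDiffAt ℝ 1 v x) (hb : ContDiff ℝ 1 b) (hbs : tsupport b ⊆ s) (ε : ℝ)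
    (x w : RN (k + 2)) : fderiv ℝ (fun x => b x * cornerProfile u v ε x ^ 2) x w =
      cornerProfile u v ε x ^ 2 * fderiv ℝ b x w - b x * (4 * cornerProfile u v ε x *
        ((u x * fderiv ℝ u x w + v x * fderiv ℝ v x w) / ε ^ 2)) := by
  by_cases hx : x ∈ tsupport b
  · have hu' := ((hu x (hbs hx)).differentiableAt (by simp)).hasFDerivAt
    have hv' := ((hv x (hbs hx)).differentiableAt (by simp)).hasFDerivAt
    have hb' := (hb.differentiable (by simp) x).hasFDerivAt
    have h1 := (((hu'.pow 2).add (hv'.pow 2)).mul_const (ε ^ 2)⁻¹).const_sub 1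
    have h2 := (hasDerivAt_max_sq (1 - (u x ^ 2 + v x ^ 2) * (ε ^ 2)⁻¹)).comp_hasFDerivAt x h1
    have h3 : HasFDerivAt (fun x => b x * cornerProfile u v ε x ^ 2) _ x := hb'.mul h2
    rw [h3.fderiv]
    simp only [cornerProfile, div_eq_mul_inv]
    simp
    ring
  · have h0 := notMem_tsupport_iff_eventuallyEq.1 hx
    have h1 : (fun x => b x * cornerProfile u v ε x ^ 2) =ᶠ[𝓝 x] fun _ => 0 := by
      filter_upwards [h0] with y hy
      rw [hy]; simp
    rw [h1.fderiv_eq, h0.fderiv_eq, h0.eq_of_nhds]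
    simp

end

section

variable {M S : Set (RN (k + 2))} {p : RN (k + 2)} {N V Ψ : RN (k + 2) → RN (k + 2)} {K : ℝ≥0}
  {s : Set (RN (k + 2))} {b : RN (k + 2) → ℝ}

/-- The flux of a field that is cut off at distance `ε` from the corner is `O(ε)`: its divergence is
`O(1/ε)`, on a set of volume `O(ε²)`. -/
theorem IsBdryChart.exists_flux_corner_le (h : IsBdryChart M p Ψ K s)
    (hS : MeasurableSet S) (hV : ContDiff ℝ 1 V) (hb : ContDiff ℝ 1 b)
    (hbc : HasCompactSupport b) (hbs : tsupport b ⊆ s) (hbp : tsupport b ⊆ Metric.ball p 1)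
    (hb1 : ∀ x, |b x| ≤ 1) :
    ∃ C : ℝ, ∀ ε > 0, ε ≤ 1 → |∫ x in S, divergence (fun x =>
      (b x * cornerProfile (fun y => Ψ y 0) (fun y => Ψ y 1) ε x ^ 2) • V x) x| ≤ C * ε := by
  obtain ⟨C, hC, hvol⟩ := h.exists_volume_le
  have hu : ∀ x ∈ s, ContDiffAt ℝ 1 (fun y => Ψ y 0) x := fun x hx =>
    (h.contDiffAt x hx).1.of_le (by norm_num)
  have hv : ∀ x ∈ s, ContDiffAt ℝ 1 (fun y => Ψ y 1) x := fun x hx =>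
    (h.contDiffAt x hx).2.of_le (by norm_num)
  set u := fun y => Ψ y 0
  set v := fun y => Ψ y 1
  have hcu : ∀ w : RN (k + 2) → ℝ, (∀ x ∈ s, ContDiffAt ℝ 1 w x) →
      ContinuousOn (fun x => fderiv ℝ w x (V x)) (tsupport b) := fun w hw x hx =>
    ((((hw x (hbs hx)).fderiv_right (m := 0) (by norm_num)).continuousAt).clm_apply
      hV.continuous.continuousAt).continuousWithinAt
  obtain ⟨B₂, hB₂⟩ := hbc.isCompact.exists_bound_of_continuousOn
    (continuous_divergence (hb.smul hV)).continuousOn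
  obtain ⟨B₃, hB₃⟩ := hbc.isCompact.exists_bound_of_continuousOn (hcu u hu)
  obtain ⟨B₄, hB₄⟩ := hbc.isCompact.exists_bound_of_continuousOn (hcu v hv)
  refine ⟨(|B₂| + 4 * (|B₃| + |B₄|)) * C, fun ε hε hε1 => ?_⟩
  set f := cornerProfile u v ε with hf
  have hbu : ContinuousOn u (tsupport b) := fun x hx => (hu x (hbs hx)).continuousAt.continuousWithinAt
  have hbv : ContinuousOn v (tsupport b) := fun x hx => (hv x (hbs hx)).continuousAt.continuousWithinAt
  set P := tsupport b ∩ {x | |u x| ≤ ε ∧ |v x| ≤ ε} with hP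
  have hPc : IsClosed P :=
    (hbu.abs.prodMk hbv.abs).preimage_isClosed_of_isClosed (isClosed_tsupport b)
      (isClosed_Iic (a := ((ε, ε) : ℝ × ℝ)))
  have hβ := contDiff_cornerCutoff hu hv hb hbs ε
  have hdiv : ∀ x, divergence (fun x => (b x * f x ^ 2) • V x) x =
      f x ^ 2 * divergence (fun x => b x • V x) x - b x * (4 * f x *
        ((u x * fderiv ℝ u x (V x) + v x * fderiv ℝ v x (V x)) / ε ^ 2)) := fun x => by
    rw [divergence_mulField hβ hV, divergence_mulField hb hV,
      fderiv_cornerCutoff hu hv hb hbs ε x]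
    ring
  have hzero : ∀ x ∉ P, divergence (fun x => (b x * f x ^ 2) • V x) x = 0 := fun x hx => by
    by_cases hxb : x ∈ tsupport b
    · have : f x = 0 := cornerProfile_eq_zero hε fun h' => hx ⟨hxb, h'⟩
      rw [hdiv, this]; ring
    · refine divergence_eq_zero_of_eventuallyEq ?_
      filter_upwards [notMem_tsupport_iff_eventuallyEq.1 hxb] with y hy
      rw [hy]; simp
  have hf0 := cornerProfile_nonneg u v ε
  have hf1 := cornerProfile_le_one u v ε
  have hle : ∀ x ∈ P, |divergence (fun x => (b x * f x ^ 2) • V x) x| ≤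
      (|B₂| + 4 * (|B₃| + |B₄|)) / ε := by
    rintro x ⟨hx, hxu, hxv⟩
    rw [hdiv]
    have a2 := (hB₂ x hx).trans (le_abs_self _)
    have a3 := (hB₃ x hx).trans (le_abs_self _)
    have a4 := (hB₄ x hx).trans (le_abs_self _)
    rw [Real.norm_eq_abs] at a2 a3 a4
    have hfx : |f x| ≤ 1 := by rw [abs_of_nonneg (hf0 x)]; exact hf1 x
    have c1 : |f x ^ 2 * divergence (fun x => b x • V x) x| ≤ |B₂| := by
      rw [abs_mul, abs_pow]
      calc _ ≤ 1 * |B₂| := mul_le_mul (pow_le_one₀ (abs_nonneg _) hfx) a2 (abs_nonneg _) zero_le_one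
        _ = |B₂| := one_mul _
    have c2 : |u x * fderiv ℝ u x (V x) + v x * fderiv ℝ v x (V x)| ≤ ε * (|B₃| + |B₄|) := by
      refine (abs_add_le _ _).trans ?_
      rw [abs_mul, abs_mul, mul_add]
      exact add_le_add (mul_le_mul hxu a3 (abs_nonneg _) hε.le)
        (mul_le_mul hxv a4 (abs_nonneg _) hε.le)
    have c3 : |b x * (4 * f x * ((u x * fderiv ℝ u x (V x) + v x * fderiv ℝ v x (V x)) / ε ^ 2))| ≤
        4 * (|B₃| + |B₄|) / ε := by
      rw [abs_mul, abs_mul, abs_mul, abs_div, abs_of_pos (show (0 : ℝ) < 4 by norm_num),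
        abs_of_pos (show (0 : ℝ) < ε ^ 2 by positivity)]
      calc _ ≤ 1 * (4 * 1 * (ε * (|B₃| + |B₄|) / ε ^ 2)) := by
            refine mul_le_mul (hb1 x) ?_ (by positivity) zero_le_one
            refine mul_le_mul (by linarith) ?_ (by positivity) (by norm_num)
            gcongr
        _ = 4 * (|B₃| + |B₄|) / ε := by field_simp
    refine (abs_sub _ _).trans ((add_le_add c1 c3).trans ?_)
    rw [add_div]
    refine add_le_add ?_ le_rfl
    rw [le_div_iff₀ hε]
    exact mul_le_of_le_one_right (abs_nonneg _) hε1
  rw [← Real.norm_eq_abs, setIntegral_eq_of_subset_of_forall_sdiff_eq_zero hS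
    (inter_subset_left : S ∩ P ⊆ S) fun x hx => hzero x fun h' => hx.2 ⟨hx.1, h'⟩]
  have hvolP : volume P ≤ ENNReal.ofReal (C * ε ^ 2) :=
    (measure_mono (t := {x ∈ s ∩ Metric.ball p 1 | |u x| ≤ ε ∧ |v x| ≤ ε})
      fun x hx => ⟨⟨hbs hx.1, hbp hx.1⟩, hx.2⟩).trans (hvol ε hε)
  have hvolSP : volume (S ∩ P) ≤ ENNReal.ofReal (C * ε ^ 2) :=
    (measure_mono inter_subset_right).trans hvolP
  refine (norm_setIntegral_le_of_norm_le_const (hvolSP.trans_lt ENNReal.ofReal_lt_top)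
    fun x hx => hle x hx.2).trans ?_
  calc _ ≤ (|B₂| + 4 * (|B₃| + |B₄|)) / ε * (C * ε ^ 2) := by
        refine mul_le_mul_of_nonneg_left ?_ (by positivity)
        exact ENNReal.toReal_le_of_le_ofReal (by positivity) hvolSP
    _ = _ := by field_simp

/-- The area of the strip `v ≤ ε` of `M` is small, as `∂M` has area zero. -/
theorem IsBdryChart.tendsto_area_strip (h : IsBdryChart M p Ψ K s) (hM : IsHypersurface M)
    (hN : IsFlatAlong M N) {T : Set (RN (k + 2))} (hT : IsClosed T) (hTs : T ⊆ s) :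
    Tendsto (fun ε => (μHE[k + 1] : Measure (RN (k + 2))).real (M ∩ (T ∩ {x | Ψ x 1 ≤ ε})))
      (𝓝[>] 0) (𝓝 0) := by
  have hcl : ∀ ε, IsClosed (T ∩ {x | Ψ x 1 ≤ ε}) := fun ε =>
    ContinuousOn.preimage_isClosed_of_isClosed (f := fun x => Ψ x 1)
      (fun x hx => (h.contDiffAt x (hTs hx)).2.continuousAt.continuousWithinAt) hT isClosed_Iic
  have h1 := tendsto_measure_biInter_gt (μ := (μHE[k + 1] : Measure (RN (k + 2)))) (a := (0 : ℝ))
    (s := fun ε => M ∩ (T ∩ {x | Ψ x 1 ≤ ε}))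
    (fun ε _ => (hN.measurableSet.inter (hcl ε).measurableSet).nullMeasurableSet)
    (fun i j _ hij => inter_subset_inter_right _ (inter_subset_inter_right _ fun x hx =>
      le_trans hx hij))
    ⟨1, one_pos, ((measure_mono inter_subset_left).trans_lt hN.area_lt_top).ne⟩
  have h2 : (μHE[k + 1] : Measure (RN (k + 2)))
      (⋂ r : ℝ, ⋂ (_ : r > 0), M ∩ (T ∩ {x | Ψ x 1 ≤ r})) = 0 := by
    refine measure_mono_null (fun x hx => ?_) hM.area_bdry_eq_zero
    simp only [mem_iInter] at hx
    have h1 := hx 1 one_pos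
    have h3 := (h.mem_iff x (hTs h1.2.1)).1 h1.1
    refine (h.mem_bdry_iff x (hTs h1.2.1)).2 ⟨h3.1, le_antisymm ?_ h3.2⟩
    exact le_of_forall_gt_imp_ge_of_dense fun r hr => (hx r hr).2.2
  rw [h2] at h1
  exact (ENNReal.tendsto_toReal ENNReal.zero_ne_top).comp h1

/-- If area and volume are balanced for the multiples of the field `V` near the boundary point
`p`, then the tangential part of `V` at `p` is tangent to `∂M`. Otherwise, for a cut-off at distance
`ε` from `∂M`, the first variation of area is bounded below, whereas that of volume is `O(ε)`. -/
theorem IsBdryChart.fderiv_tangential_eq_zero (h : IsBdryChart M p Ψ K s) (hM : IsHypersurface M)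
    (hN : IsFlatAlong M N) (hS : MeasurableSet S) (hV : ContDiff ℝ 1 V) {l r : ℝ} (hr : 0 < r)
    (hbal : ∀ β : RN (k + 2) → ℝ, ContDiff ℝ 1 β → tsupport β ⊆ Metric.ball p r →
      firstVar M N (fun x => β x • V x) = l * ∫ x in S, divergence (fun x => β x • V x) x) :
    fderiv ℝ (fun y => Ψ y 1) p (V p - ⟪V p, N p⟫ • N p) = 0 := by
  have hu : ∀ x ∈ s, ContDiffAt ℝ 1 (fun y => Ψ y 0) x := fun x hx =>
    (h.contDiffAt x hx).1.of_le (by norm_num)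
  have hv : ∀ x ∈ s, ContDiffAt ℝ 1 (fun y => Ψ y 1) x := fun x hx =>
    (h.contDiffAt x hx).2.of_le (by norm_num)
  have hpM : p ∈ M := (h.mem_iff p h.mem).2 (by simp [h.apply_eq])
  set u := fun y => Ψ y 0
  set v := fun y => Ψ y 1
  set F : RN (k + 2) → ℝ := fun x => fderiv ℝ v x (V x - ⟪V x, N x⟫ • N x) with hF
  by_contra hτ
  change F p ≠ 0 at hτ
  set τ := F p with hτdef
  have hτ2 : 0 < τ ^ 2 := by positivity
  have hFc : ContinuousWithinAt F M p := by
    have h1 : ContinuousWithinAt (fderiv ℝ v) M p :=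
      ((hv p h.mem).fderiv_right (m := 0) (by norm_num)).continuousAt.continuousWithinAt
    have h2 := hN.continuousOn p hpM
    have h3 := hV.continuous.continuousAt.continuousWithinAt (s := M) (x := p)
    have h4 : ContinuousWithinAt (fun x => ⟪V x, N x⟫) M p := h3.inner h2
    have h5 : ContinuousWithinAt (fun x => ⟪V x, N x⟫ • N x) M p := h4.smul h2
    exact h1.clm_apply (h3.sub h5)
  have hFev : ∀ᶠ x in 𝓝 p, x ∈ M → τ ^ 2 / 2 ≤ τ * F x := by
    have h1 : ContinuousWithinAt (fun x => τ * F x) M p := continuousWithinAt_const.mul hFc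
    refine eventually_nhdsWithin_iff.1 (h1.eventually (Ici_mem_nhds ?_))
    change τ ^ 2 / 2 < τ * τ
    nlinarith
  obtain ⟨R, hR, hRs⟩ := Metric.nhds_basis_closedBall.mem_iff.1
    (inter_mem (inter_mem (h.isOpen.mem_nhds h.mem) (Metric.ball_mem_nhds p one_pos))
      (inter_mem (Metric.ball_mem_nhds p hr) hFev))
  let b : ContDiffBump p := ⟨R / 2, R, by positivity, by linarith⟩
  have hb : ContDiff ℝ 1 b := b.contDiff
  have hbt : tsupport b = Metric.closedBall p R := b.tsupport_eq
  have hbs : tsupport b ⊆ s := by rw [hbt]; exact fun x hx => (hRs hx).1.1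
  have hbp : tsupport b ⊆ Metric.ball p 1 := by rw [hbt]; exact fun x hx => (hRs hx).1.2
  have hbr : tsupport b ⊆ Metric.ball p r := by rw [hbt]; exact fun x hx => (hRs hx).2.1
  have hbF : ∀ x ∈ tsupport b, x ∈ M → τ ^ 2 / 2 ≤ τ * F x := by
    rw [hbt]; exact fun x hx => (hRs hx).2.2
  obtain ⟨C, hC⟩ := h.exists_flux_corner_le hS hV hb b.hasCompactSupport hbs hbp
    fun x => by rw [abs_of_nonneg b.nonneg]; exact b.le_one
  obtain ⟨c, hc, r₀, hr₀, hstrip⟩ :=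
    h.exists_le_measure_strip (Metric.closedBall_mem_nhds p (half_pos hR))
  obtain ⟨B, hB⟩ := hN.isCompact.exists_bound_of_continuousOn (hN.continuousOn_tanTrace (hb.smul hV))
  -- With `τ F ≥ τ² / 2` near `p`, the derivative of the cut-off contributes at least `κ / ε` to
  -- `-τ` times the tangential divergence where `ε / 4 ≤ v ≤ ε / 2`, which is a strip of area at
  -- least `c ε / 4`; its other contributions have the same sign. The remaining terms are bounded,
  -- and supported in the strip `v ≤ ε`.
  set κ := 3 * τ ^ 2 / 8 with hκ
  -- the estimate of the first variation from below
  have key : ∀ ε > 0, ε ≤ 1 → ε ≤ r₀ → κ * c / 4 ≤ |τ| * |B| *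
      (μHE[k + 1] : Measure (RN (k + 2))).real (M ∩ (tsupport b ∩ {x | Ψ x 1 ≤ ε})) +
        |τ| * (|l| * (C * ε)) := by
    intro ε hε hε1 hεr
    set f := cornerProfile u v ε with hf
    have hβ := contDiff_cornerCutoff hu hv hb hbs ε
    have hβs : tsupport (fun x => b x * f x ^ 2) ⊆ tsupport b := tsupport_mul_subset_left
    have hbal' := hbal _ hβ (hβs.trans hbr)
    have hA : ∀ x, tanTrace (fderiv ℝ (fun x => (b x * f x ^ 2) • V x) x) (N x) =
        f x ^ 2 * tanTrace (fderiv ℝ (fun x => b x • V x) x) (N x) - b x * (4 * f x *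
          ((u x * fderiv ℝ u x (V x - ⟪V x, N x⟫ • N x) + v x * F x) / ε ^ 2)) := fun x => by
      rw [tanTrace_mulField hβ hV, tanTrace_mulField hb hV, fderiv_cornerCutoff hu hv hb hbs ε x]
      ring
    set St := M ∩ (Metric.closedBall p (R / 2) ∩ {x | v x ∈ Icc (ε / 4) (ε / 2)}) with hSt
    set T := M ∩ (tsupport b ∩ {x | Ψ x 1 ≤ ε}) with hTdef
    have hvc : ContinuousOn v (tsupport b) := fun x hx =>
      (hv x (hbs hx)).continuousAt.continuousWithinAt
    have hballb : Metric.closedBall p (R / 2) ⊆ tsupport b := by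
      rw [hbt]; exact Metric.closedBall_subset_closedBall (by linarith)
    have hStm : MeasurableSet St := hN.measurableSet.inter
      ((hvc.mono hballb).preimage_isClosed_of_isClosed Metric.isClosed_closedBall
        isClosed_Icc).measurableSet
    have hTm : MeasurableSet T := hN.measurableSet.inter
      (hvc.preimage_isClosed_of_isClosed (isClosed_tsupport _) isClosed_Iic).measurableSet
    have hpt : ∀ x ∈ M, St.indicator (fun _ => κ / ε) x - T.indicator (fun _ => |τ| * |B|) x ≤
        -τ * tanTrace (fderiv ℝ (fun x => (b x * f x ^ 2) • V x) x) (N x) := by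
      intro x hx
      by_cases hxb : x ∈ tsupport b
      · obtain ⟨hux, hvx⟩ := (h.mem_iff x (hbs hxb)).1 hx
        change u x = 0 at hux
        change 0 ≤ v x at hvx
        have hf0 : 0 ≤ f x := cornerProfile_nonneg u v ε x
        have hf1 : f x ≤ 1 := cornerProfile_le_one u v ε x
        have hFx := hbF x hxb hx
        rw [hA, hux]
        by_cases hvε : v x ≤ ε
        · have hxT : x ∈ T := ⟨hx, hxb, hvε⟩
          rw [indicator_of_mem hxT]
          have a1 : τ * (f x ^ 2 * tanTrace (fderiv ℝ (fun x => b x • V x) x) (N x)) ≤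
              |τ| * |B| := by
            refine (le_abs_self _).trans ?_
            rw [abs_mul, abs_mul]
            refine mul_le_mul_of_nonneg_left ?_ (abs_nonneg _)
            calc _ ≤ 1 * |B| := by
                  refine mul_le_mul ?_ ((hB x hx).trans (le_abs_self _)) (abs_nonneg _) zero_le_one
                  rw [abs_of_nonneg (by positivity)]
                  exact pow_le_one₀ hf0 hf1
              _ = |B| := one_mul _
          have a2 : St.indicator (fun _ => κ / ε) x ≤
              b x * (4 * f x * (v x * (τ * F x) / ε ^ 2)) := by
            by_cases hxS : x ∈ St
            · rw [indicator_of_mem hxS]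
              have hbx : b x = 1 := b.one_of_mem_closedBall hxS.2.1
              obtain ⟨hv1, hv2⟩ := hxS.2.2
              have hfx : 3 / 4 ≤ f x := by
                refine le_trans ?_ (le_max_right _ _)
                rw [hux]
                have : (0 ^ 2 + v x ^ 2) / ε ^ 2 ≤ 1 / 4 := by
                  rw [div_le_iff₀ (by positivity)]
                  nlinarith
                linarith
              rw [hbx, one_mul]
              calc κ / ε = 4 * (3 / 4) * ((ε / 4) * (τ ^ 2 / 2) / ε ^ 2) := by
                    rw [hκ]; field_simp; norm_num
                _ ≤ _ := by gcongr
            · rw [indicator_of_notMem hxS]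
              have : 0 ≤ τ * F x := by linarith
              have hb0 : 0 ≤ b x := b.nonneg
              positivity
          have e : -τ * (f x ^ 2 * tanTrace (fderiv ℝ (fun x => b x • V x) x) (N x) - b x *
              (4 * f x * ((0 * fderiv ℝ u x (V x - ⟪V x, N x⟫ • N x) + v x * F x) / ε ^ 2))) =
              b x * (4 * f x * (v x * (τ * F x) / ε ^ 2)) -
              τ * (f x ^ 2 * tanTrace (fderiv ℝ (fun x => b x • V x) x) (N x)) := by ring
          rw [e]
          linarith
        · have hxT : x ∉ T := fun h' => hvε h'.2.2
          have hxS : x ∉ St := fun h' => hvε (h'.2.2.2.trans (by linarith))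
          have hfx : f x = 0 := cornerProfile_eq_zero hε fun h' => hvε ((le_abs_self _).trans h'.2)
          rw [indicator_of_notMem hxT, indicator_of_notMem hxS, hfx]
          simp
      · have hxT : x ∉ T := fun h' => hxb h'.2.1
        have hxS : x ∉ St := fun h' => hxb (hballb h'.2.1)
        have h0 : (fun x => (b x * f x ^ 2) • V x) =ᶠ[𝓝 x] fun _ => 0 := by
          filter_upwards [notMem_tsupport_iff_eventuallyEq.1 hxb] with y hy
          rw [hy]; simp
        rw [indicator_of_notMem hxT, indicator_of_notMem hxS, h0.fderiv_eq]
        simp [tanTrace]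
    have hStf : μHE[k + 1] St ≠ ∞ := ((measure_mono inter_subset_left).trans_lt hN.area_lt_top).ne
    have hint : ∀ (A : Set (RN (k + 2))) (a : ℝ), MeasurableSet A → A ⊆ M →
        IntegrableOn (A.indicator fun _ => a) M μHE[k + 1] ∧
          ∫ x in M, A.indicator (fun _ => a) x ∂μHE[k + 1] =
            a * (μHE[k + 1] : Measure (RN (k + 2))).real A := fun A a hA hAM => by
      refine ⟨IntegrableOn.indicator (integrableOn_const hN.area_lt_top.ne) hA, ?_⟩
      rw [setIntegral_indicator hA, inter_eq_self_of_subset_right hAM, setIntegral_const,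
        smul_eq_mul, mul_comm]
    have hi1 := hint St (κ / ε) hStm inter_subset_left
    have hi2 := hint T (|τ| * |B|) hTm inter_subset_left
    have hle := setIntegral_mono_on (hi1.1.sub hi2.1)
      ((hN.integrableOn_tanTrace (hβ.smul hV)).const_mul (-τ)) hN.measurableSet hpt
    have e1 : ∫ x in M, -τ * tanTrace (fderiv ℝ (fun x => (b x * f x ^ 2) • V x) x) (N x)
        ∂μHE[k + 1] = -τ * firstVar M N (fun x => (b x * f x ^ 2) • V x) := integral_const_mul _ _
    have e2 : ∫ x in M, (St.indicator (fun _ => κ / ε) x - T.indicator (fun _ => |τ| * |B|) x)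
        ∂μHE[k + 1] = κ / ε * (μHE[k + 1] : Measure (RN (k + 2))).real St -
          |τ| * |B| * (μHE[k + 1] : Measure (RN (k + 2))).real T := by
      rw [integral_sub hi1.1 hi2.1, hi1.2, hi2.2]
    have hle' : κ / ε * (μHE[k + 1] : Measure (RN (k + 2))).real St -
        |τ| * |B| * (μHE[k + 1] : Measure (RN (k + 2))).real T ≤
          -τ * firstVar M N (fun x => (b x * f x ^ 2) • V x) := by
      rw [← e1, ← e2]; exact hle
    have hub : -τ * firstVar M N (fun x => (b x * f x ^ 2) • V x) ≤ |τ| * (|l| * (C * ε)) := by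
      rw [hbal']
      refine (le_abs_self _).trans ?_
      rw [abs_mul, abs_mul, abs_neg]
      gcongr
      exact hC ε hε hε1
    have hlow : c * (ε / 4) ≤ (μHE[k + 1] : Measure (RN (k + 2))).real St := by
      have h1 := hstrip (ε / 4) (ε / 2) (by positivity) (by linarith)
      have h2 : M ∩ Metric.closedBall p (R / 2) ∩ s ∩ {x | ε / 4 ≤ Ψ x 1 ∧ Ψ x 1 ≤ ε / 2} ⊆ St :=
        fun x hx => ⟨hx.1.1.1, hx.1.1.2, hx.2⟩
      have h3 := (ENNReal.ofReal_le_iff_le_toReal hStf).1 (h1.trans (measure_mono h2))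
      calc c * (ε / 4) = c * (ε / 2 - ε / 4) := by ring
        _ ≤ _ := h3
    have hκ0 : 0 ≤ κ / ε := by positivity
    have h5 := mul_le_mul_of_nonneg_left hlow hκ0
    have h6 : κ / ε * (c * (ε / 4)) = κ * c / 4 := by field_simp
    linarith
  have hlim : Tendsto (fun ε : ℝ => |τ| * |B| *
      (μHE[k + 1] : Measure (RN (k + 2))).real (M ∩ (tsupport b ∩ {x | Ψ x 1 ≤ ε})) +
        |τ| * (|l| * (C * ε))) (𝓝[>] 0) (𝓝 0) := by
    have ht0 : Tendsto (fun ε : ℝ => ε) (𝓝[>] 0) (𝓝 0) := tendsto_id.mono_left nhdsWithin_le_nhds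
    have := ((h.tendsto_area_strip hM hN (isClosed_tsupport b) hbs).const_mul (|τ| * |B|)).add
      (((ht0.const_mul C).const_mul |l|).const_mul |τ|)
    simpa using this
  have hfin : κ * c / 4 ≤ 0 := by
    refine ge_of_tendsto hlim ?_
    filter_upwards [Ioo_mem_nhdsGT (lt_min one_pos hr₀)] with ε hε
    exact key ε hε.1 (hε.2.le.trans (min_le_left _ _)) (hε.2.le.trans (min_le_right _ _))
  have : 0 < κ * c / 4 := by positivity
  linarith

/-- The hypersurface of a minimal partitioning meets the boundary of the container orthogonally. -/
theorem IsMinimalPartitioning.normal_mem_tangentBd {Ω Ω₁ Ω₂ : Set (RN (k + 2))}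
    (hM : IsMinimalPartitioning Ω M N Ω₁ Ω₂) (hp : p ∈ bdry M) : N p ∈ tangentBd Ω p := by
  obtain ⟨l, hl⟩ := hM.exists_multiplier ⟨p, hp⟩
  have hρ := (hM.container.smooth p hp).isDefiningFunction
  obtain ⟨U, m, g, hg⟩ := hρ.exists_isGraphChart
  obtain ⟨r, hr, htame⟩ := IsMultiplier.exists_isTame_chart hl hM.toIsPartitioning (m := m) (g := g)
    (hg.isOpen.mem_nhds hg.mem)
  obtain ⟨Ψ, K, s, hΨ, -⟩ := exists_isBdryChart hp univ_mem
  have hNp := hM.isFlatAlong.norm_eq p hp.1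
  obtain ⟨x, hx, hxv⟩ := hΨ.exists_inner_eq_zero hM.isFlatAlong
  change fderiv ℝ (definingFunction Ω p) p (N p) = 0
  set ℓ := fderiv ℝ (definingFunction Ω p) p
  by_contra hℓ
  -- if the normal is not tangent to `∂Ω`, each `x ∈ T_p M` is the projection of a tangent vector
  -- of `∂Ω`
  set w := x - (ℓ x / ℓ (N p)) • N p with hw
  have hwT : ℓ w = 0 := by
    rw [hw, map_sub, map_smul, smul_eq_mul, div_mul_cancel₀ _ hℓ, sub_self]
  have hwN : ⟪w, N p⟫ = -(ℓ x / ℓ (N p)) := by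
    rw [hw, inner_sub_left, inner_smul_left, real_inner_self_eq_norm_sq, hNp, real_inner_comm, hx]
    simp
  have hwx : w - ⟪w, N p⟫ • N p = x := by
    rw [hwN, hw]
    module
  have hwe := hg.eq_of_mem_ker hg.mem (hM.container.bdry_subset hp) hρ hwT
  have hch := hg.isShearChart (hg.inner_proj w)
  have hV : ContDiff ℝ 1 fun x => (w - ⟪m, w⟫ • m) + fderiv ℝ g x (w - ⟪m, w⟫ • m) • m :=
    contDiff_const.add (((hg.contDiff.fderiv_right (m := 1) (by norm_num)).clm_apply
      contDiff_const).smul contDiff_const)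
  have h0 := hΨ.fderiv_tangential_eq_zero hM.hypersurface hM.isFlatAlong hM.isOpen₁.measurableSet hV
    hr fun β hβ hβr => (htame _ hch β hβ hβr).firstVar_eq
  simp only [← hwe, hwx] at h0
  exact hxv h0

end

/-! ### Partitioning of another container -/

/-- The radial retraction of `ℝⁿ` onto the closure of an open convex set, with centre `c`. -/
theorem exists_radial_retraction {n : ℕ} {Ω : Set (RN n)} (hΩ : Convex ℝ Ω) (ho : IsOpen Ω)
    {c : RN n} (hc : c ∈ Ω) : ∃ r : RN n → RN n, Continuous r ∧ (∀ x, r x ∈ closure Ω) ∧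
      (∀ x ∈ closure Ω, r x = x) ∧ ∀ x ∉ closure Ω, r x ∉ Ω ∧ r x ∈ openSegment ℝ c x := by
  set e := Homeomorph.addLeft c with he
  set s := e ⁻¹' Ω with hs
  have hso : IsOpen s := ho.preimage e.continuous
  have hsc : Convex ℝ s := hΩ.translate_preimage_right c
  have hs0 : s ∈ 𝓝 0 := hso.mem_nhds (by simpa [hs, he] using hc)
  have hgc : Continuous (gauge s) := continuous_gauge hsc hs0
  have hcl : ∀ x, x ∈ closure Ω ↔ gauge s (x - c) ≤ 1 := fun x => by
    rw [gauge_le_one_iff_mem_closure hsc hs0, hs, ← e.preimage_closure]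
    simp [he]
  have hin : ∀ x, x ∈ Ω ↔ gauge s (x - c) < 1 := fun x => by
    rw [gauge_lt_one_iff_mem_interior hsc hs0, hso.interior_eq]
    simp [hs, he]
  set G : RN n → ℝ := fun x => max 1 (gauge s (x - c)) with hG
  have hG1 : ∀ x, 1 ≤ G x := fun x => le_max_left _ _
  have hGpos : ∀ x, 0 < G x := fun x => one_pos.trans_le (hG1 x)
  have hGc : Continuous G := continuous_const.max (hgc.comp (continuous_id.sub continuous_const))
  have hgr : ∀ x, gauge s (c + (G x)⁻¹ • (x - c) - c) = (G x)⁻¹ * gauge s (x - c) := fun x => by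
    rw [add_sub_cancel_left, gauge_smul_of_nonneg (inv_nonneg.2 (hGpos x).le), smul_eq_mul]
  refine ⟨fun x => c + (G x)⁻¹ • (x - c), ?_, fun x => ?_, fun x hx => ?_, fun x hx => ⟨?_, ?_⟩⟩
  · exact continuous_const.add ((hGc.inv₀ fun x => (hGpos x).ne').smul
      (continuous_id.sub continuous_const))
  · rw [hcl, hgr, inv_mul_le_iff₀ (hGpos x), mul_one]
    exact le_max_right _ _
  · have : G x = 1 := max_eq_left ((hcl x).1 hx)
    simp [this]
  · have h1 : 1 < gauge s (x - c) := not_le.1 fun h => hx ((hcl x).2 h)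
    have h2 : G x = gauge s (x - c) := max_eq_right h1.le
    rw [hin, hgr, h2, inv_mul_cancel₀ (by linarith)]
    exact lt_irrefl _
  · have h1 : 1 < gauge s (x - c) := not_le.1 fun h => hx ((hcl x).2 h)
    have h2 : G x = gauge s (x - c) := max_eq_right h1.le
    have h3 : (G x)⁻¹ < 1 := inv_lt_one_of_one_lt₀ (by rw [h2]; exact h1)
    refine ⟨1 - (G x)⁻¹, (G x)⁻¹, by linarith, inv_pos.2 (hGpos x), by ring, ?_⟩
    module

section

variable {Ω M Ω₁ Ω₂ : Set (RN (k + 2))} {N : RN (k + 2) → RN (k + 2)}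

/-- Near each point of `closure Ω` off `M`, only one of the phases is present. -/
theorem IsPartitioning.mem_interior_or (hΩ : Convex ℝ Ω) (hM : IsPartitioning Ω M N Ω₁ Ω₂)
    {y : RN (k + 2)} (hy : y ∉ M) :
    y ∈ interior (Ω₁ ∪ Ωᶜ) ∨ y ∈ interior (Ω₂ ∪ Ωᶜ) := by
  obtain ⟨ε, hε, hball⟩ := Metric.isOpen_iff.1 hM.hypersurface.1.isClosed.isOpen_compl y hy
  have hsub : Metric.ball y ε ∩ Ω ⊆ Ω₁ ∪ Ω₂ := by
    rw [hM.union]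
    exact fun x hx => ⟨hx.2, hball hx.1⟩
  have hpre : IsPreconnected (Metric.ball y ε ∩ Ω) := ((convex_ball y ε).inter hΩ).isPreconnected
  have hmem : ∀ A, Metric.ball y ε ∩ Ω ⊆ A → y ∈ interior (A ∪ Ωᶜ) := fun A hA => by
    refine mem_interior.2 ⟨Metric.ball y ε, fun x hx => ?_, Metric.isOpen_ball,
      Metric.mem_ball_self hε⟩
    by_cases hxΩ : x ∈ Ω
    · exact Or.inl (hA ⟨hx, hxΩ⟩)
    · exact Or.inr hxΩ
  exact (hpre.subset_or_subset hM.isOpen₁ hM.isOpen₂ hM.disjoint hsub).imp (hmem _) (hmem _)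

/-- A convex container of `M` is partitioned by `M`, into phases that agree, where the two containers
overlap, with those of the given convex container `Ω`: the phase of a point outside `Ω` is that of its
radial projection to `∂Ω`. -/
theorem IsPartitioning.exists_of_isContainer (hΩ : Convex ℝ Ω) (hM : IsPartitioning Ω M N Ω₁ Ω₂)
    {c : RN (k + 2)} (hc : c ∈ M \ bdry M) {Ω' : Set (RN (k + 2))} (hΩ' : Convex ℝ Ω')
    (hM' : IsContainer Ω' M) : ∃ Ω₁' Ω₂', IsPartitioning Ω' M N Ω₁' Ω₂' ∧ Ω₁' ∩ Ω = Ω₁ ∩ Ω' := by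
  obtain ⟨r, hr, hrcl, hrid, hrout⟩ :=
    exists_radial_retraction hΩ hM.container.isOpen (hM.container.interior_subset hc)
  have hMcl : IsClosed M := hM.hypersurface.1.isClosed
  -- If a point `x` of `Ω'` outside `Ω` projected to `∂M`, then this point of `∂Ω'` would lie on a
  -- segment with endpoints in the convex open set `Ω'`.
  have hrM : ∀ x ∈ Ω' \ M, r x ∉ M := by
    rintro x ⟨hx, hxM⟩ hrxM
    by_cases hxcl : x ∈ closure Ω
    · rw [hrid x hxcl] at hrxM
      exact hxM hrxM
    · obtain ⟨h1, h2⟩ := hrout x hxcl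
      have hb : r x ∈ bdry M := by
        by_contra h
        exact h1 (hM.container.interior_subset ⟨hrxM, h⟩)
      have h3 : r x ∈ Ω' := hΩ'.openSegment_subset (hM'.interior_subset hc) hx h2
      have h4 := hM'.bdry_subset hb
      rw [hM'.isOpen.frontier_eq] at h4
      exact h4.2 h3
  let P : Set (RN (k + 2)) → Set (RN (k + 2)) := fun A => (Ω' \ M) ∩ r ⁻¹' interior (A ∪ Ωᶜ)
  have hPo : ∀ A, IsOpen (P A) := fun A =>
    (hM'.isOpen.sdiff hMcl).inter (isOpen_interior.preimage hr)
  have hPΩ : ∀ A, IsOpen A → A ⊆ Ω \ M → P A ∩ Ω = A ∩ Ω' := fun A hA hAΩ => by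
    ext x
    constructor
    · rintro ⟨⟨hx, hxr⟩, hxΩ⟩
      rw [mem_preimage, hrid x (subset_closure hxΩ)] at hxr
      exact ⟨(interior_subset hxr).resolve_right fun h => h hxΩ, hx.1⟩
    · rintro ⟨hxA, hx⟩
      refine ⟨⟨⟨hx, (hAΩ hxA).2⟩, ?_⟩, (hAΩ hxA).1⟩
      rw [mem_preimage, hrid x (subset_closure (hAΩ hxA).1)]
      exact interior_mono subset_union_left (by rwa [hA.interior_eq])
  have h₁ : Ω₁ ⊆ Ω \ M := by rw [← hM.union]; exact subset_union_left
  have h₂ : Ω₂ ⊆ Ω \ M := by rw [← hM.union]; exact subset_union_right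
  refine ⟨P Ω₁, P Ω₂, ⟨hM.hypersurface, hM', hM.normal, hPo _, hPo _, ?_, ?_, fun p hp => ?_⟩,
    hPΩ _ hM.isOpen₁ h₁⟩
  · rw [Set.disjoint_left]
    rintro x ⟨-, hx1⟩ ⟨-, hx2⟩
    obtain ⟨y, ⟨hy1, hy2⟩, hyΩ⟩ := mem_closure_iff.1 (hrcl x) _
      (isOpen_interior.inter isOpen_interior) ⟨hx1, hx2⟩
    exact Set.disjoint_left.1 hM.disjoint ((interior_subset hy1).resolve_right fun h => h hyΩ)
      ((interior_subset hy2).resolve_right fun h => h hyΩ)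
  · refine Subset.antisymm (union_subset (fun x hx => hx.1) fun x hx => hx.1) fun x hx => ?_
    exact (hM.mem_interior_or hΩ (hrM x hx)).imp (fun h => ⟨hx, h⟩) fun h => ⟨hx, h⟩
  · have hlim : ∀ a : ℝ, Tendsto (fun t : ℝ => p + (a * t) • N p) (𝓝[>] 0) (𝓝 p) := fun a => by
      have : Continuous fun t : ℝ => p + (a * t) • N p := by fun_prop
      have h := this.tendsto 0
      simp only [mul_zero, zero_smul, add_zero] at h
      exact h.mono_left nhdsWithin_le_nhds
    have hnear := hM'.isOpen.mem_nhds (hM'.interior_subset hp)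
    filter_upwards [hM.sides p hp, (hlim (-1)).eventually hnear, (hlim 1).eventually hnear]
      with t ht hm hpl
    have e1 : p + (-1 * t) • N p = p - t • N p := by module
    rw [e1] at hm
    rw [one_mul] at hpl
    have a1 : p - t • N p ∈ Ω₁ ∩ Ω' := ⟨ht.1, hm⟩
    have a2 : p + t • N p ∈ Ω₂ ∩ Ω' := ⟨ht.2, hpl⟩
    rw [← hPΩ _ hM.isOpen₁ h₁] at a1
    rw [← hPΩ _ hM.isOpen₂ h₂] at a2
    exact ⟨a1.1, a2.1⟩

end

/-! ### Instability -/

section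

variable {Ω M Ω₁ Ω₂ : Set (RN (k + 2))} {N : RN (k + 2) → RN (k + 2)} {p : RN (k + 2)}

/-- The area of `M` is positive near each point of `∂M`. -/
theorem area_inter_ne_zero_of_mem_bdry (hp : p ∈ bdry M)
    {W : Set (RN (k + 2))} (hW : W ∈ 𝓝 p) : μHE[k + 1] (M ∩ W) ≠ 0 := by
  obtain ⟨Ψ, K, s, h, -⟩ := exists_isBdryChart hp univ_mem
  obtain ⟨c, hc, r, hr, hstrip⟩ := h.exists_le_measure_strip hW
  intro h0
  have h1 := hstrip 0 r le_rfl le_rfl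
  rw [measure_mono_null (fun x hx => hx.1.1) h0, le_zero_iff, ENNReal.ofReal_eq_zero] at h1
  have : 0 < c * (r - 0) := by rw [sub_zero]; positivity
  linarith

theorem setIntegral_sq_pos {μ : Measure (RN (k + 2))} {A : Set (RN (k + 2))} (hA : IsCompact A)
    (hμ : μ A < ∞) {f : RN (k + 2) → ℝ} (hf : Continuous f) (hfp : f p ≠ 0)
    (hp : ∀ W ∈ 𝓝 p, μ (A ∩ W) ≠ 0) : 0 < ∫ x in A, f x ^ 2 ∂μ := by
  obtain ⟨C, hC⟩ := hA.exists_bound_of_continuousOn (hf.pow 2).continuousOn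
  have hi : IntegrableOn (fun x => f x ^ 2) A μ := IntegrableOn.of_bound hμ
    ((hf.pow 2).continuousOn.aestronglyMeasurable hA.measurableSet) C
      ((ae_restrict_iff' hA.measurableSet).2 (Eventually.of_forall hC))
  rw [setIntegral_pos_iff_support_of_nonneg_ae (Eventually.of_forall fun x => sq_nonneg (f x)) hi]
  have hs : (Function.support fun x => f x ^ 2) ∈ 𝓝 p := by
    have : (Function.support fun x => f x ^ 2) = {x | f x ≠ 0} := by
      ext x
      simp
    rw [this]
    exact (isOpen_ne_fun hf continuous_const).mem_nhds hfp
  rw [inter_comm]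
  exact pos_iff_ne_zero.2 (hp _ hs)

/-- A normalized function that satisfies the volume constraint and does not vanish identically on
`∂M`. -/
theorem IsPartitioning.exists_test_function (hM : IsPartitioning Ω M N Ω₁ Ω₂) (hp : p ∈ bdry M) :
    ∃ f : RN (k + 2) → ℝ, ContDiff ℝ 1 f ∧ (∫ x in M, f x ∂μHE[k + 1]) = 0 ∧
      (∫ x in M, f x ^ 2 ∂μHE[k + 1]) = 1 ∧ 0 < ∫ x in bdry M, f x ^ 2 ∂μHE[k] := by
  have hflat := hM.isFlatAlong
  have hH := hM.hypersurface
  set μ : Measure (RN (k + 2)) := μHE[k + 1] with hμ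
  set g : RN (k + 2) → ℝ := fun x => ‖x - p‖ ^ 2 with hg
  have hgc : ContDiff ℝ 1 g := (contDiff_id.sub contDiff_const).norm_sq ℝ
  have hA : μ M ≠ 0 := by simpa using area_inter_ne_zero_of_mem_bdry hp univ_mem
  have hA' : 0 < μ.real M := ENNReal.toReal_pos hA hflat.area_lt_top.ne
  have hI : 0 < ∫ x in M, g x ∂μ := by
    rw [setIntegral_pos_iff_support_of_nonneg_ae (Eventually.of_forall fun x => sq_nonneg _)
      (hflat.integrableOn hgc.continuous.continuousOn)]
    refine pos_iff_ne_zero.2 fun h0 => hA ?_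
    refine measure_mono_null (t := (Function.support g ∩ M) ∪ bdry M) (fun x hx => ?_)
      (measure_union_null h0 hH.area_bdry_eq_zero)
    by_cases hxp : x = p
    · exact Or.inr (hxp ▸ hp)
    · refine Or.inl ⟨?_, hx⟩
      simpa [hg, sub_eq_zero] using hxp
  -- The mean of `‖x - p‖²` is positive, so that `f₀` has mean zero and does not vanish at `p ∈
  -- ∂M`.
  set a := (∫ x in M, g x ∂μ) / μ.real M with ha
  have ha0 : 0 < a := by positivity
  set f₀ : RN (k + 2) → ℝ := fun x => a - g x with hf₀
  have hf₀c : ContDiff ℝ 1 f₀ := contDiff_const.sub hgc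
  have hf₀p : f₀ p ≠ 0 := by simp [hf₀, hg, ha0.ne']
  have h1 : ∫ x in M, f₀ x ∂μ = 0 := by
    have hi : IntegrableOn (fun _ => a) M μ := hflat.integrableOn continuousOn_const
    have hi' : IntegrableOn g M μ := hflat.integrableOn hgc.continuous.continuousOn
    have e : ∫ x in M, f₀ x ∂μ = (∫ x in M, a ∂μ) - ∫ x in M, g x ∂μ := integral_sub hi hi'
    rw [e, setIntegral_const, smul_eq_mul, ha, mul_div_cancel₀ _ hA'.ne', sub_self]
  have h2 : 0 < ∫ x in M, f₀ x ^ 2 ∂μ := setIntegral_sq_pos hflat.isCompact hflat.area_lt_top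
    hf₀c.continuous hf₀p fun W hW => area_inter_ne_zero_of_mem_bdry hp hW
  have h3 : 0 < ∫ x in bdry M, f₀ x ^ 2 ∂μHE[k] := setIntegral_sq_pos hH.isCompact_bdry
    hH.measure_bdry_lt_top hf₀c.continuous hf₀p fun W hW => IsHypersurface.measure_bdry_inter_ne_zero hp hW
  set d := (Real.sqrt (∫ x in M, f₀ x ^ 2 ∂μ))⁻¹ with hd
  have hd2 : d ^ 2 = (∫ x in M, f₀ x ^ 2 ∂μ)⁻¹ := by rw [hd, inv_pow, Real.sq_sqrt h2.le]
  have hsq : ∀ x, (d * f₀ x) ^ 2 = d ^ 2 * f₀ x ^ 2 := fun x => mul_pow _ _ _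
  refine ⟨fun x => d * f₀ x, contDiff_const.mul hf₀c, ?_, ?_, ?_⟩
  · exact (integral_const_mul d f₀).trans (by rw [h1, mul_zero])
  · simp only [hsq]
    refine (integral_const_mul (d ^ 2) fun x => f₀ x ^ 2).trans ?_
    rw [hd2, inv_mul_cancel₀ h2.ne']
  · simp only [hsq]
    refine lt_of_lt_of_eq ?_ (integral_const_mul (d ^ 2) fun x => f₀ x ^ 2).symm
    rw [hd2]
    exact mul_pos (inv_pos.2 h2) h3

/-- The boundary term of the second variation is at least `σ ∫ f²` if `II(N, N) ≥ σ`. This needs the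
integrability of `II(N, N) f²`, hence the tangency of `N` to `∂Ω`: otherwise the values of `II(N, N)`
could depend on the choice of defining functions in a nonmeasurable way. -/
theorem IsHypersurface.le_integral_IIbd (hM : IsHypersurface M) (hΩ : IsContainer Ω M)
    (hN : ContinuousOn N (bdry M)) (hT : ∀ q ∈ bdry M, N q ∈ tangentBd Ω q) {σ : ℝ}
    (hσ : ∀ q ∈ bdry M, σ ≤ IIbd Ω q (N q) (N q)) {f : RN (k + 2) → ℝ} (hf : Continuous f) :
    σ * ∫ x in bdry M, f x ^ 2 ∂μHE[k] ≤
      ∫ x in bdry M, IIbd Ω x (N x) (N x) * f x ^ 2 ∂μHE[k] := by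
  have hint : ∀ h : RN (k + 2) → ℝ, ContinuousOn h (bdry M) →
      IntegrableOn h (bdry M) μHE[k] := fun h hh => by
    obtain ⟨C, hC⟩ := hM.isCompact_bdry.exists_bound_of_continuousOn hh
    exact IntegrableOn.of_bound hM.measure_bdry_lt_top
      (hh.aestronglyMeasurable hM.isCompact_bdry.measurableSet) C
      ((ae_restrict_iff' hM.isCompact_bdry.measurableSet).2 (Eventually.of_forall hC))
  rw [← integral_const_mul]
  refine setIntegral_mono_on (hint _ (continuous_const.mul (hf.pow 2)).continuousOn)
    (hint _ ((hΩ.continuousOn_IIbd hN hT).mul (hf.pow 2).continuousOn))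
    hM.isCompact_bdry.measurableSet fun x hx => ?_
  exact mul_le_mul_of_nonneg_right (hσ x hx) (sq_nonneg _)

/-- The second variation in `Ω'` is at most `C - σ I`, where neither `C` nor `I = ∫_{∂M} f² > 0`
depends on the container. -/
theorem IsMinimalPartitioning.exists_unstable (hΩ : Convex ℝ Ω)
    (hM : IsMinimalPartitioning Ω M N Ω₁ Ω₂) (hb : (bdry M).Nonempty) (hH : HypothesisH Ω M N) :
    ∃ Ω' Ω₁' Ω₂' : Set (RN (k + 2)), Convex ℝ Ω' ∧ IsUnstablePartitioning Ω' M N Ω₁' Ω₂' := by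
  obtain ⟨p, hp⟩ := id hb
  obtain ⟨f, hf, hf1, hf2, hf3⟩ := hM.exists_test_function hp
  obtain ⟨c, hc⟩ : (M \ bdry M).Nonempty := by
    rw [nonempty_iff_ne_empty]
    intro h
    have h1 := area_inter_ne_zero_of_mem_bdry hp univ_mem
    rw [inter_univ] at h1
    exact h1 (measure_mono_null (sdiff_eq_empty.1 h) hM.hypersurface.area_bdry_eq_zero)
  -- the part of the second variation that does not depend on the container
  set C := ∫ p in M, (‖tangGrad N f p‖ ^ 2 - normSqB M p * f p ^ 2) ∂μHE[k + 1] with hC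
  set I := ∫ x in bdry M, f x ^ 2 ∂μHE[k] with hI
  obtain ⟨σ, ⟨Ω', hΩ', hΩM, hσ⟩, hσC⟩ := (hH.and (eventually_gt_atTop (C / I))).exists
  obtain ⟨Ω₁', Ω₂', hM', hphase⟩ := hM.exists_of_isContainer hΩ hc hΩ' hΩM
  have hmin := hM.of_tangent hb hM' (fun q hq => (hσ q hq).1) hphase
  refine ⟨Ω', Ω₁', Ω₂', hΩ', hmin, f, hf, hf1, hf2, ?_⟩
  have h1 := hM.hypersurface.le_integral_IIbd hΩM (hM.normal.1.mono fun q hq => hq.1)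
    (fun q hq => by rw [(hσ q hq).1]; exact hM.normal_mem_tangentBd hq) (fun q hq => (hσ q hq).2)
    hf.continuous
  have h2 : C < σ * I := (div_lt_iff₀ hf3).1 hσC
  change C - ∫ x in bdry M, IIbd Ω' x (N x) (N x) * f x ^ 2 ∂μHE[k] < 0
  linarith

/-- A hypersurface with nonempty boundary has dimension at least one. -/
theorem two_le_of_isBoundaryPoint {n : ℕ} {M : Set (RN n)} {p : RN n} (h : IsBoundaryPoint M p) :
    2 ≤ n := by
  obtain ⟨u, v, -, -, -, -, hli, -⟩ := h
  let e := (InnerProductSpace.toDual ℝ (RN n)).symm.toLinearEquiv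
  have h1 := hli.map' (M' := RN n) e.toLinearMap e.ker
  simpa using h1.fintype_card_le_finrank

end

end

theorem mainTheorem6 {n : ℕ} (Ω M : Set (RN n)) (N : RN n → RN n) (Ω₁ Ω₂ : Set (RN n))
    (hΩ : Convex ℝ Ω) (hM : IsMinimalPartitioning Ω M N Ω₁ Ω₂)
    (hbdry : (bdry M).Nonempty) (hH : HypothesisH Ω M N) :
    ∃ Ωstar Ω₁star Ω₂star : Set (RN n), Convex ℝ Ωstar ∧
      IsUnstablePartitioning Ωstar M N Ω₁star Ω₂star := by
  obtain ⟨k, rfl⟩ : ∃ k, n = k + 2 := by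
    obtain ⟨p, hp⟩ := hbdry
    exact Nat.exists_eq_add_of_le' (two_le_of_isBoundaryPoint hp.2)
  exact hM.exists_unstable hΩ hbdry hH
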